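/- For a locally integrable $f:\mathbb{C}\to\mathbb{C}$ and $\varepsilon>0$ let $$B^{\varepsilon}f(z)=\frac1\pi\int_{|w|>\varepsilon}\frac{f(z-w)}{w^2}\,dA(w) :=\lim_{R\to\infty}\frac1\pi\int_{\varepsilon<|w|<R}\frac{f(z-w)}{w^2}\,dA(w),$$ where $dA$ is Lebesgue measure in the plane (if $f\in L^q(\mathbb{C})$ with $1\le q<\infty$ the integral converges absolutely). Let $Bf(z)=\lim_{\varepsilon\to0^+}B^{\varepsilon}f(z)$ be the Beurling transform (a principal value) and $B^{\star}f(z)=\sup_{\varepsilon>0}|B^{\varepsilon}f(z)|$ the maximal Beurling transform, and write $\|h\|_{1,\infty}=\sup_{t>0}t\,|\{z:|h(z)|>t\}|$. If $f\in L^q(\mathbb{C})$ with $1\le q<\infty$, then $Bf$ is defined almost everywhere, by a classical theorem; for $f\in L^\infty(\mathbb{C})$ put $\|Bf\|_1=\infty$ if the limits defining $Bf$ do not exist almost everywhere. Theorem. There is an absolute constant $C$ such that $$\|B^{\star}f\|_{1,\infty}\le C\,\|Bf\|_1$$ for every function $f$ that belongs to $L^q(\mathbb{C})$ for some $q$ with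 $1\le q\le\infty$. -/

import Mathlib

open MeasureTheory Filter Topology
open scoped ENNReal NNReal

noncomputable section

/-- The doubly truncated Beurling integral `π⁻¹ ∫_{ε < |w| < R} f(z - w) / w² dA(w)`. For `ε > 0` the
kernel is bounded on this annulus, so the integrand is integrable for every locally integrable
`f`. -/
def beurlingAnnulus (f : ℂ → ℂ) (ε R : ℝ) (z : ℂ) : ℂ :=
  ((Real.pi : ℂ))⁻¹ * ∫ w in {w : ℂ | ε < ‖w‖ ∧ ‖w‖ < R}, f (z - w) / w ^ 2

/-- The truncation `B^ε f(z) = π⁻¹ ∫_{|w| > ε} f(z - w) / w² dA(w)`, where the integral is the limit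
of the integrals over `ε < |w| < R` as `R → ∞`. Where the integral converges absolutely (always,
if `f ∈ L^q` with `q < ∞`) this is the Lebesgue integral; for `f ∈ L^∞` the kernel is not
integrable at infinity and the integral may converge only in this sense, if at all. -/
def beurlingTrunc (f : ℂ → ℂ) (ε : ℝ) (z : ℂ) : ℂ :=
  limUnder atTop (fun R : ℝ => beurlingAnnulus f ε R z)

/-- `B^⋆ f(z) = sup_{ε > 0} |B^ε f(z)|`. -/
def maximalBeurling (f : ℂ → ℂ) (z : ℂ) : ℝ≥0∞ :=
  ⨆ (ε : ℝ) (_ : 0 < ε), ‖beurlingTrunc f ε z‖ₑ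

/-- The principal value `π⁻¹ PV ∫ f(z - w) / w² dA(w)` exists and equals `l`: all truncations
converge at infinity, and `B^ε f(z) → l` as `ε → 0⁺`. -/
def HasBeurlingPV (f : ℂ → ℂ) (z l : ℂ) : Prop :=
  (∀ ε : ℝ, 0 < ε → ∃ a : ℂ, Tendsto (fun R : ℝ => beurlingAnnulus f ε R z) atTop (𝓝 a)) ∧
    Tendsto (fun ε : ℝ => beurlingTrunc f ε z) (𝓝[>] 0) (𝓝 l)

/-- The Beurling transform `Bf(z)`, as a principal value (used only where it exists). -/
def beurling (f : ℂ → ℂ) (z : ℂ) : ℂ :=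
  limUnder (𝓝[>] (0 : ℝ)) (fun ε => beurlingTrunc f ε z)

open Classical in
/-- `‖Bf‖₁ ∈ [0, ∞]`. It is infinite by convention if `Bf` is not defined almost everywhere, which
can occur for `f ∈ L^∞`, but does not occur for `f ∈ L^q` with `1 ≤ q < ∞`. -/
def beurlingL1Norm (f : ℂ → ℂ) : ℝ≥0∞ :=
  if ∀ᵐ z : ℂ, ∃ l : ℂ, HasBeurlingPV f z l then ∫⁻ z : ℂ, ‖beurling f z‖ₑ else ⊤

/-- The weak `L¹` quasinorm `‖h‖_{1,∞} = sup_{t > 0} t |{z : h(z) > t}|` of `h : ℂ → [0, ∞]`. -/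
def weakL1Norm (h : ℂ → ℝ≥0∞) : ℝ≥0∞ :=
  ⨆ t : ℝ≥0, (t : ℝ≥0∞) * volume {z : ℂ | (t : ℝ≥0∞) < h z}

end

/-! Let g = Bf and suppose ‖g‖₁ < ∞. Everything rests on one identity: B^r f(z) is the mean of g
over the disc of radius r about z. It gives B^⋆f ≤ Mg pointwise, where M is the centred
Hardy–Littlewood maximal operator, and Vitali's covering lemma gives the weak bound with constant 25
= 5².

The identity comes from the function V_r(w) = conj w / (π max(|w|, r)²), called `cauchyKernel`. It
is Lipschitz, equals 1/(πw) outside the disc of radius r, and satisfies ∂̄V_r = `discKernel r` and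
∂V_r = -`truncKernel r`. Since V_r - V_R has compact support, it can be tested, after mollification,
against the distributional equation ∂̄g = -∂f. The outcome is that the integral over r < |w| < R is
the mean of g over the disc of radius r minus the mean over the disc of radius R
(`beurlingAnnulus_eq_sub`). The second mean is O(‖g‖₁ / R²) and disappears as R → ∞
(`beurlingTrunc_eq`).

The main difficulty is the equation ∂̄g = -∂f itself (`integral_wirtingerBar_mul_beurling`): g is
only an almost everywhere limit that happens to be integrable, and for q = 1 the truncations are not
controlled in L¹. Let φ = ∂̄ψ and let f₁ be the part of f near the support of ψ. Transposition turns
∫ φ B^ε f₁ into -∫ (disc average of ∂ψ) f₁, which tends to -∫ ∂ψ f₁. That the same integrals tend to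
the integral of φ against the pointwise limit is `tendsto_integral_mul_kernelConv`. There f₁ is
split by a Calderón–Zygmund decomposition whose exceptional set and bad part are as small as
desired. The good part is controlled in L² uniformly in ε, the bad part off the exceptional set by
Hörmander's condition, and Egorov's theorem gives uniform convergence off a further small set. On
the exceptional set the bad part has no absolute bound, but its integral against φ over the whole
plane is small by transposition.

The far part of f adds to B^ε f near the support of ψ a constant plus an absolutely convergent
integral, and both are annihilated by ∂̄ψ. This is what admits f in L^∞.

The L² bound avoids the Fourier transform: |∂̄V|² - |∂V|² is a Jacobian and has integral zero, so a
truncation has the same L² norm as a disc average, which is a contraction. -/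

/-! ### The kernels and their pointwise properties -/

/-- The Beurling kernel `1 / (π w²)` truncated to `|w| > r`. -/
noncomputable def truncKernel (r : ℝ) (w : ℂ) : ℂ :=
  if r < ‖w‖ then ((Real.pi : ℂ) * w ^ 2)⁻¹ else 0

/-- The normalized indicator of the closed disc of radius `r`. -/
noncomputable def discKernel (r : ℝ) (w : ℂ) : ℂ :=
  if r < ‖w‖ then 0 else ((Real.pi * r ^ 2 : ℝ) : ℂ)⁻¹

/-- The average of the Cauchy kernel `1 / (π w)` over discs of radius `r`. -/
noncomputable def cauchyKernel (r : ℝ) (w : ℂ) : ℂ :=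
  (starRingEnd ℂ w) / ((Real.pi * (max ‖w‖ r) ^ 2 : ℝ) : ℂ)

theorem measurable_truncKernel (r : ℝ) : Measurable (truncKernel r) := by
  unfold truncKernel
  exact Measurable.ite (measurableSet_lt measurable_const measurable_norm) (by fun_prop)
    measurable_const

theorem measurable_discKernel (r : ℝ) : Measurable (discKernel r) := by
  unfold discKernel
  exact Measurable.ite (measurableSet_lt measurable_const measurable_norm) (by fun_prop)
    measurable_const

theorem norm_truncKernel_of_lt {r : ℝ} {w : ℂ} (h : r < ‖w‖) :
    ‖truncKernel r w‖ = (Real.pi * ‖w‖ ^ 2)⁻¹ := by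
  simp [truncKernel, h, abs_of_pos Real.pi_pos, mul_comm]

theorem norm_truncKernel_le {r : ℝ} (hr : 0 < r) (w : ℂ) :
    ‖truncKernel r w‖ ≤ (Real.pi * r ^ 2)⁻¹ := by
  by_cases h : r < ‖w‖
  · rw [norm_truncKernel_of_lt h]
    have := Real.pi_pos
    gcongr
  · simp only [truncKernel, h, if_false, norm_zero]
    positivity

theorem norm_discKernel_le {r : ℝ} (w : ℂ) :
    ‖discKernel r w‖ ≤ (Real.pi * r ^ 2)⁻¹ := by
  by_cases h : r < ‖w‖
  · simp only [discKernel, h, if_true, norm_zero]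
    positivity
  · simp [discKernel, h, abs_of_pos Real.pi_pos, mul_comm]

/-- The reflected projection onto the unit disc is a contraction. -/
theorem norm_conj_div_sub_le (w z : ℂ) :
    ‖(starRingEnd ℂ w) / ((max ‖w‖ 1 ^ 2 : ℝ) : ℂ) - (starRingEnd ℂ z) / ((max ‖z‖ 1 ^ 2 : ℝ) : ℂ)‖
      ≤ ‖w - z‖ := by
  have mixed : ∀ w z : ℂ, ‖w‖ ≤ 1 → 1 < ‖z‖ →
      ‖(starRingEnd ℂ w) / ((max ‖w‖ 1 ^ 2 : ℝ) : ℂ) -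
        (starRingEnd ℂ z) / ((max ‖z‖ 1 ^ 2 : ℝ) : ℂ)‖ ≤ ‖w - z‖ := by
    intro w z hw hz
    rw [max_eq_right hw, max_eq_left hz.le]
    have e : (starRingEnd ℂ w) / ((1 ^ 2 : ℝ) : ℂ) - (starRingEnd ℂ z) / ((‖z‖ ^ 2 : ℝ) : ℂ)
        = starRingEnd ℂ (w - (((‖z‖ ^ 2)⁻¹ : ℝ) : ℂ) * z) := by
      simp [div_eq_mul_inv, mul_comm]
    rw [e, RCLike.norm_conj]
    apply le_of_sq_le_sq _ (norm_nonneg _)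
    set t : ℝ := (‖z‖ ^ 2)⁻¹ with ht
    have ht1 : t < 1 := inv_lt_one_of_one_lt₀ (by nlinarith)
    have htz : t * ‖z‖ ^ 2 = 1 := inv_mul_cancel₀ (by positivity)
    rw [← Complex.normSq_eq_norm_sq, ← Complex.normSq_eq_norm_sq, Complex.normSq_sub,
      Complex.normSq_sub]
    have h1 : (w * starRingEnd ℂ ((t : ℂ) * z)).re = t * (w * starRingEnd ℂ z).re := by
      simp; ring
    have h2 : Complex.normSq ((t : ℂ) * z) = t ^ 2 * ‖z‖ ^ 2 := by
      rw [Complex.normSq_eq_norm_sq, norm_mul, mul_pow]; simp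
    have h3 : (w * starRingEnd ℂ z).re ≤ ‖z‖ := by
      refine (Complex.re_le_norm _).trans ?_
      rw [norm_mul, RCLike.norm_conj]
      nlinarith [norm_nonneg z]
    rw [h1, h2, Complex.normSq_eq_norm_sq z]
    -- With t = |z|⁻², the difference |w - z|² - |w - tz|² equals (1 - t)(|z|² + 1 - 2 Re(w conj
    -- z)), which is at least (1 - t)(|z| - 1)² because Re(w conj z) ≤ |z|.
    nlinarith [sq_nonneg (‖z‖ - 1), mul_nonneg (sub_nonneg.2 ht1.le) (sq_nonneg (‖z‖ - 1)),
      mul_nonneg (sub_nonneg.2 ht1.le) (sub_nonneg.2 h3)]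
  rcases le_or_gt ‖w‖ 1 with hw | hw <;> rcases le_or_gt ‖z‖ 1 with hz | hz
  · rw [max_eq_right hw, max_eq_right hz]
    simp only [one_pow, Complex.ofReal_one, div_one]
    rw [← map_sub, RCLike.norm_conj]
  · exact mixed w z hw hz
  · rw [norm_sub_rev, norm_sub_rev w]
    exact mixed z w hz hw
  · rw [max_eq_left hw.le, max_eq_left hz.le]
    have hw0 : w ≠ 0 := norm_pos_iff.1 (by linarith)
    have hz0 : z ≠ 0 := norm_pos_iff.1 (by linarith)
    have e : ∀ u : ℂ, u ≠ 0 → (starRingEnd ℂ u) / ((‖u‖ ^ 2 : ℝ) : ℂ) = u⁻¹ := by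
      intro u hu
      rw [Complex.inv_def, Complex.normSq_eq_norm_sq, div_eq_mul_inv, Complex.ofReal_inv]
    rw [e w hw0, e z hz0, inv_sub_inv hw0 hz0, norm_div, norm_mul, norm_sub_rev]
    exact div_le_self (norm_nonneg _) (by nlinarith)

/-- By scaling, the kernel is (πr)⁻¹ times the reflected projection onto the unit disc at w/r. The
Lipschitz property permits integration by parts across the circle |w| = r, where the kernel is not
differentiable. -/
theorem lipschitzWith_cauchyKernel {r : ℝ} (hr : 0 < r) :
    LipschitzWith (Real.toNNReal (Real.pi * r ^ 2)⁻¹) (cauchyKernel r) := by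
  apply LipschitzWith.of_dist_le_mul
  intro w z
  rw [Real.coe_toNNReal _ (by positivity), dist_eq_norm, dist_eq_norm]
  have e : ∀ u : ℂ, cauchyKernel r u = ((Real.pi * r : ℝ) : ℂ)⁻¹ *
      ((starRingEnd ℂ ((r : ℂ)⁻¹ * u)) / ((max ‖(r : ℂ)⁻¹ * u‖ 1 ^ 2 : ℝ) : ℂ)) := by
    intro u
    have h : max ‖(r : ℂ)⁻¹ * u‖ 1 = r⁻¹ * max ‖u‖ r := by
      rw [mul_max_of_nonneg _ _ (by positivity), inv_mul_cancel₀ hr.ne']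
      simp [abs_of_pos hr]
    rw [cauchyKernel, h]
    have hm : (0:ℝ) < max ‖u‖ r := lt_max_of_lt_right hr
    have hm' : ((max ‖u‖ r : ℝ) : ℂ) ≠ 0 := by exact_mod_cast hm.ne'
    have hr' : (r : ℂ) ≠ 0 := by exact_mod_cast hr.ne'
    push_cast
    simp only [map_mul, map_inv₀, Complex.conj_ofReal]
    field_simp
  rw [e w, e z, ← mul_sub, norm_mul]
  calc _ ≤ ‖((Real.pi * r : ℝ) : ℂ)⁻¹‖ * ‖(r : ℂ)⁻¹ * w - (r : ℂ)⁻¹ * z‖ := by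
        gcongr; exact norm_conj_div_sub_le _ _
    _ = _ := by
        rw [← mul_sub, norm_mul, ← mul_assoc, norm_inv, norm_inv, Complex.norm_real,
          Complex.norm_real, Real.norm_of_nonneg (by positivity), Real.norm_of_nonneg hr.le]
        congr 1
        field_simp

/-- The kernel is conj w / (πr²) inside the circle and 1/(πw) outside, so it is antiholomorphic on
one side and holomorphic on the other. The two terms of the derivative are ∂̄V · conj v and ∂V · v.
-/
theorem hasLineDerivAt_cauchyKernel {r : ℝ} (hr : 0 < r) {w : ℂ} (hw : ‖w‖ ≠ r) (v : ℂ) :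
    HasLineDerivAt ℝ (cauchyKernel r)
      (starRingEnd ℂ v * discKernel r w - v * truncKernel r w) w v := by
  rcases lt_or_gt_of_ne hw with h | h
  · have h1 : HasLineDerivAt ℝ (fun u : ℂ => starRingEnd ℂ u * ((Real.pi * r ^ 2 : ℝ) : ℂ)⁻¹)
        (starRingEnd ℂ v * discKernel r w - v * truncKernel r w) w v := by
      have h2 := ((Complex.conjCLE.hasFDerivAt (x := w)).mul_const
        (((Real.pi * r ^ 2 : ℝ) : ℂ)⁻¹)).hasLineDerivAt v
      simp only [truncKernel, discKernel, h.not_gt, if_false]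
      have e : starRingEnd ℂ v * ((Real.pi * r ^ 2 : ℝ) : ℂ)⁻¹ - v * 0 =
          (((Real.pi * r ^ 2 : ℝ) : ℂ)⁻¹ • (Complex.conjCLE : ℂ →L[ℝ] ℂ)) v := by
        simp [mul_comm]
      rw [e]
      exact h2
    refine h1.congr_of_eventuallyEq ?_
    filter_upwards [(continuous_norm.tendsto w).eventually (eventually_lt_nhds h)] with u hu
    simp only [cauchyKernel]
    rw [max_eq_right hu.le, div_eq_mul_inv]
  · have hw0 : w ≠ 0 := norm_pos_iff.1 (hr.trans h)
    have h1 : HasLineDerivAt ℝ (fun u : ℂ => (u)⁻¹ * (Real.pi : ℂ)⁻¹)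
        (starRingEnd ℂ v * discKernel r w - v * truncKernel r w) w v := by
      have h2 := (((hasDerivAt_inv hw0).hasFDerivAt.restrictScalars ℝ).mul_const
        ((Real.pi : ℂ)⁻¹)).hasLineDerivAt v
      simp only [truncKernel, discKernel, h, if_true]
      have e : starRingEnd ℂ v * 0 - v * ((Real.pi : ℂ) * w ^ 2)⁻¹ =
          ((Real.pi : ℂ)⁻¹ • ContinuousLinearMap.restrictScalars ℝ
            (ContinuousLinearMap.toSpanSingleton ℂ (-(w ^ 2)⁻¹))) v := by
        simp
        ring
      rw [e]
      exact h2
    refine h1.congr_of_eventuallyEq ?_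
    filter_upwards [(continuous_norm.tendsto w).eventually (eventually_gt_nhds h)] with u hu
    simp only [cauchyKernel]
    rw [max_eq_left (le_of_lt hu), Complex.inv_def, Complex.normSq_eq_norm_sq]
    push_cast
    simp [div_eq_mul_inv]
    ring

/-! ### Integration by parts and Wirtinger derivatives -/

theorem ae_norm_ne (r : ℝ) (hr : r ≠ 0) : ∀ᵐ w : ℂ, ‖w‖ ≠ r := by
  have : volume (Metric.sphere (0 : ℂ) r) = 0 := Measure.addHaar_sphere_of_ne_zero _ _ hr
  rw [ae_iff]
  convert this using 2
  ext; simp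

/-- The real-valued formula for Lipschitz functions is applied to the four pairings of real and
imaginary parts; no boundary term arises where `k` fails to be differentiable. -/
theorem integral_lipschitz_mul_fderiv {k k' η : ℂ → ℂ} {C : ℝ≥0} (hk : LipschitzWith C k) {v : ℂ}
    (hk' : ∀ᵐ x, HasLineDerivAt ℝ k (k' x) x v) (hη : ContDiff ℝ 1 η) (hc : HasCompactSupport η) :
    ∫ x, k x * fderiv ℝ η x v = - ∫ x, k' x * η x := by
  have hkc := hk.continuous
  have hm : AEStronglyMeasurable k' volume := by
    refine (measurable_lineDeriv (𝕜 := ℝ) hkc (v := v)).aestronglyMeasurable.congr ?_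
    filter_upwards [hk'] with x hx using hx.lineDeriv
  have hbd : ∀ᵐ x, ‖k' x‖ ≤ C * ‖v‖ := by
    filter_upwards [hk'] with x hx
    rw [← hx.lineDeriv]
    exact norm_lineDeriv_le_of_lipschitz ℝ hk
  have hηi : Integrable η := hη.continuous.integrable_of_hasCompactSupport hc
  have hDc : Continuous fun x => fderiv ℝ η x v :=
    (hη.continuous_fderiv one_ne_zero).clm_apply continuous_const
  have hDs : HasCompactSupport fun x => fderiv ℝ η x v := hc.fderiv_apply ℝ v
  have hI1 : Integrable fun x => k x * fderiv ℝ η x v :=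
    (hkc.mul hDc).integrable_of_hasCompactSupport hDs.mul_left
  have hI2 : Integrable fun x => k' x * η x := hηi.bdd_mul hm hbd
  obtain ⟨D, hD⟩ := hη.lipschitzWith_of_hasCompactSupport hc one_ne_zero
  have real : ∀ p q : ℂ →L[ℝ] ℝ, ∫ x, p (k x) * q (fderiv ℝ η x v) = -∫ x, p (k' x) * q (η x) := by
    intro p q
    have h := LipschitzWith.integral_lineDeriv_mul_eq (μ := (volume : Measure ℂ))
      (p.lipschitz.comp hk) (q.lipschitz.comp hD) (hc.comp_left (map_zero q)) v
    have e1 : ∫ x, lineDeriv ℝ (p ∘ k) x v * (q ∘ η) x = ∫ x, p (k' x) * q (η x) := by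
      refine integral_congr_ae ?_
      filter_upwards [hk'] with x hx
      have : HasLineDerivAt ℝ (p ∘ k) (p (k' x)) x v :=
        p.hasFDerivAt.comp_hasDerivAt (0 : ℝ) (f := fun t : ℝ => k (x + t • v)) hx
      rw [this.lineDeriv]; rfl
    have e2 : ∫ x, lineDeriv ℝ (q ∘ η) x (-v) * (p ∘ k) x
        = -∫ x, p (k x) * q (fderiv ℝ η x v) := by
      rw [← integral_neg]
      refine integral_congr_ae (Eventually.of_forall fun x => ?_)
      have h3 : HasFDerivAt (q ∘ η) (q.comp (fderiv ℝ η x)) x :=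
        q.hasFDerivAt.comp x ((hη.differentiable one_ne_zero) x).hasFDerivAt
      show lineDeriv ℝ (q ∘ η) x (-v) * (p ∘ k) x = _
      rw [(h3.hasLineDerivAt (-v)).lineDeriv]
      simp; ring
    rw [e1, e2] at h
    rw [h, neg_neg]
  have ir : ∀ (p q : ℂ →L[ℝ] ℝ) {a b : ℂ → ℂ}, AEStronglyMeasurable a volume →
      AEStronglyMeasurable b volume → Integrable (fun x => a x * b x) →
      Integrable fun x => p (a x) * q (b x) := by
    intro p q a b ha hb hab
    refine (hab.norm.const_mul (‖p‖ * ‖q‖)).mono'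
      ((p.continuous.comp_aestronglyMeasurable ha).mul (q.continuous.comp_aestronglyMeasurable hb))
      (Eventually.of_forall fun x => ?_)
    rw [norm_mul, norm_mul]
    calc _ ≤ (‖p‖ * ‖a x‖) * (‖q‖ * ‖b x‖) := by
          gcongr <;> exact ContinuousLinearMap.le_opNorm _ _
      _ = _ := by ring
  have i1 := fun p q => ir p q hkc.aestronglyMeasurable hDc.aestronglyMeasurable hI1
  have i2 := fun p q => ir p q hm hη.continuous.aestronglyMeasurable hI2
  apply Complex.ext
  · have a1 := Complex.reCLM.integral_comp_comm hI1
    have a2 := Complex.reCLM.integral_comp_comm hI2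
    simp only [Complex.reCLM_apply] at a1 a2
    rw [Complex.neg_re, ← a1, ← a2]
    simp only [Complex.mul_re]
    have := real Complex.reCLM Complex.reCLM
    have := real Complex.imCLM Complex.imCLM
    have j1 := i1 Complex.reCLM Complex.reCLM
    have j2 := i1 Complex.imCLM Complex.imCLM
    have j3 := i2 Complex.reCLM Complex.reCLM
    have j4 := i2 Complex.imCLM Complex.imCLM
    simp only [Complex.reCLM_apply, Complex.imCLM_apply] at *
    rw [integral_sub j1 j2, integral_sub j3 j4]
    linarith
  · have a1 := Complex.imCLM.integral_comp_comm hI1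
    have a2 := Complex.imCLM.integral_comp_comm hI2
    simp only [Complex.imCLM_apply] at a1 a2
    rw [Complex.neg_im, ← a1, ← a2]
    simp only [Complex.mul_im]
    have := real Complex.reCLM Complex.imCLM
    have := real Complex.imCLM Complex.reCLM
    have j1 := i1 Complex.reCLM Complex.imCLM
    have j2 := i1 Complex.imCLM Complex.reCLM
    have j3 := i2 Complex.reCLM Complex.imCLM
    have j4 := i2 Complex.imCLM Complex.reCLM
    simp only [Complex.reCLM_apply, Complex.imCLM_apply] at *
    rw [integral_add j1 j2, integral_add j3 j4]
    linarith

theorem integral_cauchyKernel_mul_fderiv {r : ℝ} (hr : 0 < r) {η : ℂ → ℂ} (hη : ContDiff ℝ 1 η)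
    (hc : HasCompactSupport η) (v : ℂ) :
    ∫ x, cauchyKernel r x * fderiv ℝ η x v =
      - ∫ x, (starRingEnd ℂ v * discKernel r x - v * truncKernel r x) * η x := by
  refine integral_lipschitz_mul_fderiv (lipschitzWith_cauchyKernel hr) ?_ hη hc
  filter_upwards [ae_norm_ne r hr.ne'] with x hx using hasLineDerivAt_cauchyKernel hr hx v

/-- The Wirtinger derivative `∂ψ`. -/
noncomputable def wirtinger (ψ : ℂ → ℂ) (z : ℂ) : ℂ :=
  2⁻¹ * (fderiv ℝ ψ z 1 - Complex.I * fderiv ℝ ψ z Complex.I)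

/-- The conjugate Wirtinger derivative `∂̄ψ`. -/
noncomputable def wirtingerBar (ψ : ℂ → ℂ) (z : ℂ) : ℂ :=
  2⁻¹ * (fderiv ℝ ψ z 1 + Complex.I * fderiv ℝ ψ z Complex.I)

theorem norm_cauchyKernel_le {r : ℝ} (hr : 0 < r) (w : ℂ) :
    ‖cauchyKernel r w‖ ≤ (Real.pi * max ‖w‖ r)⁻¹ := by
  rw [cauchyKernel, norm_div, RCLike.norm_conj, Complex.norm_real,
    Real.norm_of_nonneg (by positivity), div_le_iff₀ (by positivity)]
  have : (Real.pi * max ‖w‖ r)⁻¹ * (Real.pi * max ‖w‖ r ^ 2) = max ‖w‖ r := by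
    field_simp
  rw [this]
  exact le_max_left _ _

theorem one_add_norm_le_mul_max {r : ℝ} (hr : 0 < r) (w : ℂ) :
    1 + ‖w‖ ≤ (1 + r⁻¹) * max ‖w‖ r := by
  have h1 : r⁻¹ * r ≤ r⁻¹ * max ‖w‖ r := by gcongr; exact le_max_right _ _
  rw [inv_mul_cancel₀ hr.ne'] at h1
  have := le_max_left ‖w‖ r
  linarith

theorem norm_cauchyKernel_le_div {r : ℝ} (hr : 0 < r) (w : ℂ) :
    ‖cauchyKernel r w‖ ≤ (Real.pi⁻¹ * (1 + r⁻¹)) / (1 + ‖w‖) ^ 1 := by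
  refine (norm_cauchyKernel_le hr w).trans ?_
  rw [le_div_iff₀ (by positivity), inv_mul_le_iff₀ (by positivity), pow_one]
  refine (one_add_norm_le_mul_max hr w).trans (le_of_eq ?_)
  field_simp

theorem inv_max_sq_le {r : ℝ} (hr : 0 < r) (w : ℂ) :
    (Real.pi * max ‖w‖ r ^ 2)⁻¹ ≤ (Real.pi⁻¹ * (1 + r⁻¹) ^ 2) / (1 + ‖w‖) ^ 2 := by
  rw [le_div_iff₀ (by positivity), inv_mul_le_iff₀ (by positivity)]
  have h := pow_le_pow_left₀ (by positivity) (one_add_norm_le_mul_max hr w) 2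
  refine h.trans (le_of_eq ?_)
  field_simp

theorem norm_truncKernel_le_div {r : ℝ} (hr : 0 < r) (w : ℂ) :
    ‖truncKernel r w‖ ≤ (Real.pi⁻¹ * (1 + r⁻¹) ^ 2) / (1 + ‖w‖) ^ 2 := by
  refine le_trans ?_ (inv_max_sq_le hr w)
  by_cases h : r < ‖w‖
  · rw [norm_truncKernel_of_lt h, max_eq_left h.le]
  · simp only [truncKernel, h, if_false, norm_zero]; positivity

theorem norm_discKernel_le_div {r : ℝ} (hr : 0 < r) (w : ℂ) :
    ‖discKernel r w‖ ≤ (Real.pi⁻¹ * (1 + r⁻¹) ^ 2) / (1 + ‖w‖) ^ 2 := by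
  refine le_trans ?_ (inv_max_sq_le hr w)
  by_cases h : r < ‖w‖
  · simp only [discKernel, h, if_true, norm_zero]; positivity
  · rw [max_eq_right (not_lt.1 h)]; exact norm_discKernel_le w

theorem integrable_bdd_mul_of_hasCompactSupport {κ η : ℂ → ℂ} {C : ℝ} (hκ : Measurable κ)
    (hC : ∀ t, ‖κ t‖ ≤ C) (hη : Continuous η) (hc : HasCompactSupport η) :
    Integrable fun t => κ t * η t :=
  (hη.integrable_of_hasCompactSupport hc).bdd_mul hκ.aestronglyMeasurable
    (Eventually.of_forall hC)

section
variable {r : ℝ} {η : ℂ → ℂ}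

/-- These are ∂V = -`truncKernel` and ∂̄V = `discKernel` in the sense of distributions, obtained by
combining the directions 1 and i. -/
theorem integral_cauchyKernel_mul_wirtinger (hr : 0 < r) (hη : ContDiff ℝ 1 η)
    (hc : HasCompactSupport η) :
    ∫ x, cauchyKernel r x * wirtinger η x = ∫ x, truncKernel r x * η x ∧
    ∫ x, cauchyKernel r x * wirtingerBar η x = - ∫ x, discKernel r x * η x := by
  have h1 := integral_cauchyKernel_mul_fderiv hr hη hc 1
  have h2 := integral_cauchyKernel_mul_fderiv hr hη hc Complex.I
  have iK := integrable_bdd_mul_of_hasCompactSupport (measurable_truncKernel r)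
    (norm_truncKernel_le hr) hη.continuous hc
  have id := integrable_bdd_mul_of_hasCompactSupport (measurable_discKernel r)
    (norm_discKernel_le (r := r)) hη.continuous hc
  have iD : ∀ v, Integrable fun x => cauchyKernel r x * fderiv ℝ η x v := fun v =>
    ((lipschitzWith_cauchyKernel hr).continuous.mul ((hη.continuous_fderiv one_ne_zero).clm_apply
      continuous_const)).integrable_of_hasCompactSupport (hc.fderiv_apply ℝ v).mul_left
  have key : ∀ v, ∫ x, (starRingEnd ℂ v * discKernel r x - v * truncKernel r x) * η x =
      starRingEnd ℂ v * (∫ x, discKernel r x * η x) - v * ∫ x, truncKernel r x * η x := by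
    intro v
    rw [← integral_const_mul, ← integral_const_mul, ← integral_sub (id.const_mul _)
      (iK.const_mul _)]
    congr 1; ext x; ring
  rw [key] at h1 h2
  have I2 := Complex.I_mul_I
  constructor
  · have : ∫ x, cauchyKernel r x * wirtinger η x = 2⁻¹ * ((∫ x, cauchyKernel r x * fderiv ℝ η x 1) -
        Complex.I * ∫ x, cauchyKernel r x * fderiv ℝ η x Complex.I) := by
      rw [← integral_const_mul, ← integral_sub (iD 1) ((iD _).const_mul _), ← integral_const_mul]
      congr 1; ext x; simp only [wirtinger]; ring
    rw [this, h1, h2]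
    simp only [map_one, Complex.conj_I]
    linear_combination (-(2⁻¹:ℂ) * ((∫ x, discKernel r x * η x) + ∫ x, truncKernel r x * η x)) * I2
  · have : ∫ x, cauchyKernel r x * wirtingerBar η x = 2⁻¹ * ((∫ x, cauchyKernel r x * fderiv ℝ η x 1) +
        Complex.I * ∫ x, cauchyKernel r x * fderiv ℝ η x Complex.I) := by
      rw [← integral_const_mul, ← integral_add (iD 1) ((iD _).const_mul _), ← integral_const_mul]
      congr 1; ext x; simp only [wirtingerBar]; ring
    rw [this, h1, h2]
    simp only [map_one, Complex.conj_I]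
    linear_combination ((2⁻¹:ℂ) * ((∫ x, discKernel r x * η x) + ∫ x, truncKernel r x * η x)) * I2

end

section
variable {ψ : ℂ → ℂ}

theorem ContDiff.fderiv_apply_const {m n : WithTop ℕ∞} (hψ : ContDiff ℝ n ψ) (hmn : m + 1 ≤ n) (v : ℂ) :
    ContDiff ℝ m fun z => fderiv ℝ ψ z v :=
  (hψ.fderiv_right hmn).clm_apply contDiff_const

theorem fderiv_fderiv_apply_comm (hψ : ContDiff ℝ 2 ψ) (z u v : ℂ) :
    fderiv ℝ (fun x => fderiv ℝ ψ x v) z u = fderiv ℝ (fun x => fderiv ℝ ψ x u) z v := by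
  have hd : DifferentiableAt ℝ (fderiv ℝ ψ) z :=
    (hψ.fderiv_right (m := 1) (by norm_num)).differentiable one_ne_zero z
  have e : ∀ v u : ℂ, fderiv ℝ (fun x => fderiv ℝ ψ x v) z u = fderiv ℝ (fderiv ℝ ψ) z u v := by
    intro v u
    rw [fderiv_clm_apply hd (differentiableAt_const v)]
    simp
  rw [e, e]
  exact (hψ.contDiffAt.isSymmSndFDerivAt (by simp)) u v

theorem contDiff_wirtinger {m n : WithTop ℕ∞} (hψ : ContDiff ℝ n ψ) (hmn : m + 1 ≤ n) : ContDiff ℝ m (wirtinger ψ) :=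
  contDiff_const.mul ((hψ.fderiv_apply_const hmn 1).sub (contDiff_const.mul (hψ.fderiv_apply_const hmn _)))

theorem contDiff_wirtingerBar {m n : WithTop ℕ∞} (hψ : ContDiff ℝ n ψ) (hmn : m + 1 ≤ n) :
    ContDiff ℝ m (wirtingerBar ψ) :=
  contDiff_const.mul ((hψ.fderiv_apply_const hmn 1).add (contDiff_const.mul (hψ.fderiv_apply_const hmn _)))

theorem tsupport_wirtinger_subset : Function.support (wirtinger ψ) ⊆ tsupport ψ := by
  intro z hz
  by_contra h
  have h0 : fderiv ℝ ψ z = 0 := by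
    by_contra h'
    exact h (support_fderiv_subset ℝ h')
  exact hz (by simp [wirtinger, h0])

theorem tsupport_wirtingerBar_subset : Function.support (wirtingerBar ψ) ⊆ tsupport ψ := by
  intro z hz
  by_contra h
  have h0 : fderiv ℝ ψ z = 0 := by
    by_contra h'
    exact h (support_fderiv_subset ℝ h')
  exact hz (by simp [wirtingerBar, h0])

theorem HasCompactSupport.wirtinger (hc : HasCompactSupport ψ) :
    HasCompactSupport (wirtinger ψ) :=
  hc.mono' tsupport_wirtinger_subset

theorem HasCompactSupport.wirtingerBar (hc : HasCompactSupport ψ) :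
    HasCompactSupport (wirtingerBar ψ) :=
  hc.mono' tsupport_wirtingerBar_subset

theorem wirtinger_wirtingerBar_comm (hψ : ContDiff ℝ 2 ψ) (z : ℂ) :
    wirtinger (wirtingerBar ψ) z = wirtingerBar (wirtinger ψ) z := by
  have hD : ∀ v : ℂ, DifferentiableAt ℝ (fun x => fderiv ℝ ψ x v) z := fun v =>
    (hψ.fderiv_apply_const (m := 1) (by norm_num) v).differentiable one_ne_zero z
  have e1 : ∀ u : ℂ, fderiv ℝ (wirtingerBar ψ) z u =
      2⁻¹ * (fderiv ℝ (fun x => fderiv ℝ ψ x 1) z u +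
        Complex.I * fderiv ℝ (fun x => fderiv ℝ ψ x Complex.I) z u) := by
    intro u
    have := ((hD 1).hasFDerivAt.add ((hD Complex.I).hasFDerivAt.const_mul Complex.I)).const_mul
      (2⁻¹ : ℂ)
    have h2 : HasFDerivAt (wirtingerBar ψ) _ z := this
    rw [h2.fderiv]; simp; ring
  have e2 : ∀ u : ℂ, fderiv ℝ (wirtinger ψ) z u =
      2⁻¹ * (fderiv ℝ (fun x => fderiv ℝ ψ x 1) z u -
        Complex.I * fderiv ℝ (fun x => fderiv ℝ ψ x Complex.I) z u) := by
    intro u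
    have := ((hD 1).hasFDerivAt.sub ((hD Complex.I).hasFDerivAt.const_mul Complex.I)).const_mul
      (2⁻¹ : ℂ)
    have h2 : HasFDerivAt (wirtinger ψ) _ z := this
    rw [h2.fderiv]; simp
  rw [wirtinger, wirtingerBar, e1, e1, e2, e2, fderiv_fderiv_apply_comm hψ z Complex.I 1]
  ring

theorem wirtinger_comp_add_right (w z : ℂ) :
    wirtinger (fun x => ψ (x + w)) z = wirtinger ψ (z + w) := by
  simp only [wirtinger, fderiv_comp_add_right]

theorem wirtingerBar_comp_add_right (w z : ℂ) :
    wirtingerBar (fun x => ψ (x + w)) z = wirtingerBar ψ (z + w) := by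
  simp only [wirtingerBar, fderiv_comp_add_right]

/-- Both sides equal ∫ V ∂∂̄ψ, as mixed derivatives commute. This is the truncated form of B∂̄ = -∂.
The right-hand side is an average of ∂ψ, hence bounded uniformly in r, and every transposition below
depends on that. -/
theorem integral_truncKernel_mul_wirtingerBar {r : ℝ} (hr : 0 < r) (hψ : ContDiff ℝ 2 ψ)
    (hc : HasCompactSupport ψ) (w : ℂ) :
    ∫ z, truncKernel r z * wirtingerBar ψ (z + w) = - ∫ z, discKernel r z * wirtinger ψ (z + w) := by
  have main : ∀ ψ : ℂ → ℂ, ContDiff ℝ 2 ψ → HasCompactSupport ψ →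
      ∫ z, truncKernel r z * wirtingerBar ψ z = - ∫ z, discKernel r z * wirtinger ψ z := by
    intro ψ hψ hc
    have h1 : ContDiff ℝ 1 (wirtingerBar ψ) := contDiff_wirtingerBar hψ (by norm_num)
    have h2 : ContDiff ℝ 1 (wirtinger ψ) := contDiff_wirtinger hψ (by norm_num)
    rw [← (integral_cauchyKernel_mul_wirtinger hr h1 hc.wirtingerBar).1,
      ← (integral_cauchyKernel_mul_wirtinger hr h2 hc.wirtinger).2]
    simp only [wirtinger_wirtingerBar_comm hψ]
  have := main (fun x => ψ (x + w)) (hψ.comp (contDiff_id.add contDiff_const))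
    (hc.comp_homeomorph (Homeomorph.addRight w))
  simpa only [wirtinger_comp_add_right, wirtingerBar_comp_add_right] using this

end

/-! ### Convolutions and the uniform L² bound for the truncations -/

/-- The convolution `∫ κ(t) h(z - t) dt`. -/
noncomputable def kernelConv (κ h : ℂ → ℂ) (z : ℂ) : ℂ := ∫ t, κ t * h (z - t)

section
variable {κ h : ℂ → ℂ}

theorem kernelConv_eq_convolution :
    kernelConv κ h = convolution κ h (ContinuousLinearMap.mul ℝ ℂ) volume := rfl

/-- Where h(z - t) ≠ 0 one has 1 + |z| ≤ (1 + ρ)(1 + |t|), so the decay of the kernel passes to the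
convolution. -/
theorem norm_kernelConv_le_div {C ρ : ℝ} {a : ℕ} (hC : 0 ≤ C)
    (hκ : ∀ t, ‖κ t‖ ≤ C / (1 + ‖t‖) ^ a) (hρ : 0 ≤ ρ) (hh : Continuous h)
    (hc : HasCompactSupport h) (hs : ∀ t, ρ < ‖t‖ → h t = 0) (z : ℂ) :
    ‖kernelConv κ h z‖ ≤ (C * (1 + ρ) ^ a * ∫ t, ‖h t‖) / (1 + ‖z‖) ^ a := by
  have hi : Integrable h := hh.integrable_of_hasCompactSupport hc
  have hi' : Integrable fun t => h (z - t) := hi.comp_sub_left z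
  have bound : ∀ t, ‖κ t * h (z - t)‖ ≤ (C * (1 + ρ) ^ a / (1 + ‖z‖) ^ a) * ‖h (z - t)‖ := by
    intro t
    rw [norm_mul]
    by_cases ht : ρ < ‖z - t‖
    · simp [hs _ ht]
    · gcongr
      refine (hκ t).trans ?_
      rw [div_le_div_iff₀ (by positivity) (by positivity), mul_assoc, ← mul_pow]
      gcongr
      have := norm_sub_norm_le z t
      nlinarith [norm_nonneg t]
  calc ‖kernelConv κ h z‖ ≤ ∫ t, (C * (1 + ρ) ^ a / (1 + ‖z‖) ^ a) * ‖h (z - t)‖ :=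
        norm_integral_le_of_norm_le (hi'.norm.const_mul _) (Eventually.of_forall bound)
    _ = _ := by
        rw [integral_const_mul, integral_sub_left_eq_self (fun t => ‖h t‖)]
        ring

theorem fderiv_kernelConv (hκ : LocallyIntegrable κ) (hh : ContDiff ℝ 1 h)
    (hc : HasCompactSupport h) (z v : ℂ) :
    fderiv ℝ (kernelConv κ h) z v = kernelConv κ (fun x => fderiv ℝ h x v) z := by
  rw [kernelConv_eq_convolution,
    (hc.hasFDerivAt_convolution_right (ContinuousLinearMap.mul ℝ ℂ) hκ hh z).fderiv,
    convolution_precompR_apply _ hκ (hc.fderiv ℝ) (hh.continuous_fderiv one_ne_zero)]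
  rfl

theorem contDiff_kernelConv {n : ℕ∞} (hκ : LocallyIntegrable κ) (hh : ContDiff ℝ n h)
    (hc : HasCompactSupport h) : ContDiff ℝ n (kernelConv κ h) :=
  hc.contDiff_convolution_right (ContinuousLinearMap.mul ℝ ℂ) hκ hh

end

theorem locallyIntegrable_of_norm_le {κ : ℂ → ℂ} {C : ℝ} (hκ : Measurable κ)
    (hC : ∀ t, ‖κ t‖ ≤ C) : LocallyIntegrable κ :=
  (locallyIntegrable_const C).mono hκ.aestronglyMeasurable
    (Eventually.of_forall fun t => (hC t).trans (le_abs_self _))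

section
variable {r : ℝ} {h : ℂ → ℂ}

theorem kernelConv_cauchyKernel_fderiv (hr : 0 < r) (hh : ContDiff ℝ 1 h)
    (hc : HasCompactSupport h) (z v : ℂ) :
    kernelConv (cauchyKernel r) (fun x => fderiv ℝ h x v) z =
      starRingEnd ℂ v * kernelConv (discKernel r) h z - v * kernelConv (truncKernel r) h z := by
  have hη : ContDiff ℝ 1 fun t => h (z - t) := hh.comp (contDiff_const.sub contDiff_id)
  have hcη : HasCompactSupport fun t => h (z - t) := hc.comp_homeomorph (Homeomorph.subLeft z)
  have h1 := integral_cauchyKernel_mul_fderiv hr hη hcη v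
  have e : ∀ t, fderiv ℝ (fun t => h (z - t)) t v = - fderiv ℝ h (z - t) v := by
    intro t
    have := ((hh.differentiable one_ne_zero (z - t)).hasFDerivAt).comp t
      ((hasFDerivAt_id t).const_sub z)
    have h2 : HasFDerivAt (fun t => h (z - t)) _ t := this
    rw [h2.fderiv]; simp
  have iK := integrable_bdd_mul_of_hasCompactSupport (measurable_truncKernel r)
    (norm_truncKernel_le hr) hη.continuous hcη
  have id := integrable_bdd_mul_of_hasCompactSupport (measurable_discKernel r)
    (norm_discKernel_le (r := r)) hη.continuous hcη
  simp only [e, mul_neg, integral_neg, neg_inj] at h1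
  simp only [kernelConv]
  rw [h1, ← integral_const_mul, ← integral_const_mul, ← integral_sub (id.const_mul _)
      (iK.const_mul _)]
  congr 1; ext x; ring

/-- The convolution V of the Cauchy kernel with h satisfies ∂̄V = P and ∂V = -Q. Two integrations by
parts and the symmetry of second derivatives give ∫ V_x conj V_y = ∫ V_y conj V_x, and the
difference of the integrands is 2i(|P|² - |Q|²). -/
theorem integral_norm_sq_kernelConv_trunc (hr : 0 < r) (hh : ContDiff ℝ 2 h)
    (hc : HasCompactSupport h) :
    Integrable (fun z => ‖kernelConv (truncKernel r) h z‖ ^ 2) ∧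
    Integrable (fun z => ‖kernelConv (discKernel r) h z‖ ^ 2) ∧
    ∫ z, ‖kernelConv (truncKernel r) h z‖ ^ 2 = ∫ z, ‖kernelConv (discKernel r) h z‖ ^ 2 := by
  set P := kernelConv (discKernel r) h with hP
  set Q := kernelConv (truncKernel r) h with hQ
  set V := kernelConv (cauchyKernel r) h with hV
  have hh1 : ContDiff ℝ 1 h := hh.of_le (by norm_num)
  have lk : LocallyIntegrable (cauchyKernel r) :=
    (lipschitzWith_cauchyKernel hr).continuous.locallyIntegrable
  have ld := locallyIntegrable_of_norm_le (measurable_discKernel r) (norm_discKernel_le (r := r))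
  have lt := locallyIntegrable_of_norm_le (measurable_truncKernel r) (norm_truncKernel_le hr)
  obtain ⟨ρ, hρ0, hρ⟩ : ∃ ρ : ℝ, 0 ≤ ρ ∧ ∀ t, t ∈ tsupport h → ‖t‖ ≤ ρ := by
    obtain ⟨ρ, hρ⟩ := hc.isCompact.isBounded.exists_norm_le
    exact ⟨max ρ 0, le_max_right _ _, fun t ht => (hρ t ht).trans (le_max_left _ _)⟩
  have hs : ∀ t, ρ < ‖t‖ → h t = 0 := fun t ht => by
    by_contra h0
    exact (hρ t (subset_tsupport _ h0)).not_gt ht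
  have hs' : ∀ v t, ρ < ‖t‖ → fderiv ℝ h t v = 0 := fun v t ht => by
    by_contra h0
    have : fderiv ℝ h t ≠ 0 := fun h1 => h0 (by simp [h1])
    exact (hρ t (support_fderiv_subset ℝ this)).not_gt ht
  have hV1 : ∀ v z, fderiv ℝ V z v = starRingEnd ℂ v * P z - v * Q z := fun v z => by
    rw [hV, fderiv_kernelConv lk hh1 hc, kernelConv_cauchyKernel_fderiv hr hh1 hc]
  have hD1 : ∀ v, ContDiff ℝ 1 fun x => fderiv ℝ h x v := fun v =>
    hh.fderiv_apply_const (by norm_num) v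
  have hDc : ∀ v, HasCompactSupport fun x => fderiv ℝ h x v := fun v => hc.fderiv_apply ℝ v
  have Pc : ContDiff ℝ 1 P := contDiff_kernelConv (n := 1) ld hh1 hc
  have Qc : ContDiff ℝ 1 Q := contDiff_kernelConv (n := 1) lt hh1 hc
  have Vc : ContDiff ℝ 2 V := contDiff_kernelConv (n := 2) lk hh hc
  -- decay
  have decay : ∀ (κ g : ℂ → ℂ) (C : ℝ) (a : ℕ), 0 ≤ C → (∀ t, ‖κ t‖ ≤ C / (1 + ‖t‖) ^ a) →
      Continuous g → HasCompactSupport g → (∀ t, ρ < ‖t‖ → g t = 0) →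
      ∃ B, 0 ≤ B ∧ ∀ z, ‖kernelConv κ g z‖ ≤ B / (1 + ‖z‖) ^ a := by
    intro κ g C a hC hκ hg hgc hgs
    exact ⟨C * (1 + ρ) ^ a * ∫ t, ‖g t‖,
      mul_nonneg (by positivity) (integral_nonneg fun _ => norm_nonneg _),
      norm_kernelConv_le_div hC hκ hρ0 hg hgc hgs⟩
  have cc : (0:ℝ) ≤ Real.pi⁻¹ * (1 + r⁻¹) ^ 2 := by positivity
  obtain ⟨BV, hBV0, hBV⟩ := decay _ h _ 1 (by positivity) (norm_cauchyKernel_le_div hr)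
    hh.continuous hc hs
  obtain ⟨BP, hBP0, hBP⟩ := decay _ h _ 2 cc (norm_discKernel_le_div hr) hh.continuous hc hs
  obtain ⟨BQ, hBQ0, hBQ⟩ := decay _ h _ 2 cc (norm_truncKernel_le_div hr) hh.continuous hc hs
  have dP : ∀ v, ∃ B, 0 ≤ B ∧ ∀ z, ‖fderiv ℝ P z v‖ ≤ B / (1 + ‖z‖) ^ 2 := by
    intro v
    obtain ⟨B, h0, hB⟩ := decay _ (fun x => fderiv ℝ h x v) _ 2 cc (norm_discKernel_le_div hr)
      (hD1 v).continuous (hDc v) (hs' v)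
    exact ⟨B, h0, fun z => by rw [hP, fderiv_kernelConv ld hh1 hc]; exact hB z⟩
  have dQ : ∀ v, ∃ B, 0 ≤ B ∧ ∀ z, ‖fderiv ℝ Q z v‖ ≤ B / (1 + ‖z‖) ^ 2 := by
    intro v
    obtain ⟨B, h0, hB⟩ := decay _ (fun x => fderiv ℝ h x v) _ 2 cc (norm_truncKernel_le_div hr)
      (hD1 v).continuous (hDc v) (hs' v)
    exact ⟨B, h0, fun z => by rw [hQ, fderiv_kernelConv lt hh1 hc]; exact hB z⟩
  -- Decay of order 3 suffices in the plane. V itself decays only to order 1, but it always occurs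
  -- multiplied by one of its derivatives, which decay to order 2.
  have int3 : ∀ (F : ℂ → ℂ) (B : ℝ), Continuous F → (∀ z, ‖F z‖ ≤ B / (1 + ‖z‖) ^ 3) →
      Integrable F := by
    intro F B hF hB
    have h3 : Integrable fun z : ℂ => B * (1 + ‖z‖) ^ (-(3:ℝ)) :=
      (integrable_one_add_norm (by simp [Complex.finrank_real_complex]; norm_num)).const_mul B
    refine h3.mono' hF.aestronglyMeasurable (Eventually.of_forall fun z => ?_)
    refine (hB z).trans (le_of_eq ?_)
    rw [Real.rpow_neg (by positivity), div_eq_mul_inv]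
    norm_cast
  have prod3 : ∀ (F G : ℂ → ℂ) (A B : ℝ) (a b : ℕ), 0 ≤ A → 0 ≤ B → 3 ≤ a + b →
      Continuous F → Continuous G →
      (∀ z, ‖F z‖ ≤ A / (1 + ‖z‖) ^ a) → (∀ z, ‖G z‖ ≤ B / (1 + ‖z‖) ^ b) →
      Integrable fun z => F z * starRingEnd ℂ (G z) := by
    intro F G A B a b hA hB hab hF hG hFA hGB
    refine int3 _ (A * B) (hF.mul (Complex.continuous_conj.comp hG)) fun z => ?_
    rw [norm_mul, RCLike.norm_conj]
    calc _ ≤ (A / (1 + ‖z‖) ^ a) * (B / (1 + ‖z‖) ^ b) := by gcongr; exacts [hFA z, hGB z]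
      _ = A * B / (1 + ‖z‖) ^ (a + b) := by rw [div_mul_div_comm, pow_add]
      _ ≤ _ := by
        gcongr
        linarith [norm_nonneg z]
  -- the derivatives of `V` in the directions `1` and `I`
  have eV : ∀ v, (fun z => fderiv ℝ V z v) = fun z => starRingEnd ℂ v * P z - v * Q z := fun v =>
    funext (hV1 v)
  have dV : ∀ v, ∃ B, 0 ≤ B ∧ ∀ z, ‖fderiv ℝ V z v‖ ≤ B / (1 + ‖z‖) ^ 2 := by
    intro v
    refine ⟨‖v‖ * (BP + BQ), by positivity, fun z => ?_⟩
    rw [hV1]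
    refine (norm_sub_le _ _).trans ?_
    rw [norm_mul, norm_mul, RCLike.norm_conj, mul_div_assoc, add_div, ← mul_add]
    gcongr; exacts [hBP z, hBQ z]
  have ddV : ∀ u v, ∃ B, 0 ≤ B ∧ ∀ z, ‖fderiv ℝ (fun x => fderiv ℝ V x v) z u‖ ≤
      B / (1 + ‖z‖) ^ 2 := by
    intro u v
    obtain ⟨B1, h1, hB1⟩ := dP u
    obtain ⟨B2, h2, hB2⟩ := dQ u
    refine ⟨‖v‖ * (B1 + B2), by positivity, fun z => ?_⟩
    have hd := (((Pc.differentiable one_ne_zero) z).hasFDerivAt.const_mul (starRingEnd ℂ v)).sub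
      (((Qc.differentiable one_ne_zero) z).hasFDerivAt.const_mul v)
    have hd' : HasFDerivAt (fun x => starRingEnd ℂ v * P x - v * Q x) _ z := hd
    rw [eV, hd'.fderiv]
    simp only [sub_apply, smul_apply, smul_eq_mul]
    refine (norm_sub_le _ _).trans ?_
    rw [norm_mul, norm_mul, RCLike.norm_conj, mul_div_assoc, add_div, ← mul_add]
    gcongr; exacts [hB1 z, hB2 z]
  have Vd1 : ∀ v, ContDiff ℝ 1 fun z => fderiv ℝ V z v := fun v =>
    Vc.fderiv_apply_const (by norm_num) v
  have Vdd : ∀ u v, Continuous fun z => fderiv ℝ (fun x => fderiv ℝ V x v) z u := fun u v =>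
    ((Vd1 v).continuous_fderiv one_ne_zero).clm_apply continuous_const
  have conjd : ∀ u v z, fderiv ℝ (fun x => starRingEnd ℂ (fderiv ℝ V x v)) z u =
      starRingEnd ℂ (fderiv ℝ (fun x => fderiv ℝ V x v) z u) := by
    intro u v z
    have := (Complex.conjCLE.hasFDerivAt (x := fderiv ℝ V z v)).comp z
      ((Vd1 v).differentiable one_ne_zero z).hasFDerivAt
    have h2 : HasFDerivAt (fun x => starRingEnd ℂ (fderiv ℝ V x v)) _ z := this
    rw [h2.fderiv]; rfl
  have ibp : ∀ u v, ∫ z, V z * starRingEnd ℂ (fderiv ℝ (fun x => fderiv ℝ V x v) z u) =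
      - ∫ z, fderiv ℝ V z u * starRingEnd ℂ (fderiv ℝ V z v) := by
    intro u v
    obtain ⟨Bu, hu, hBu⟩ := dV u
    obtain ⟨Bv, hv, hBv⟩ := dV v
    obtain ⟨Bd, hd, hBd⟩ := ddV u v
    have := integral_mul_fderiv_eq_neg_fderiv_mul_of_integrable (𝕜 := ℂ) (v := u)
      (f := V) (g := fun x => starRingEnd ℂ (fderiv ℝ V x v)) (μ := volume)
      (prod3 _ _ _ _ _ _ hu hv (by norm_num) (Vd1 u).continuous (Vd1 v).continuous hBu hBv)
      (by
        simp only [conjd]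
        exact prod3 _ _ _ _ _ _ hBV0 hd (by norm_num) Vc.continuous (Vdd u v) hBV hBd)
      (prod3 _ _ _ _ _ _ hBV0 hv (by norm_num) Vc.continuous (Vd1 v).continuous hBV hBv)
      (fun x _ => Vc.differentiable (by norm_num) x)
      (fun x _ => Complex.conjCLE.differentiable.comp ((Vd1 v).differentiable one_ne_zero) x)
    simpa only [conjd] using this
  have key : ∫ z, fderiv ℝ V z 1 * starRingEnd ℂ (fderiv ℝ V z Complex.I) =
      ∫ z, fderiv ℝ V z Complex.I * starRingEnd ℂ (fderiv ℝ V z 1) := by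
    have h1 := ibp 1 Complex.I
    have h2 := ibp Complex.I 1
    simp only [fderiv_fderiv_apply_comm Vc _ 1 Complex.I] at h1
    rw [h1, neg_inj] at h2
    exact h2
  have iPQ : ∀ F : ℂ → ℂ, ∀ B : ℝ, 0 ≤ B → Continuous F → (∀ z, ‖F z‖ ≤ B / (1 + ‖z‖) ^ 2) →
      Integrable fun z => ‖F z‖ ^ 2 := by
    intro F B hB hF hFB
    have := (prod3 F F B B 2 2 hB hB (by norm_num) hF hF hFB hFB).re
    refine this.congr (Eventually.of_forall fun z => ?_)
    simp [Complex.mul_conj, Complex.normSq_eq_norm_sq, -Complex.ofReal_pow]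
  have iQ := iPQ Q BQ hBQ0 Qc.continuous hBQ
  have iP := iPQ P BP hBP0 Pc.continuous hBP
  refine ⟨iQ, iP, ?_⟩
  obtain ⟨B1, hu, hBu⟩ := dV 1
  obtain ⟨BI, hv, hBv⟩ := dV Complex.I
  have key2 := sub_eq_zero.2 key
  rw [← integral_sub
    (prod3 _ _ _ _ _ _ hu hv (by norm_num) (Vd1 _).continuous (Vd1 _).continuous hBu hBv)
    (prod3 _ _ _ _ _ _ hv hu (by norm_num) (Vd1 _).continuous (Vd1 _).continuous hBv hBu)] at key2
  have e : ∀ z, fderiv ℝ V z 1 * starRingEnd ℂ (fderiv ℝ V z Complex.I) -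
      fderiv ℝ V z Complex.I * starRingEnd ℂ (fderiv ℝ V z 1) =
      (2 * Complex.I) * ((‖P z‖ ^ 2 - ‖Q z‖ ^ 2 : ℝ) : ℂ) := by
    intro z
    rw [hV1, hV1, ← Complex.normSq_eq_norm_sq, ← Complex.normSq_eq_norm_sq]
    push_cast
    rw [← Complex.mul_conj, ← Complex.mul_conj]
    simp only [map_sub, map_mul, map_one, map_neg, Complex.conj_I]
    ring
  simp only [e] at key2
  rw [integral_const_mul, integral_complex_ofReal, integral_sub iP iQ] at key2
  have : (2 * Complex.I) ≠ 0 := by simp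
  have h3 := (mul_eq_zero.1 key2).resolve_left this
  have h4 : (∫ z, ‖P z‖ ^ 2) - ∫ z, ‖Q z‖ ^ 2 = 0 := by exact_mod_cast h3
  linarith

end

theorem eLpNorm_two_eq {f : ℂ → ℂ} {μ : Measure ℂ} :
    eLpNorm f 2 μ = (∫⁻ z, ‖f z‖ₑ ^ 2 ∂μ) ^ (1 / 2 : ℝ) := by
  rw [eLpNorm_eq_lintegral_rpow_enorm_toReal (by simp) (by simp)]
  simp

theorem lintegral_mul_sq_le {α : Type*} [MeasurableSpace α] {μ : Measure α} {F G : α → ℝ≥0∞}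
    (hF : AEMeasurable F μ) (hG : AEMeasurable G μ) :
    (∫⁻ x, F x * G x ∂μ) ^ 2 ≤ (∫⁻ x, F x ^ 2 ∂μ) * ∫⁻ x, G x ^ 2 ∂μ := by
  have h := ENNReal.lintegral_mul_le_Lp_mul_Lq μ (p := 2) (q := 2)
    (by rw [Real.holderConjugate_iff]; norm_num) hF hG
  simp only [Pi.mul_apply, ENNReal.rpow_two] at h
  calc _ ≤ ((∫⁻ x, F x ^ 2 ∂μ) ^ (1 / 2 : ℝ) * (∫⁻ x, G x ^ 2 ∂μ) ^ (1 / 2 : ℝ)) ^ 2 := by gcongr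
    _ = _ := by
      rw [mul_pow, ← ENNReal.rpow_two, ← ENNReal.rpow_two, ← ENNReal.rpow_mul, ← ENNReal.rpow_mul]
      norm_num

theorem lintegral_enorm_discKernel {r : ℝ} (hr : 0 < r) : ∫⁻ t, ‖discKernel r t‖ₑ = 1 := by
  have e : (fun t => ‖discKernel r t‖ₑ) =
      (Metric.closedBall (0 : ℂ) r).indicator fun _ => ENNReal.ofReal (Real.pi * r ^ 2)⁻¹ := by
    ext t
    by_cases h : r < ‖t‖
    · simp [discKernel, h]
    · rw [Set.indicator_of_mem (by simpa using h)]
      simp only [discKernel, h, if_false]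
      rw [← ofReal_norm, norm_inv, Complex.norm_real, Real.norm_of_nonneg (by positivity)]
  rw [e, lintegral_indicator measurableSet_closedBall, setLIntegral_const, Complex.volume_closedBall,
    ENNReal.ofReal_inv_of_pos (by positivity), mul_comm Real.pi, ENNReal.ofReal_mul (by positivity),
    ENNReal.ofReal_pow hr.le]
  have : ENNReal.ofReal Real.pi = NNReal.pi := by
    rw [← NNReal.coe_real_pi, ENNReal.ofReal_coe_nnreal]
  rw [this]
  refine ENNReal.inv_mul_cancel ?_ ?_
  · have := NNReal.pi_ne_zero
    simp [hr, this]
  · exact ENNReal.mul_ne_top (by simp) (by simp)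

/-- Cauchy–Schwarz with respect to the probability density `discKernel r`, then Tonelli. -/
theorem lintegral_kernelConv_disc_sq_le {r : ℝ} (hr : 0 < r) {h : ℂ → ℂ} (hh : Continuous h) :
    ∫⁻ z, ‖kernelConv (discKernel r) h z‖ₑ ^ 2 ≤ ∫⁻ z, ‖h z‖ₑ ^ 2 := by
  have md : Measurable fun t => ‖discKernel r t‖ₑ := (measurable_discKernel r).enorm
  have hc : Measurable fun p : ℂ × ℂ => ‖h (p.1 - p.2)‖ₑ :=
    ((hh.comp (continuous_fst.sub continuous_snd)).enorm).measurable
  have hm : Measurable h := hh.measurable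
  calc ∫⁻ z, ‖kernelConv (discKernel r) h z‖ₑ ^ 2
      ≤ ∫⁻ z, ∫⁻ t, ‖discKernel r t‖ₑ * ‖h (z - t)‖ₑ ^ 2 := by
        gcongr with z
        calc ‖kernelConv (discKernel r) h z‖ₑ ^ 2
            ≤ (∫⁻ t, ‖discKernel r t * h (z - t)‖ₑ) ^ 2 := by
              gcongr; exact enorm_integral_le_lintegral_enorm _
          _ = (∫⁻ t, ‖h (z - t)‖ₑ * 1 ∂(volume.withDensity fun t => ‖discKernel r t‖ₑ)) ^ 2 := by
              rw [lintegral_withDensity_eq_lintegral_mul _ md (by fun_prop)]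
              simp
          _ ≤ _ := by
              refine (lintegral_mul_sq_le (by fun_prop) (by fun_prop)).trans ?_
              rw [lintegral_withDensity_eq_lintegral_mul _ md (by fun_prop),
                lintegral_withDensity_eq_lintegral_mul _ md (by fun_prop)]
              simp [lintegral_enorm_discKernel hr]
    _ = ∫⁻ t, ∫⁻ z, ‖discKernel r t‖ₑ * ‖h (z - t)‖ₑ ^ 2 := by
        rw [lintegral_lintegral_swap]
        exact ((md.comp measurable_snd).mul (hc.pow_const 2)).aemeasurable
    _ = ∫⁻ t, ‖discKernel r t‖ₑ * ∫⁻ z, ‖h z‖ₑ ^ 2 := by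
        congr 1; ext t
        rw [lintegral_const_mul _ (by fun_prop),
          lintegral_sub_right_eq_self (fun z => ‖h z‖ₑ ^ 2)]
    _ = _ := by rw [lintegral_mul_const _ md, lintegral_enorm_discKernel hr, one_mul]

theorem memLp_truncKernel {r : ℝ} (hr : 0 < r) : MemLp (truncKernel r) 2 := by
  rw [memLp_two_iff_integrable_sq_norm (measurable_truncKernel r).aestronglyMeasurable]
  have h4 : Integrable fun z : ℂ => (Real.pi⁻¹ * (1 + r⁻¹) ^ 2) ^ 2 * (1 + ‖z‖) ^ (-(4:ℝ)) :=
    (integrable_one_add_norm (by simp [Complex.finrank_real_complex]; norm_num)).const_mul _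
  refine h4.mono' ((measurable_truncKernel r).norm.pow_const 2).aestronglyMeasurable
    (Eventually.of_forall fun z => ?_)
  rw [Real.norm_of_nonneg (by positivity)]
  refine (pow_le_pow_left₀ (norm_nonneg _) (norm_truncKernel_le_div hr z) 2).trans (le_of_eq ?_)
  rw [Real.rpow_neg (by positivity), div_pow, div_eq_mul_inv, ← pow_mul]
  norm_cast

theorem enorm_kernelConv_sq_le {κ h : ℂ → ℂ} (hκ : AEStronglyMeasurable κ volume)
    (hh : AEStronglyMeasurable h volume) (z : ℂ) :
    ‖kernelConv κ h z‖ₑ ^ 2 ≤ (∫⁻ t, ‖κ t‖ₑ ^ 2) * ∫⁻ t, ‖h t‖ₑ ^ 2 := by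
  have hh' : AEStronglyMeasurable (fun t => h (z - t)) volume :=
    hh.comp_quasiMeasurePreserving (quasiMeasurePreserving_sub_left_of_right_invariant volume z)
  calc _ ≤ (∫⁻ t, ‖κ t * h (z - t)‖ₑ) ^ 2 := by
        gcongr; exact enorm_integral_le_lintegral_enorm _
    _ = (∫⁻ t, ‖κ t‖ₑ * ‖h (z - t)‖ₑ) ^ 2 := by simp only [enorm_mul]
    _ ≤ (∫⁻ t, ‖κ t‖ₑ ^ 2) * ∫⁻ t, ‖h (z - t)‖ₑ ^ 2 :=
        lintegral_mul_sq_le hκ.enorm hh'.enorm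
    _ = _ := by rw [lintegral_sub_left_eq_self (fun t => ‖h t‖ₑ ^ 2)]

theorem integrable_mul_comp_sub {κ h : ℂ → ℂ} (hκ : MemLp κ 2) (hh : MemLp h 2) (z : ℂ) :
    Integrable fun t => κ t * h (z - t) :=
  hκ.integrable_mul (hh.comp_measurePreserving (volume.measurePreserving_sub_left z))

/-- For smooth compactly supported functions the truncation has the L² norm of a disc average, which
is a contraction. As `truncKernel r` lies in L², convergence of approximants in L² implies pointwise
convergence of their truncations, and Fatou's lemma extends the bound. What matters is that the
constant does not depend on r. -/
theorem eLpNorm_kernelConv_trunc_le {r : ℝ} (hr : 0 < r) {h : ℂ → ℂ} (hh : MemLp h 2) :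
    eLpNorm (kernelConv (truncKernel r) h) 2 volume ≤ eLpNorm h 2 volume := by
  have smooth : ∀ g : ℂ → ℂ, ContDiff ℝ 2 g → HasCompactSupport g →
      eLpNorm (kernelConv (truncKernel r) g) 2 volume ≤ eLpNorm g 2 volume := by
    intro g hg hc
    obtain ⟨h1, h2, h3⟩ := integral_norm_sq_kernelConv_trunc hr hg hc
    have e : ∀ F : ℂ → ℂ, Integrable (fun z => ‖F z‖ ^ 2) →
        ∫⁻ z, ‖F z‖ₑ ^ 2 = ENNReal.ofReal (∫ z, ‖F z‖ ^ 2) := by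
      intro F hF
      rw [ofReal_integral_eq_lintegral_ofReal hF (Eventually.of_forall fun _ => by positivity)]
      congr 1; ext z
      rw [ENNReal.ofReal_pow (norm_nonneg _), ofReal_norm]
    rw [eLpNorm_two_eq, eLpNorm_two_eq, e _ h1, h3, ← e _ h2]
    refine ENNReal.rpow_le_rpow ?_ (by norm_num)
    exact lintegral_kernelConv_disc_sq_le hr hg.continuous
  have approx : ∀ n : ℕ, ∃ g, HasCompactSupport g ∧ ContDiff ℝ 2 g ∧
      eLpNorm (h - g) 2 volume ≤ ENNReal.ofReal (1 / ((n:ℝ) + 1)) := by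
    intro n
    obtain ⟨g, h1, h2, h3⟩ := hh.exist_eLpNorm_sub_le (by simp) (by norm_num)
      (ε := 1 / ((n:ℝ) + 1)) (by positivity)
    exact ⟨g, h1, h2.of_le (WithTop.coe_le_coe.2 le_top), h3⟩
  choose g hgc hgd hg using approx
  have hK := memLp_truncKernel hr
  have hg2 : ∀ n, MemLp (g n) 2 volume := fun n =>
    (hgd n).continuous.memLp_of_hasCompactSupport (hgc n)
  have to0 : Tendsto (fun n : ℕ => ENNReal.ofReal (1 / ((n:ℝ) + 1))) atTop (𝓝 0) := by
    simpa using ENNReal.tendsto_ofReal tendsto_one_div_add_atTop_nhds_zero_nat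
  have lim : ∀ z, Tendsto (fun n => kernelConv (truncKernel r) (g n) z) atTop
      (𝓝 (kernelConv (truncKernel r) h z)) := by
    intro z
    rw [tendsto_iff_edist_tendsto_0]
    have hb : ∀ n, edist (kernelConv (truncKernel r) (g n) z) (kernelConv (truncKernel r) h z) ≤
        eLpNorm (truncKernel r) 2 volume * ENNReal.ofReal (1 / ((n:ℝ) + 1)) := by
      intro n
      have hsub : kernelConv (truncKernel r) h z - kernelConv (truncKernel r) (g n) z =
          kernelConv (truncKernel r) (h - g n) z := by
        simp only [kernelConv]
        rw [← integral_sub (integrable_mul_comp_sub hK hh z) (integrable_mul_comp_sub hK (hg2 n) z)]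
        simp [mul_sub]
      rw [edist_comm, edist_eq_enorm_sub, hsub]
      refine le_trans ?_ (mul_le_mul_right (hg n) _)
      have h1 := enorm_kernelConv_sq_le hK.1 (hh.sub (hg2 n)).1 z
      rw [eLpNorm_two_eq, eLpNorm_two_eq, ← ENNReal.mul_rpow_of_nonneg _ _ (by norm_num)]
      calc _ = (‖kernelConv (truncKernel r) (h - g n) z‖ₑ ^ 2) ^ (1 / 2 : ℝ) := by
            rw [← ENNReal.rpow_two, ← ENNReal.rpow_mul]; norm_num
        _ ≤ _ := by gcongr
    refine tendsto_of_tendsto_of_tendsto_of_le_of_le tendsto_const_nhds ?_ (fun _ => zero_le) hb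
    simpa using ENNReal.Tendsto.const_mul to0 (Or.inr hK.2.ne)
  have hmeas : ∀ n, AEStronglyMeasurable (kernelConv (truncKernel r) (g n)) volume := fun n =>
    (contDiff_kernelConv (n := 2) (locallyIntegrable_of_norm_le (measurable_truncKernel r)
      (norm_truncKernel_le hr)) (hgd n) (hgc n)).continuous.aestronglyMeasurable
  calc _ ≤ liminf (fun n => eLpNorm (kernelConv (truncKernel r) (g n)) 2 volume) atTop :=
        Lp.eLpNorm_lim_le_liminf_eLpNorm hmeas _ (Eventually.of_forall lim)
    _ ≤ liminf (fun n : ℕ => eLpNorm h 2 volume + ENNReal.ofReal (1 / ((n:ℝ) + 1))) atTop := by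
        refine liminf_le_liminf (Eventually.of_forall fun n => ?_)
        refine (smooth _ (hgd n) (hgc n)).trans ?_
        have : g n = h - (h - g n) := by simp
        calc eLpNorm (g n) 2 volume = eLpNorm (h - (h - g n)) 2 volume := by rw [← this]
          _ ≤ eLpNorm h 2 volume + eLpNorm (h - g n) 2 volume :=
            eLpNorm_sub_le hh.1 (hh.sub (hg2 n)).1 (by norm_num)
          _ ≤ _ := by gcongr; exact hg n
    _ = eLpNorm h 2 volume := by
        have := (tendsto_const_nhds (x := eLpNorm h 2 volume)).add to0
        rw [add_zero] at this
        exact this.liminf_eq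

/-! ### Hörmander's condition and mean-zero functions -/

/-- Where both points lie outside the circle of radius R, the difference of the smooth kernels is of
order |y| / |x|³. The jump is felt only if the circle separates x from x - y, which confines x to a
shell of width 2|y|. -/
theorem norm_truncKernel_sub_le {R : ℝ} {x y : ℂ} (hy : 2 * ‖y‖ < ‖x‖) :
    ‖truncKernel R (x - y) - truncKernel R x‖ ≤
      4 * ‖y‖ / ‖x‖ ^ 3 + if |‖x‖ - R| ≤ ‖y‖ then 2 / ‖x‖ ^ 2 else 0 := by
  have hx : 0 < ‖x‖ := by linarith [norm_nonneg y]
  have hpi := Real.pi_gt_three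
  have h1 : ‖x‖ / 2 ≤ ‖x - y‖ := by linarith [norm_sub_norm_le x y]
  have h1' : ‖x - y‖ ≤ ‖x‖ + ‖y‖ := norm_sub_le x y
  have h1'' : ‖x‖ - ‖y‖ ≤ ‖x - y‖ := norm_sub_norm_le x y
  have hxy : 0 < ‖x - y‖ := by linarith
  have f0 : 0 ≤ 4 * ‖y‖ / ‖x‖ ^ 3 := by positivity
  have g0 : 0 ≤ (if |‖x‖ - R| ≤ ‖y‖ then 2 / ‖x‖ ^ 2 else 0 : ℝ) := by
    split_ifs <;> positivity
  have b1 : (Real.pi * ‖x‖ ^ 2)⁻¹ ≤ 2 / ‖x‖ ^ 2 := by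
    rw [inv_le_comm₀ (by positivity) (by positivity), inv_div]
    nlinarith [sq_nonneg ‖x‖]
  have b2 : (Real.pi * ‖x - y‖ ^ 2)⁻¹ ≤ 2 / ‖x‖ ^ 2 := by
    rw [inv_le_comm₀ (by positivity) (by positivity), inv_div]
    nlinarith [sq_nonneg ‖x‖, pow_le_pow_left₀ (by positivity) h1 2]
  by_cases ha : R < ‖x - y‖ <;> by_cases hb : R < ‖x‖
  · have hx0 : x ≠ 0 := norm_pos_iff.1 hx
    have hxy0 : x - y ≠ 0 := norm_pos_iff.1 hxy
    refine le_trans ?_ (le_add_of_nonneg_right g0)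
    simp only [truncKernel, ha, hb, if_true]
    have e : ((Real.pi : ℂ) * (x - y) ^ 2)⁻¹ - ((Real.pi : ℂ) * x ^ 2)⁻¹ =
        y * (x + (x - y)) / ((Real.pi : ℂ) * (x - y) ^ 2 * x ^ 2) := by
      field_simp
      ring
    rw [e, norm_div, norm_mul, norm_mul, norm_mul, norm_pow, norm_pow, Complex.norm_real,
      Real.norm_of_nonneg Real.pi_pos.le]
    have n1 : ‖x + (x - y)‖ ≤ 5 / 2 * ‖x‖ := by linarith [norm_add_le x (x - y)]
    calc ‖y‖ * ‖x + (x - y)‖ / (Real.pi * ‖x - y‖ ^ 2 * ‖x‖ ^ 2)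
        ≤ ‖y‖ * (5 / 2 * ‖x‖) / (3 * (‖x‖ / 2) ^ 2 * ‖x‖ ^ 2) := by gcongr
      _ = (10 / 3) * ‖y‖ / ‖x‖ ^ 3 := by field_simp; ring
      _ ≤ _ := by gcongr; norm_num
  · have : |‖x‖ - R| ≤ ‖y‖ := by rw [abs_le]; constructor <;> linarith
    rw [if_pos this]
    refine le_trans ?_ (le_add_of_nonneg_left f0)
    have e : truncKernel R x = 0 := by simp [truncKernel, hb]
    rw [e, sub_zero, norm_truncKernel_of_lt ha]
    exact b2
  · have : |‖x‖ - R| ≤ ‖y‖ := by rw [abs_le]; constructor <;> linarith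
    rw [if_pos this]
    refine le_trans ?_ (le_add_of_nonneg_left f0)
    have e : truncKernel R (x - y) = 0 := by simp [truncKernel, ha]
    rw [e, zero_sub, norm_neg, norm_truncKernel_of_lt hb]
    exact b1
  · simp only [truncKernel, ha, hb, if_false, sub_zero, norm_zero]
    positivity

theorem lintegral_inv_norm_cube {s : ℝ} (hs : 0 < s) :
    ∫⁻ x in {x : ℂ | s < ‖x‖}, ENNReal.ofReal (‖x‖ ^ 3)⁻¹ = ENNReal.ofReal (2 * Real.pi / s) := by
  have hset : MeasurableSet {x : ℂ | s < ‖x‖} := measurableSet_lt measurable_const measurable_norm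
  set F : ℝ → ℝ := (Set.Ioi s).indicator fun y => y ^ (-3 : ℝ) with hF
  have eF : ∀ x : ℂ, {x : ℂ | s < ‖x‖}.indicator (fun x => ENNReal.ofReal (‖x‖ ^ 3)⁻¹) x =
      ENNReal.ofReal (F ‖x‖) := by
    intro x
    by_cases h : s < ‖x‖
    · rw [Set.indicator_of_mem (by exact h), hF, Set.indicator_of_mem (by exact h),
        Real.rpow_neg (norm_nonneg _)]
      norm_cast
    · rw [Set.indicator_of_notMem (by exact h), hF, Set.indicator_of_notMem (by exact h)]
      simp
  have e2 : ∀ y ∈ Set.Ioi (0 : ℝ), y ^ (Module.finrank ℝ ℂ - 1) • F y =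
      (Set.Ioi s).indicator (fun y => y ^ (-2 : ℝ)) y := by
    intro y hy
    rw [Complex.finrank_real_complex, hF]
    by_cases h : y ∈ Set.Ioi s
    · rw [Set.indicator_of_mem h, Set.indicator_of_mem h, smul_eq_mul]
      rw [show (-2 : ℝ) = 1 + -3 by norm_num, Real.rpow_add hy]
      norm_num
    · rw [Set.indicator_of_notMem h, Set.indicator_of_notMem h, smul_zero]
  have i2 : IntegrableOn (fun y : ℝ => y ^ (-2 : ℝ)) (Set.Ioi s) :=
    integrableOn_Ioi_rpow_of_lt (by norm_num) hs
  have hint : Integrable fun x : ℂ => F ‖x‖ := by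
    rw [integrable_fun_norm_addHaar]
    refine IntegrableOn.congr_fun ?_ (fun y hy => (e2 y hy).symm) measurableSet_Ioi
    exact (i2.integrable_indicator measurableSet_Ioi).integrableOn
  rw [← lintegral_indicator hset]
  simp only [eF]
  rw [← ofReal_integral_eq_lintegral_ofReal hint (Eventually.of_forall fun x => by
    rw [hF]; exact Set.indicator_nonneg (fun y hy => Real.rpow_nonneg (hs.le.trans (le_of_lt hy)) _) _)]
  congr 1
  rw [integral_fun_norm_addHaar, setIntegral_congr_fun measurableSet_Ioi e2,
    setIntegral_indicator measurableSet_Ioi,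
    Set.inter_eq_self_of_subset_right (Set.Ioi_subset_Ioi hs.le),
    integral_Ioi_rpow_of_lt (by norm_num) hs, Complex.finrank_real_complex]
  have hv : (volume : Measure ℂ).real (Metric.ball 0 1) = Real.pi := by
    simp [Measure.real, Complex.volume_ball]
  rw [hv]
  norm_num [Real.rpow_neg_one]
  field_simp

/-- Hörmander's condition for the truncated Beurling kernels, uniformly in the truncation. -/
theorem lintegral_truncKernel_sub_le {R : ℝ} (y : ℂ) :
    ∫⁻ x in {x : ℂ | 2 * ‖y‖ < ‖x‖}, ‖truncKernel R (x - y) - truncKernel R x‖ₑ ≤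
      ENNReal.ofReal (12 * Real.pi) := by
  rcases eq_or_ne y 0 with rfl | hy0
  · simp
  have hs : 0 < ‖y‖ := norm_pos_iff.2 hy0
  set s := ‖y‖ with hsdef
  have hset : MeasurableSet {x : ℂ | 2 * s < ‖x‖} :=
    measurableSet_lt measurable_const measurable_norm
  -- The shell lies in m ≤ |x| ≤ 2m, because R + s ≤ m + 2s ≤ 2m. There the jump costs at most 2/m²,
  -- so it contributes at most 8π; the cubic decay contributes 4π.
  set m := max (2 * s) (R - s) with hm
  have hm0 : 0 < m := lt_max_of_lt_left (by positivity)
  have hpt : ∀ x ∈ {x : ℂ | 2 * s < ‖x‖}, ‖truncKernel R (x - y) - truncKernel R x‖ₑ ≤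
      ENNReal.ofReal (4 * s) * ENNReal.ofReal (‖x‖ ^ 3)⁻¹ +
        (Metric.closedBall (0 : ℂ) (2 * m)).indicator (fun _ => ENNReal.ofReal (2 / m ^ 2)) x := by
    intro x hx
    rw [← ofReal_norm]
    refine (ENNReal.ofReal_le_ofReal (norm_truncKernel_sub_le hx)).trans ?_
    rw [ENNReal.ofReal_add (by positivity) (by split_ifs <;> positivity),
      ← ENNReal.ofReal_mul (by positivity), ← div_eq_mul_inv]
    gcongr
    split_ifs with h
    · rw [abs_le] at h
      have h2 : m ≤ ‖x‖ := max_le (le_of_lt hx) (by linarith)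
      have h3 : ‖x‖ ≤ 2 * m := by
        have := le_max_left (2 * s) (R - s)
        have := le_max_right (2 * s) (R - s)
        linarith
      rw [Set.indicator_of_mem (by simpa using h3)]
      gcongr
    · simp
  calc _ ≤ ∫⁻ x in {x : ℂ | 2 * s < ‖x‖}, (ENNReal.ofReal (4 * s) * ENNReal.ofReal (‖x‖ ^ 3)⁻¹ +
        (Metric.closedBall (0 : ℂ) (2 * m)).indicator (fun _ => ENNReal.ofReal (2 / m ^ 2)) x) :=
        setLIntegral_mono' hset hpt
    _ = ENNReal.ofReal (4 * s) * ENNReal.ofReal (2 * Real.pi / (2 * s)) +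
        ∫⁻ x in {x : ℂ | 2 * s < ‖x‖},
        (Metric.closedBall (0 : ℂ) (2 * m)).indicator (fun _ => ENNReal.ofReal (2 / m ^ 2)) x := by
        rw [lintegral_add_left (by fun_prop), lintegral_const_mul _ (by fun_prop),
          lintegral_inv_norm_cube (by positivity)]
    _ ≤ ENNReal.ofReal (4 * s) * ENNReal.ofReal (2 * Real.pi / (2 * s)) +
        ∫⁻ x,
        (Metric.closedBall (0 : ℂ) (2 * m)).indicator (fun _ => ENNReal.ofReal (2 / m ^ 2)) x := by
        gcongr
        exact Measure.restrict_le_self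
    _ = _ := by
        rw [lintegral_indicator measurableSet_closedBall, setLIntegral_const,
          Complex.volume_closedBall, ← ENNReal.ofReal_mul (by positivity),
          ← ENNReal.ofReal_pow (by positivity), ← NNReal.coe_real_pi, ← ENNReal.ofReal_coe_nnreal,
          ← ENNReal.ofReal_mul (by positivity), ← ENNReal.ofReal_mul (by positivity),
          ← ENNReal.ofReal_add (by positivity) (by positivity)]
        congr 1
        field_simp
        ring

theorem kernelConv_eq_integral_sub (κ h : ℂ → ℂ) (x : ℂ) :
    kernelConv κ h x = ∫ y, κ (x - y) * h y := by
  rw [kernelConv, ← integral_sub_left_eq_self _ _ x]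
  simp

/-- Since b has mean zero, its kernel may be replaced by the difference from the value at c. After
Tonelli, Hörmander's condition applies to each y in the support. -/
theorem lintegral_kernelConv_trunc_le_of_integral_eq_zero {R : ℝ} (hR : 0 < R) {b : ℂ → ℂ}
    (hb : Measurable b) (hbi : Integrable b) (h0 : ∫ y, b y = 0) {c : ℂ} {s : ℝ}
    (hs : ∀ y, b y ≠ 0 → ‖y - c‖ ≤ s) :
    ∫⁻ x in {x : ℂ | 2 * s < ‖x - c‖}, ‖kernelConv (truncKernel R) b x‖ₑ ≤
      ENNReal.ofReal (12 * Real.pi) * ∫⁻ y, ‖b y‖ₑ := by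
  have mK := measurable_truncKernel R
  have hpt : ∀ x, ‖kernelConv (truncKernel R) b x‖ₑ ≤
      ∫⁻ y, ‖truncKernel R (x - y) - truncKernel R (x - c)‖ₑ * ‖b y‖ₑ := by
    intro x
    have i1 : Integrable fun y => truncKernel R (x - y) * b y :=
      hbi.bdd_mul (mK.comp (measurable_const.sub measurable_id)).aestronglyMeasurable
        (Eventually.of_forall fun y => norm_truncKernel_le hR _)
    have : kernelConv (truncKernel R) b x =
        ∫ y, (truncKernel R (x - y) - truncKernel R (x - c)) * b y := by
      simp only [sub_mul]
      rw [integral_sub i1 (hbi.const_mul _), integral_const_mul, h0, mul_zero, sub_zero,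
        kernelConv_eq_integral_sub]
    rw [this]
    refine (enorm_integral_le_lintegral_enorm _).trans (le_of_eq ?_)
    simp only [enorm_mul]
  have hset : MeasurableSet {x : ℂ | 2 * s < ‖x - c‖} :=
    measurableSet_lt measurable_const (measurable_id.sub_const c).norm
  calc _ ≤ ∫⁻ x in {x : ℂ | 2 * s < ‖x - c‖},
        ∫⁻ y, ‖truncKernel R (x - y) - truncKernel R (x - c)‖ₑ * ‖b y‖ₑ := by
        gcongr with x; exact hpt x
    _ = ∫⁻ y, ∫⁻ x in {x : ℂ | 2 * s < ‖x - c‖},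
        ‖truncKernel R (x - y) - truncKernel R (x - c)‖ₑ * ‖b y‖ₑ := by
        rw [lintegral_lintegral_swap]
        refine Measurable.aemeasurable ?_
        refine Measurable.mul (Measurable.enorm (Measurable.sub ?_ ?_)) ?_
        · exact mK.comp (measurable_fst.sub measurable_snd)
        · exact mK.comp (measurable_fst.sub measurable_const)
        · exact (hb.comp measurable_snd).enorm
    _ ≤ ∫⁻ y, ENNReal.ofReal (12 * Real.pi) * ‖b y‖ₑ := by
        gcongr with y
        by_cases hy : b y = 0
        · simp [hy]
        have hyc := hs y hy
        rw [lintegral_mul_const _ (by fun_prop)]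
        gcongr
        calc _ = ∫⁻ x, {x : ℂ | 2 * s < ‖x‖}.indicator
              (fun x => ‖truncKernel R (x - (y - c)) - truncKernel R x‖ₑ) (x - c) := by
              rw [← lintegral_indicator hset]
              congr 1; ext x
              by_cases hx : 2 * s < ‖x - c‖
              · rw [Set.indicator_of_mem (by exact hx), Set.indicator_of_mem (by exact hx)]
                simp
              · rw [Set.indicator_of_notMem (by exact hx), Set.indicator_of_notMem (by exact hx)]
          _ = ∫⁻ x in {x : ℂ | 2 * s < ‖x‖},
              ‖truncKernel R (x - (y - c)) - truncKernel R x‖ₑ := by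
              rw [lintegral_sub_right_eq_self (fun x => {x : ℂ | 2 * s < ‖x‖}.indicator
                (fun x => ‖truncKernel R (x - (y - c)) - truncKernel R x‖ₑ) x),
                lintegral_indicator (measurableSet_lt measurable_const measurable_norm)]
          _ ≤ ∫⁻ x in {x : ℂ | 2 * ‖y - c‖ < ‖x‖},
              ‖truncKernel R (x - (y - c)) - truncKernel R x‖ₑ := by
              refine lintegral_mono_set fun x hx => ?_
              have : 2 * s < ‖x‖ := hx
              show 2 * ‖y - c‖ < ‖x‖
              linarith
          _ ≤ _ := lintegral_truncKernel_sub_le _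
    _ = _ := lintegral_const_mul _ hb.enorm

/-! ### Dyadic squares and the Calderón–Zygmund decomposition -/

/-- The index of the dyadic square of side `2⁻ⁿ` that contains `z`. -/
noncomputable def dyadicIndex (n : ℕ) (z : ℂ) : ℤ × ℤ := (⌊2 ^ n * z.re⌋, ⌊2 ^ n * z.im⌋)

/-- The half-open dyadic square of side `2⁻ⁿ` with index `p`. -/
def dyadicSquare (n : ℕ) (p : ℤ × ℤ) : Set ℂ := {z | dyadicIndex n z = p}

theorem measurable_dyadicIndex (n : ℕ) : Measurable (dyadicIndex n) :=
  (Int.measurable_floor.comp (Complex.measurable_re.const_mul _)).prodMk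
    (Int.measurable_floor.comp (Complex.measurable_im.const_mul _))

theorem measurableSet_dyadicSquare (n : ℕ) (p : ℤ × ℤ) : MeasurableSet (dyadicSquare n p) :=
  measurable_dyadicIndex n (measurableSet_singleton p)

/-- Dyadic squares are nested: the index at generation n is half the index at generation n + 1,
rounded down. -/
theorem dyadicIndex_succ_congr {n : ℕ} {z w : ℂ} (h : dyadicIndex (n + 1) z = dyadicIndex (n + 1) w) :
    dyadicIndex n z = dyadicIndex n w := by
  have key : ∀ a : ℝ, ⌊(2:ℝ) ^ n * a⌋ = ⌊(2:ℝ) ^ (n + 1) * a⌋ / 2 := by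
    intro a
    have := Int.floor_div_natCast ((2:ℝ) ^ (n + 1) * a) 2
    push_cast at this
    rw [← this]
    congr 1
    rw [pow_succ]; ring
  simp only [dyadicIndex, Prod.mk.injEq] at h ⊢
  rw [key, key, key, key, h.1, h.2]
  exact ⟨rfl, rfl⟩

theorem dyadicIndex_congr_of_le {m n : ℕ} (hmn : m ≤ n) {z w : ℂ}
    (h : dyadicIndex n z = dyadicIndex n w) : dyadicIndex m z = dyadicIndex m w := by
  induction n, hmn using Nat.le_induction with
  | base => exact h
  | succ n _ ih => exact ih (dyadicIndex_succ_congr h)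

theorem dyadicSquare_eq (n : ℕ) (p : ℤ × ℤ) :
    dyadicSquare n p = Complex.measurableEquivRealProd ⁻¹'
      (Set.Ico ((p.1 : ℝ) / 2 ^ n) ((p.1 + 1) / 2 ^ n) ×ˢ
        Set.Ico ((p.2 : ℝ) / 2 ^ n) ((p.2 + 1) / 2 ^ n)) := by
  ext z
  have h2 : (0:ℝ) < 2 ^ n := by positivity
  simp only [dyadicSquare, dyadicIndex, Set.mem_ofPred_eq, Prod.ext_iff, Int.floor_eq_iff,
    Set.mem_preimage, Set.mem_prod, Set.mem_Ico, Complex.measurableEquivRealProd_apply,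
    div_le_iff₀ h2, lt_div_iff₀ h2, mul_comm]

theorem volume_dyadicSquare (n : ℕ) (p : ℤ × ℤ) :
    volume (dyadicSquare n p) = ENNReal.ofReal ((4 : ℝ) ^ n)⁻¹ := by
  rw [dyadicSquare_eq, Complex.volume_preserving_equiv_real_prod.measure_preimage_equiv,
    Measure.volume_eq_prod, Measure.prod_prod, Real.volume_Ico, Real.volume_Ico,
    ← ENNReal.ofReal_mul]
  · congr 1
    rw [show (4:ℝ) = 2 * 2 by norm_num, mul_pow]
    field_simp
    ring
  · rw [← sub_div]; simp

theorem norm_sub_le_of_dyadicIndex_eq {n : ℕ} {z w : ℂ} (h : dyadicIndex n z = dyadicIndex n w) :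
    ‖z - w‖ ≤ 2 * (2 ^ n)⁻¹ := by
  have h2 : (0:ℝ) < 2 ^ n := by positivity
  simp only [dyadicIndex, Prod.mk.injEq] at h
  have key : ∀ a b : ℝ, ⌊(2:ℝ) ^ n * a⌋ = ⌊(2:ℝ) ^ n * b⌋ → |a - b| ≤ (2 ^ n)⁻¹ := by
    intro a b hab
    have := Int.abs_sub_lt_one_of_floor_eq_floor hab
    rw [← mul_sub, abs_mul, abs_of_pos h2] at this
    rw [← one_div, le_div_iff₀ h2, mul_comm]
    exact this.le
  refine (Complex.norm_le_abs_re_add_abs_im _).trans ?_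
  have h3 := key _ _ h.1
  have h4 := key _ _ h.2
  rw [Complex.sub_re, Complex.sub_im]
  linarith

theorem measurable_kernelConv {κ h : ℂ → ℂ} (hκ : Measurable κ) (hh : Measurable h) :
    Measurable (kernelConv κ h) := by
  have : StronglyMeasurable (Function.uncurry fun z t : ℂ => κ t * h (z - t)) :=
    (Measurable.mul (hκ.comp measurable_snd)
      (hh.comp (measurable_fst.sub measurable_snd))).stronglyMeasurable
  exact this.integral_prod_right.measurable

/-- The average of `‖f‖` over the dyadic square of generation `n` around `z` exceeds `lam`. -/
def DyadicBad (f : ℂ → ℂ) (lam : ℝ≥0∞) (n : ℕ) (z : ℂ) : Prop :=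
  lam * volume (dyadicSquare n (dyadicIndex n z)) <
    ∫⁻ y in dyadicSquare n (dyadicIndex n z), ‖f y‖ₑ

open Classical in
/-- The generation and the index of the maximal dyadic square around `z` on which the average of
`‖f‖` exceeds `lam`; the generation is `0` if there is none. -/
noncomputable def stopIndex (f : ℂ → ℂ) (lam : ℝ≥0∞) (z : ℂ) : ℕ × (ℤ × ℤ) :=
  if h : ∃ n, DyadicBad f lam n z then (Nat.find h, dyadicIndex (Nat.find h) z) else (0, (0, 0))

section
variable {f : ℂ → ℂ} {lam : ℝ≥0∞}

theorem DyadicBad.congr {n : ℕ} {z w : ℂ} (h : dyadicIndex n z = dyadicIndex n w) :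
    DyadicBad f lam n z ↔ DyadicBad f lam n w := by
  simp only [DyadicBad, h]

theorem not_dyadicBad_zero (hlam : ∫⁻ y, ‖f y‖ₑ ≤ lam) (z : ℂ) : ¬ DyadicBad f lam 0 z := by
  rw [DyadicBad, not_lt, volume_dyadicSquare]
  simpa using (setLIntegral_le_lintegral _ _).trans hlam

theorem measurableSet_dyadicBad (n : ℕ) : MeasurableSet {z | DyadicBad f lam n z} := by
  have : {z | DyadicBad f lam n z} = dyadicIndex n ⁻¹' {p | lam * volume (dyadicSquare n p) <
    ∫⁻ y in dyadicSquare n p, ‖f y‖ₑ} := rfl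
  rw [this]
  exact measurable_dyadicIndex n (Set.to_countable _).measurableSet

theorem exists_dyadicBad_of_stopIndex_ne {z : ℂ} (h : (stopIndex f lam z).1 ≠ 0) :
    ∃ n, DyadicBad f lam n z := by
  by_contra h'
  simp [stopIndex, h'] at h

theorem stopIndex_spec {z : ℂ} (h : (stopIndex f lam z).1 ≠ 0) :
    DyadicBad f lam (stopIndex f lam z).1 z ∧
    (∀ m < (stopIndex f lam z).1, ¬ DyadicBad f lam m z) ∧
    (stopIndex f lam z).2 = dyadicIndex (stopIndex f lam z).1 z := by
  classical
  have hex := exists_dyadicBad_of_stopIndex_ne h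
  have e : stopIndex f lam z = (Nat.find hex, dyadicIndex (Nat.find hex) z) := by
    rw [stopIndex, dif_pos hex]
  rw [e]
  exact ⟨Nat.find_spec hex, fun m hm => Nat.find_min hex hm, rfl⟩

theorem stopIndex_eq_of_first {z : ℂ} {n : ℕ} (h : DyadicBad f lam n z)
    (h' : ∀ m < n, ¬ DyadicBad f lam m z) : stopIndex f lam z = (n, dyadicIndex n z) := by
  classical
  have hex : ∃ n, DyadicBad f lam n z := ⟨n, h⟩
  have e : Nat.find hex = n := (Nat.find_eq_iff hex).2 ⟨h, h'⟩
  rw [stopIndex, dif_pos hex, e]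

/-- By nestedness all points of a dyadic square share the squares of the earlier generations, hence
also the first generation at which the average is too large. -/
theorem preimage_stopIndex {z : ℂ} (h : (stopIndex f lam z).1 ≠ 0) :
    stopIndex f lam ⁻¹' {stopIndex f lam z} =
      dyadicSquare (stopIndex f lam z).1 (stopIndex f lam z).2 := by
  obtain ⟨h1, h2, h3⟩ := stopIndex_spec h
  ext w
  constructor
  · intro hw
    have hw' : stopIndex f lam w = stopIndex f lam z := hw
    have h4 := stopIndex_spec (f := f) (lam := lam) (z := w) (by rw [hw']; exact h)
    rw [hw'] at h4
    exact h4.2.2.symm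
  · intro hw
    have hw' : dyadicIndex (stopIndex f lam z).1 w = dyadicIndex (stopIndex f lam z).1 z := by
      rw [← h3]; exact hw
    have h5 := stopIndex_eq_of_first ((DyadicBad.congr hw').2 h1) (fun m hm hb =>
      h2 m hm ((DyadicBad.congr (dyadicIndex_congr_of_le hm.le hw')).1 hb))
    show stopIndex f lam w = stopIndex f lam z
    rw [h5, hw', ← h3]

/-- The fibres with nonzero generation are dyadic squares. Generation 0 needs care because the level
is arbitrary here: the value `(0, (0, 0))` may be the default as well as a genuinely selected unit
square. -/
theorem measurable_stopIndex : Measurable (stopIndex f lam) := by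
  classical
  have hset : MeasurableSet {z | ∃ n, DyadicBad f lam n z} := by
    have : {z | ∃ n, DyadicBad f lam n z} = ⋃ n, {z | DyadicBad f lam n z} := by ext; simp
    rw [this]
    exact MeasurableSet.iUnion fun n => measurableSet_dyadicBad n
  refine measurable_to_countable' fun i => ?_
  by_cases hi : ∃ z, stopIndex f lam z = i ∧ i.1 ≠ 0
  · obtain ⟨z, rfl, hz⟩ := hi
    rw [preimage_stopIndex hz]
    exact measurableSet_dyadicSquare _ _
  by_cases hb : ∃ z, DyadicBad f lam 0 z ∧ stopIndex f lam z = i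
  · obtain ⟨z, hz, rfl⟩ := hb
    have e : ∀ w, DyadicBad f lam 0 w → stopIndex f lam w = (0, dyadicIndex 0 w) := fun w hw =>
      stopIndex_eq_of_first hw (by simp)
    have : stopIndex f lam ⁻¹' {stopIndex f lam z} =
        ({w | DyadicBad f lam 0 w} ∩ dyadicIndex 0 ⁻¹' {dyadicIndex 0 z}) ∪
        ({w | ∃ n, DyadicBad f lam n w}ᶜ ∩ {_w | stopIndex f lam z = (0, (0, 0))}) := by
      ext w
      simp only [Set.mem_preimage, Set.mem_singleton_iff, Set.mem_union, Set.mem_inter_iff,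
        Set.mem_compl_iff]
      constructor
      · intro hw
        by_cases hex : ∃ n, DyadicBad f lam n w
        · left
          have h0 : (stopIndex f lam w).1 = 0 := by rw [hw, e z hz]
          rw [stopIndex, dif_pos hex] at h0
          have hb0 : DyadicBad f lam 0 w := by
            have := Nat.find_spec hex
            rwa [show Nat.find hex = 0 from h0] at this
          refine ⟨hb0, ?_⟩
          rw [e w hb0, e z hz] at hw
          exact (Prod.ext_iff.1 hw).2
        · right
          refine ⟨hex, ?_⟩
          show stopIndex f lam z = _
          rw [← hw, stopIndex, dif_neg hex]
      · rintro (⟨h1, h2⟩ | ⟨h1, h2⟩)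
        · rw [e w h1, e z hz, h2]
        · have h2' : stopIndex f lam z = (0, (0, 0)) := h2
          have h1' : ¬ ∃ n, DyadicBad f lam n w := h1
          rw [h2', stopIndex, dif_neg h1']
    rw [this]
    exact ((measurableSet_dyadicBad 0).inter (measurable_dyadicIndex 0 (measurableSet_singleton _))).union
      (hset.compl.inter (MeasurableSet.const _))
  · by_cases h0 : i = (0, (0, 0))
    · have : stopIndex f lam ⁻¹' {i} = {w | ∃ n, DyadicBad f lam n w}ᶜ := by
        ext w
        simp only [Set.mem_preimage, Set.mem_singleton_iff, Set.mem_compl_iff]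
        constructor
        · rintro hw hex
          have hex' : ∃ n, DyadicBad f lam n w := hex
          have h2 : (stopIndex f lam w).1 = 0 := by rw [hw, h0]
          rw [stopIndex, dif_pos hex'] at h2
          have := Nat.find_spec hex'
          rw [show Nat.find hex' = 0 from h2] at this
          exact hb ⟨w, this, hw⟩
        · intro hex
          have hex' : ¬ ∃ n, DyadicBad f lam n w := hex
          rw [stopIndex, dif_neg hex', h0]
      rw [this]
      exact hset.compl
    · have : stopIndex f lam ⁻¹' {i} = ∅ := by
        ext w
        simp only [Set.mem_preimage, Set.mem_singleton_iff, Set.mem_empty_iff_false, iff_false]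
        intro hw
        have h1 : i.1 = 0 := by
          by_contra h1
          exact hi ⟨w, hw, h1⟩
        by_cases hex : ∃ n, DyadicBad f lam n w
        · have h2 : (stopIndex f lam w).1 = 0 := by rw [hw, h1]
          rw [stopIndex, dif_pos hex] at h2
          have := Nat.find_spec hex
          rw [show Nat.find hex = 0 from h2] at this
          exact hb ⟨w, this, hw⟩
        · rw [stopIndex, dif_neg hex] at hw
          exact h0 hw.symm
      rw [this]
      exact MeasurableSet.empty

/-- Off the union of the selected squares, `‖f‖ ≤ lam` almost everywhere. -/
theorem ae_enorm_le_of_not_dyadicBad (hf : Integrable f) :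
    ∀ᵐ z, (∀ n, ¬ DyadicBad f lam n z) → ‖f z‖ₑ ≤ lam := by
  filter_upwards [(Besicovitch.vitaliFamily (volume : Measure ℂ)).ae_tendsto_lintegral_enorm_sub_div
    hf.locallyIntegrable] with z hz hbad
  have hr : Tendsto (fun n : ℕ => 2 * ((2:ℝ) ^ n)⁻¹) atTop (𝓝[>] 0) := by
    refine tendsto_nhdsWithin_iff.2 ⟨?_, Eventually.of_forall fun n => by
      show (0:ℝ) < _; positivity⟩
    have := (tendsto_pow_atTop_nhds_zero_of_lt_one (r := (2:ℝ)⁻¹) (by norm_num)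
      (by norm_num)).const_mul 2
    simpa using this
  have h := hz.comp ((Besicovitch.tendsto_filterAt volume z).comp hr)
  -- The factor 4π is the area of the disc of radius 2 · 2⁻ⁿ divided by that of the dyadic square it
  -- contains.
  have h2 := (ENNReal.Tendsto.const_mul (a := ENNReal.ofReal (4 * Real.pi)) h
    (Or.inr ENNReal.ofReal_ne_top)).const_add lam
  rw [mul_zero, add_zero] at h2
  refine ge_of_tendsto h2 (Eventually.of_forall fun n => ?_)
  set Q := dyadicSquare n (dyadicIndex n z) with hQ
  set B := Metric.closedBall z (2 * ((2:ℝ) ^ n)⁻¹) with hB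
  have hQB : Q ⊆ B := fun w hw => by
    rw [hB, Metric.mem_closedBall, dist_eq_norm]
    exact norm_sub_le_of_dyadicIndex_eq hw
  have vQ : volume Q = ENNReal.ofReal ((4 : ℝ) ^ n)⁻¹ := volume_dyadicSquare _ _
  have vQ0 : volume Q ≠ 0 := by rw [vQ]; simp
  have vQt : volume Q ≠ ⊤ := by rw [vQ]; simp
  have vB : volume B = ENNReal.ofReal (4 * Real.pi) * volume Q := by
    rw [hB, vQ, Complex.volume_closedBall, ← ENNReal.ofReal_pow (by positivity),
      ← NNReal.coe_real_pi, ← ENNReal.ofReal_coe_nnreal, ← ENNReal.ofReal_mul (by positivity),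
      ← ENNReal.ofReal_mul (by positivity)]
    congr 1
    rw [show (4:ℝ) ^ n = 2 ^ n * 2 ^ n by rw [← mul_pow]; norm_num]
    field_simp
    ring
  have hle : ‖f z‖ₑ * volume Q ≤ lam * volume Q + ∫⁻ y in B, ‖f y - f z‖ₑ := by
    calc ‖f z‖ₑ * volume Q = ∫⁻ y in Q, ‖f z‖ₑ := by rw [setLIntegral_const]
      _ ≤ ∫⁻ y in Q, (‖f y‖ₑ + ‖f y - f z‖ₑ) := by
          gcongr with y
          calc ‖f z‖ₑ = ‖f y - (f y - f z)‖ₑ := by congr 1; ring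
            _ ≤ _ := enorm_sub_le
      _ = (∫⁻ y in Q, ‖f y‖ₑ) + ∫⁻ y in Q, ‖f y - f z‖ₑ :=
          lintegral_add_left' hf.1.enorm.restrict _
      _ ≤ _ := add_le_add (not_lt.1 (hbad n)) (lintegral_mono_set hQB)
  show ‖f z‖ₑ ≤ lam + ENNReal.ofReal (4 * Real.pi) * ((∫⁻ y in B, ‖f y - f z‖ₑ) / volume B)
  have hp0 : ENNReal.ofReal (4 * Real.pi) ≠ 0 := by
    have := Real.pi_pos
    simp [this]
  rw [vB, ← mul_div_assoc, ENNReal.mul_div_mul_left _ _ hp0 ENNReal.ofReal_ne_top]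
  rw [← ENNReal.mul_le_mul_iff_left vQ0 vQt, add_mul, ENNReal.div_mul_cancel vQ0 vQt]
  exact hle

end

/-- The function that equals `f` off the selected squares and the average of `f` on each of
them. -/
noncomputable def czGood (f : ℂ → ℂ) (lam : ℝ≥0∞) (z : ℂ) : ℂ :=
  if (stopIndex f lam z).1 = 0 then f z else
    ((4 : ℂ) ^ (stopIndex f lam z).1) *
      ∫ y in dyadicSquare (stopIndex f lam z).1 (stopIndex f lam z).2, f y

section
variable {f : ℂ → ℂ} {lam : ℝ≥0∞}

theorem measurable_czGood (hf : Measurable f) : Measurable (czGood f lam) := by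
  have hi := measurable_stopIndex (f := f) (lam := lam)
  refine Measurable.ite (hi (Set.to_countable {i : ℕ × ℤ × ℤ | i.1 = 0}).measurableSet) hf ?_
  exact (measurable_of_countable (fun i : ℕ × ℤ × ℤ => ((4 : ℂ) ^ i.1) *
    ∫ y in dyadicSquare i.1 i.2, f y)).comp hi

/-- The selected square with index `i` (empty if it is not selected). -/
def czSquare (f : ℂ → ℂ) (lam : ℝ≥0∞) (i : ℕ × ℤ × ℤ) : Set ℂ :=
  {z | stopIndex f lam z = i ∧ i.1 ≠ 0}

theorem measurableSet_czSquare (i : ℕ × ℤ × ℤ) : MeasurableSet (czSquare f lam i) :=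
  (measurable_stopIndex (measurableSet_singleton i)).inter (MeasurableSet.const _)

theorem pairwise_disjoint_czSquare : Pairwise (Function.onFun Disjoint (czSquare f lam)) := by
  intro i j hij
  rw [Function.onFun, Set.disjoint_left]
  rintro z ⟨h1, -⟩ ⟨h2, -⟩
  exact hij (h1.symm.trans h2)

theorem iUnion_czSquare : ⋃ i, czSquare f lam i = {z | (stopIndex f lam z).1 ≠ 0} := by
  ext z
  simp [czSquare]

/-- The upper bound comes from the parent square, which was not selected and has four times the
area. The parent exists because the generation is not 0. -/
theorem czSquare_eq {i : ℕ × ℤ × ℤ} (hne : (czSquare f lam i).Nonempty) :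
    czSquare f lam i = dyadicSquare i.1 i.2 ∧
    lam * volume (czSquare f lam i) ≤ (∫⁻ y in czSquare f lam i, ‖f y‖ₑ) ∧
    ∫⁻ y in czSquare f lam i, ‖f y‖ₑ ≤ 4 * lam * volume (czSquare f lam i) := by
  obtain ⟨z, hz, hi⟩ := hne
  subst hz
  obtain ⟨h1, h2, h3⟩ := stopIndex_spec hi
  have e : czSquare f lam (stopIndex f lam z) =
      dyadicSquare (stopIndex f lam z).1 (stopIndex f lam z).2 := by
    rw [← preimage_stopIndex hi]
    ext w
    simp [czSquare, hi]
  refine ⟨e, ?_, ?_⟩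
  · rw [e, h3]
    exact (le_of_lt h1)
  · rw [e]
    obtain ⟨m, hm⟩ := Nat.exists_eq_succ_of_ne_zero hi
    have h4 := h2 m (by omega)
    rw [DyadicBad, not_lt, volume_dyadicSquare] at h4
    have hsub : dyadicSquare (stopIndex f lam z).1 (stopIndex f lam z).2 ⊆
        dyadicSquare m (dyadicIndex m z) := by
      intro w hw
      have hw' : dyadicIndex (stopIndex f lam z).1 w = dyadicIndex (stopIndex f lam z).1 z := by
        rw [← h3]; exact hw
      exact dyadicIndex_congr_of_le (by omega) hw'
    refine (lintegral_mono_set hsub).trans (h4.trans (le_of_eq ?_))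
    rw [volume_dyadicSquare, hm, mul_comm 4, mul_assoc]
    congr 1
    rw [show (4 : ℝ≥0∞) = ENNReal.ofReal 4 by simp, ← ENNReal.ofReal_mul (by norm_num)]
    congr 1
    rw [Nat.succ_eq_add_one, pow_succ]
    field_simp

theorem czGood_of_mem {i : ℕ × ℤ × ℤ} {z : ℂ} (hz : z ∈ czSquare f lam i) :
    czGood f lam z = ((4 : ℂ) ^ i.1) * ∫ y in dyadicSquare i.1 i.2, f y := by
  obtain ⟨h1, h2⟩ := hz
  rw [czGood, h1, if_neg h2]

theorem volume_czSquare {i : ℕ × ℤ × ℤ} (hne : (czSquare f lam i).Nonempty) :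
    volume (czSquare f lam i) = ENNReal.ofReal ((4 : ℝ) ^ i.1)⁻¹ := by
  rw [(czSquare_eq hne).1, volume_dyadicSquare]

theorem enorm_czGood_mul_volume_le {i : ℕ × ℤ × ℤ} {z : ℂ} (hz : z ∈ czSquare f lam i)
    :
    ‖czGood f lam z‖ₑ * volume (czSquare f lam i) ≤ ∫⁻ y in czSquare f lam i, ‖f y‖ₑ := by
  have h4 : ‖(4 : ℂ) ^ i.1‖ₑ * ENNReal.ofReal ((4 : ℝ) ^ i.1)⁻¹ = 1 := by
    rw [← ofReal_norm, ← ENNReal.ofReal_mul (norm_nonneg _)]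
    simp
  rw [czGood_of_mem hz, volume_czSquare ⟨z, hz⟩, enorm_mul, mul_right_comm, h4, one_mul,
    (czSquare_eq ⟨z, hz⟩).1]
  exact enorm_integral_le_lintegral_enorm _

theorem setLIntegral_czGood_le (i : ℕ × ℤ × ℤ) :
    ∫⁻ z in czSquare f lam i, ‖czGood f lam z‖ₑ ≤ ∫⁻ z in czSquare f lam i, ‖f z‖ₑ := by
  rcases (czSquare f lam i).eq_empty_or_nonempty with h | ⟨z, hz⟩
  · simp [h]
  · refine le_trans (le_of_eq ?_) (enorm_czGood_mul_volume_le hz)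
    rw [← setLIntegral_const]
    refine setLIntegral_congr_fun (measurableSet_czSquare i) fun w hw => ?_
    simp only [czGood_of_mem hw, czGood_of_mem hz]

theorem setIntegral_sub_czGood (hfi : Integrable f) (i : ℕ × ℤ × ℤ) :
    ∫ z in czSquare f lam i, (f z - czGood f lam z) = 0 := by
  rcases (czSquare f lam i).eq_empty_or_nonempty with h | hne
  · simp [h]
  · rw [setIntegral_congr_fun (measurableSet_czSquare i) (g := fun z => f z -
      ((4 : ℂ) ^ i.1) * ∫ y in dyadicSquare i.1 i.2, f y)
      (fun w hw => by simp only [czGood_of_mem hw]),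
      integral_sub hfi.integrableOn (by
        refine integrableOn_const ?_
        rw [volume_czSquare hne]; simp), setIntegral_const, (czSquare_eq hne).1,
      Measure.real, volume_dyadicSquare, ENNReal.toReal_ofReal (by positivity)]
    rw [Complex.real_smul, ← mul_assoc]
    push_cast
    rw [inv_mul_cancel₀ (pow_ne_zero _ (by norm_num)), one_mul, sub_self]

theorem lintegral_czGood_le :
    ∫⁻ z, ‖czGood f lam z‖ₑ ≤ ∫⁻ z, ‖f z‖ₑ ∧
    ∫⁻ z in ⋃ i, czSquare f lam i, ‖czGood f lam z‖ₑ ≤ ∫⁻ z in ⋃ i, czSquare f lam i, ‖f z‖ₑ := by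
  have hm : MeasurableSet (⋃ i, czSquare f lam i) :=
    MeasurableSet.iUnion fun i => measurableSet_czSquare i
  have h2 : ∫⁻ z in ⋃ i, czSquare f lam i, ‖czGood f lam z‖ₑ ≤
      ∫⁻ z in ⋃ i, czSquare f lam i, ‖f z‖ₑ := by
    rw [lintegral_iUnion measurableSet_czSquare pairwise_disjoint_czSquare,
      lintegral_iUnion measurableSet_czSquare pairwise_disjoint_czSquare]
    exact ENNReal.tsum_le_tsum fun i => setLIntegral_czGood_le i
  refine ⟨?_, h2⟩
  rw [← lintegral_add_compl _ hm, ← lintegral_add_compl (fun z => ‖f z‖ₑ) hm]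
  refine add_le_add h2 (le_of_eq (setLIntegral_congr_fun hm.compl fun z hz => ?_))
  rw [iUnion_czSquare] at hz
  have : (stopIndex f lam z).1 = 0 := by simpa using hz
  simp only [czGood, this, if_true]

/-- Off the selected squares this is Lebesgue differentiation, and on them the average is controlled
through the parent. The level must exceed ‖f‖₁, since `czGood` leaves f unchanged on a bad square of
generation 0. -/
theorem ae_enorm_czGood_le (hfi : Integrable f) (hlam : ∫⁻ y, ‖f y‖ₑ ≤ lam) :
    ∀ᵐ z, ‖czGood f lam z‖ₑ ≤ 4 * lam := by
  filter_upwards [ae_enorm_le_of_not_dyadicBad (lam := lam) hfi] with z hz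
  by_cases h : (stopIndex f lam z).1 = 0
  · rw [czGood, if_pos h]
    refine (hz fun n hn => ?_).trans (le_mul_of_one_le_left' (by norm_num))
    classical
    have hex : ∃ n, DyadicBad f lam n z := ⟨n, hn⟩
    rw [stopIndex, dif_pos hex] at h
    have h0 := Nat.find_spec hex
    rw [show Nat.find hex = 0 from h] at h0
    exact not_dyadicBad_zero hlam z h0
  · have hmem : z ∈ czSquare f lam (stopIndex f lam z) := ⟨rfl, h⟩
    have h1 := (enorm_czGood_mul_volume_le hmem).trans (czSquare_eq ⟨z, hmem⟩).2.2
    have v := volume_czSquare ⟨z, hmem⟩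
    rwa [ENNReal.mul_le_mul_iff_left (by rw [v]; simp) (by rw [v]; simp)] at h1

theorem lam_mul_volume_le :
    lam * volume (⋃ i, czSquare f lam i) ≤ ∫⁻ z in ⋃ i, czSquare f lam i, ‖f z‖ₑ := by
  rw [lintegral_iUnion measurableSet_czSquare pairwise_disjoint_czSquare,
    measure_iUnion pairwise_disjoint_czSquare measurableSet_czSquare, ← ENNReal.tsum_mul_left]
  refine ENNReal.tsum_le_tsum fun i => ?_
  rcases (czSquare f lam i).eq_empty_or_nonempty with h | hne
  · simp [h]
  · exact (czSquare_eq hne).2.1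

theorem sub_czGood_eq_zero {z : ℂ} (hz : z ∉ ⋃ i, czSquare f lam i) : f z - czGood f lam z = 0 := by
  rw [iUnion_czSquare] at hz
  have : (stopIndex f lam z).1 = 0 := by simpa using hz
  simp [czGood, this]

theorem lintegral_sub_czGood_le (hf : Measurable f) :
    ∫⁻ z, ‖f z - czGood f lam z‖ₑ ≤ 2 * ∫⁻ z in ⋃ i, czSquare f lam i, ‖f z‖ₑ := by
  have hm : MeasurableSet (⋃ i, czSquare f lam i) :=
    MeasurableSet.iUnion fun i => measurableSet_czSquare i
  rw [← lintegral_add_compl _ hm]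
  have h0 : ∫⁻ z in (⋃ i, czSquare f lam i)ᶜ, ‖f z - czGood f lam z‖ₑ = 0 := by
    rw [setLIntegral_congr_fun hm.compl (g := fun _ => 0)
      (fun z hz => by simp only [sub_czGood_eq_zero hz, enorm_zero])]
    simp
  rw [h0, add_zero]
  calc _ ≤ ∫⁻ z in ⋃ i, czSquare f lam i, (‖f z‖ₑ + ‖czGood f lam z‖ₑ) := by
        gcongr with z; exact enorm_sub_le
    _ = _ := lintegral_add_left hf.enorm _
    _ ≤ _ := by
      rw [two_mul]
      exact add_le_add le_rfl lintegral_czGood_le.2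

open Classical in
/-- The union of the dilated selected squares. -/
noncomputable def czExceptional (f : ℂ → ℂ) (lam : ℝ≥0∞) : Set ℂ :=
  -- A square of side 2⁻ⁿ lies in the disc of radius 2 · 2⁻ⁿ about any of its points; that radius is
  -- doubled, as Hörmander's condition requires.
  ⋃ i, if h : (czSquare f lam i).Nonempty then
    Metric.closedBall h.some (2 * (2 * (2 ^ i.1)⁻¹)) else ∅

theorem measurableSet_czExceptional : MeasurableSet (czExceptional f lam) := by
  refine MeasurableSet.iUnion fun i => ?_
  split_ifs
  · exact measurableSet_closedBall
  · exact MeasurableSet.empty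

theorem volume_czExceptional_le :
    volume (czExceptional f lam) ≤
      ENNReal.ofReal (16 * Real.pi) * volume (⋃ i, czSquare f lam i) := by
  rw [measure_iUnion pairwise_disjoint_czSquare measurableSet_czSquare, ← ENNReal.tsum_mul_left]
  refine (measure_iUnion_le _).trans (ENNReal.tsum_le_tsum fun i => ?_)
  split_ifs with h
  · rw [volume_czSquare h, Complex.volume_closedBall, ← ENNReal.ofReal_pow (by positivity),
      ← NNReal.coe_real_pi, ← ENNReal.ofReal_coe_nnreal, ← ENNReal.ofReal_mul (by positivity),
      ← ENNReal.ofReal_mul (by positivity)]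
    refine le_of_eq ?_
    congr 1
    rw [show (4:ℝ) ^ i.1 = 2 ^ i.1 * 2 ^ i.1 by rw [← mul_pow]; norm_num]
    field_simp
    ring
  · simp

/-- The bad part is a sum of mean-zero functions, each living on one selected square, and
Hörmander's condition bounds the transform of each off its doubled disc. The squares are disjoint,
so the L¹ norms add up. -/
theorem setLIntegral_kernelConv_sub_czGood_le (hf : Measurable f) (hfi : Integrable f)
    {R : ℝ} (hR : 0 < R) :
    ∫⁻ x in (czExceptional f lam)ᶜ,
      ‖kernelConv (truncKernel R) (fun z => f z - czGood f lam z) x‖ₑ ≤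
      ENNReal.ofReal (12 * Real.pi) * ∫⁻ z, ‖f z - czGood f lam z‖ₑ := by
  set b := fun z => f z - czGood f lam z with hb
  have mb : Measurable b := hf.sub (measurable_czGood hf)
  have ib : Integrable b := by
    refine hfi.sub ⟨(measurable_czGood hf).aestronglyMeasurable, ?_⟩
    exact lintegral_czGood_le.1.trans_lt hfi.2
  have mK := measurable_truncKernel R
  set β : ℕ × ℤ × ℤ → ℂ → ℂ := fun i => (czSquare f lam i).indicator b with hβ
  have mβ : ∀ i, Measurable (β i) := fun i => mb.indicator (measurableSet_czSquare i)
  have hpt : ∀ x, ‖kernelConv (truncKernel R) b x‖ₑ ≤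
      ∑' i, ‖kernelConv (truncKernel R) (β i) x‖ₑ := by
    intro x
    have i1 : Integrable fun y => truncKernel R (x - y) * b y :=
      ib.bdd_mul (mK.comp (measurable_const.sub measurable_id)).aestronglyMeasurable
        (Eventually.of_forall fun y => norm_truncKernel_le hR _)
    have e1 : kernelConv (truncKernel R) b x =
        ∫ y in ⋃ i, czSquare f lam i, truncKernel R (x - y) * b y := by
      rw [kernelConv_eq_integral_sub, setIntegral_eq_integral_of_forall_compl_eq_zero]
      intro y hy
      simp only [hb, sub_czGood_eq_zero hy, mul_zero]
    rw [e1, integral_iUnion measurableSet_czSquare pairwise_disjoint_czSquare i1.integrableOn]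
    refine enorm_tsum_le_tsum_enorm.trans (le_of_eq ?_)
    congr 1; ext i
    rw [kernelConv_eq_integral_sub, ← integral_indicator (measurableSet_czSquare i)]
    congr 2; ext y
    by_cases hy : y ∈ czSquare f lam i
    · simp [hβ, hy]
    · simp [hβ, hy]
  calc _ ≤ ∫⁻ x in (czExceptional f lam)ᶜ, ∑' i, ‖kernelConv (truncKernel R) (β i) x‖ₑ := by
        gcongr with x; exact hpt x
    _ = ∑' i, ∫⁻ x in (czExceptional f lam)ᶜ, ‖kernelConv (truncKernel R) (β i) x‖ₑ :=
        lintegral_tsum fun i => (measurable_kernelConv mK (mβ i)).enorm.aemeasurable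
    _ ≤ ∑' i, ENNReal.ofReal (12 * Real.pi) * ∫⁻ y, ‖β i y‖ₑ := by
        refine ENNReal.tsum_le_tsum fun i => ?_
        by_cases hne : (czSquare f lam i).Nonempty
        · refine le_trans ?_ (lintegral_kernelConv_trunc_le_of_integral_eq_zero hR (mβ i)
            (ib.indicator (measurableSet_czSquare i)) ?_ (c := hne.some) (s := 2 * (2 ^ i.1)⁻¹) ?_)
          · refine lintegral_mono_set fun x hx => ?_
            show 2 * (2 * (2 ^ i.1)⁻¹) < ‖x - hne.some‖
            by_contra hcon
            refine hx (Set.mem_iUnion.2 ⟨i, ?_⟩)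
            rw [dif_pos hne, Metric.mem_closedBall, dist_eq_norm]
            exact not_lt.1 hcon
          · rw [integral_indicator (measurableSet_czSquare i)]
            exact setIntegral_sub_czGood hfi i
          · intro y hy
            have hy' : y ∈ czSquare f lam i := by
              by_contra hcon
              exact hy (by simp [hβ, hcon])
            have hsub := (czSquare_eq hne).1.subset
            exact norm_sub_le_of_dyadicIndex_eq
              (Eq.trans (hsub hy') (Eq.symm (hsub hne.some_mem)))
        · rw [Set.not_nonempty_iff_eq_empty] at hne
          simp [hβ, hne, kernelConv]
    _ = ENNReal.ofReal (12 * Real.pi) * ∑' i, ∫⁻ y in czSquare f lam i, ‖b y‖ₑ := by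
        rw [ENNReal.tsum_mul_left]
        congr 2; ext i
        rw [← lintegral_indicator (measurableSet_czSquare i)]
        congr 1; ext y
        by_cases hy : y ∈ czSquare f lam i
        · simp [hβ, hy]
        · simp [hβ, hy]
    _ ≤ _ := by
        gcongr
        rw [← lintegral_iUnion measurableSet_czSquare pairwise_disjoint_czSquare]
        exact setLIntegral_le_lintegral _ _

end

/-- A Calderón–Zygmund decomposition of an integrable function with arbitrarily small error. -/
theorem exists_calderonZygmund {f : ℂ → ℂ} (hf : Measurable f) (hfi : Integrable f) {δ : ℝ≥0∞}
    (hδ : δ ≠ 0) :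
    ∃ g : ℂ → ℂ, ∃ E : Set ℂ, Measurable g ∧ Integrable g ∧ MemLp g 2 ∧ MeasurableSet E ∧
      volume E ≤ δ ∧ volume E * ∫⁻ z, ‖g z‖ₑ ^ 2 ≤ δ ∧ ∫⁻ z, ‖f z - g z‖ₑ ≤ δ ∧
      ∀ R > 0, ∫⁻ x in Eᶜ, ‖kernelConv (truncKernel R) (fun z => f z - g z) x‖ₑ ≤ δ := by
  set A := ∫⁻ z, ‖f z‖ₑ with hA
  have hAt : A ≠ ⊤ := hfi.2.ne
  set p := ENNReal.ofReal Real.pi with hp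
  -- The four summands are the constants of the four final estimates: 16π for |E|, 64πA = 16π · 4A
  -- for |E|‖g‖₂², 2 for ‖f - g‖₁, and 24π = 12π · 2 for the transform of the bad part.
  set M : ℝ≥0∞ := 16 * p + 64 * p * A + 2 + 24 * p with hM
  have hMt : M ≠ ⊤ := by
    simp only [hM]
    finiteness
  have hM0 : M ≠ 0 := by simp [hM]
  obtain ⟨T, hT0, hT⟩ : ∃ T : ℝ≥0∞, T ≠ 0 ∧ M * T ≤ δ :=
    ⟨δ / M, (ENNReal.div_pos hδ hMt).ne', by rw [ENNReal.mul_div_cancel hM0 hMt]⟩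
  obtain ⟨η, hη, hsmall⟩ := exists_pos_setLIntegral_lt_of_measure_lt (f := fun z => ‖f z‖ₑ) hAt hT0
  -- choice of the level
  obtain ⟨lam, hl1, hlA, hlη, hlt⟩ : ∃ lam : ℝ≥0∞, 1 ≤ lam ∧ A ≤ lam ∧ A / lam < η ∧ lam ≠ ⊤ := by
    obtain ⟨η', h0, hlt⟩ := exists_between hη
    have hη't : η' ≠ ⊤ := hlt.ne_top
    refine ⟨max (max 1 A) (A / η'), le_max_of_le_left (le_max_left _ _),
      le_max_of_le_left (le_max_right _ _), ?_, ?_⟩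
    · refine lt_of_le_of_lt ?_ hlt
      refine ENNReal.div_le_of_le_mul ?_
      calc A = η' * (A / η') := (ENNReal.mul_div_cancel h0.ne' hη't).symm
        _ ≤ _ := by gcongr; exact le_max_right _ _
    · simp only [ne_eq, max_eq_top, not_or]
      exact ⟨⟨ENNReal.one_ne_top, hAt⟩, (ENNReal.div_lt_top hAt h0.ne').ne⟩
  set Ω := ⋃ i, czSquare f lam i with hΩ
  have hl0 : lam ≠ 0 := (lt_of_lt_of_le one_pos hl1).ne'
  have hvol := lam_mul_volume_le (f := f) (lam := lam)
  rw [← hΩ] at hvol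
  -- A high level makes |Ω| ≤ A / lam small, and absolute continuity makes the mass of f on Ω small.
  -- That mass also bounds lam |Ω|, so |E|‖g‖₂² stays small although the bound 4 lam A for ‖g‖₂²
  -- grows with the level.
  have hTΩ : ∫⁻ z in Ω, ‖f z‖ₑ ≤ T := by
    refine (hsmall Ω (lt_of_le_of_lt ?_ hlη)).le
    rw [ENNReal.le_div_iff_mul_le (Or.inl hl0) (Or.inl hlt), mul_comm]
    exact hvol.trans (setLIntegral_le_lintegral _ _)
  have hlΩ : lam * volume Ω ≤ T := hvol.trans hTΩ
  have hvΩ : volume Ω ≤ T := le_trans (le_mul_of_one_le_left' hl1) hlΩ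
  have hE := volume_czExceptional_le (f := f) (lam := lam)
  have mg := measurable_czGood (lam := lam) hf
  have hg1 := (lintegral_czGood_le (f := f) (lam := lam)).1
  have hg2 : ∫⁻ z, ‖czGood f lam z‖ₑ ^ 2 ≤ 4 * lam * A := by
    calc _ ≤ ∫⁻ z, 4 * lam * ‖czGood f lam z‖ₑ := by
          refine lintegral_mono_ae ?_
          filter_upwards [ae_enorm_czGood_le hfi hlA] with z hz
          rw [sq]; gcongr
      _ = 4 * lam * ∫⁻ z, ‖czGood f lam z‖ₑ := lintegral_const_mul _ mg.enorm
      _ ≤ _ := by gcongr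
  have hb := lintegral_sub_czGood_le (lam := lam) hf
  have o16 : ENNReal.ofReal (16 * Real.pi) = 16 * p := by
    rw [ENNReal.ofReal_mul (by norm_num)]; simp [hp]
  have o12 : ENNReal.ofReal (12 * Real.pi) = 12 * p := by
    rw [ENNReal.ofReal_mul (by norm_num)]; simp [hp]
  have hbT : ∫⁻ z, ‖f z - czGood f lam z‖ₑ ≤ 2 * T := hb.trans (by gcongr)
  have hEv : volume (czExceptional f lam) ≤ 16 * p * volume Ω := by rw [← o16]; exact hE
  have le1 : 16 * p ≤ M := by rw [hM, add_assoc, add_assoc]; exact le_self_add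
  have le2 : 64 * p * A ≤ M := by
    rw [hM, add_comm (16 * p), add_assoc, add_assoc]; exact le_self_add
  have le3 : 2 ≤ M := by rw [hM, add_comm _ 2, add_assoc]; exact le_self_add
  have le4 : 24 * p ≤ M := by rw [hM, add_comm _ (24 * p)]; exact le_self_add
  refine ⟨czGood f lam, czExceptional f lam, mg, ⟨mg.aestronglyMeasurable, hg1.trans_lt hfi.2⟩,
    ⟨mg.aestronglyMeasurable, ?_⟩, measurableSet_czExceptional, ?_, ?_, ?_, ?_⟩
  · rw [eLpNorm_two_eq]
    refine ENNReal.rpow_lt_top_of_nonneg (by norm_num) (lt_of_le_of_lt hg2 ?_).ne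
    finiteness
  · calc _ ≤ 16 * p * volume Ω := hEv
      _ ≤ M * T := by gcongr
      _ ≤ δ := hT
  · calc _ ≤ 16 * p * volume Ω * (4 * lam * A) := by gcongr
      _ = 64 * p * A * (lam * volume Ω) := by ring
      _ ≤ M * T := by gcongr
      _ ≤ δ := hT
  · calc _ ≤ 2 * T := hbT
      _ ≤ M * T := by gcongr
      _ ≤ δ := hT
  · intro R hR
    calc _ ≤ 12 * p * ∫⁻ z, ‖f z - czGood f lam z‖ₑ := by
          rw [← o12]; exact setLIntegral_kernelConv_sub_czGood_le hf hfi hR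
      _ ≤ 12 * p * (2 * T) := by gcongr
      _ = 24 * p * T := by ring
      _ ≤ M * T := by gcongr
      _ ≤ δ := hT

/-! ### From almost everywhere convergence to convergence of integrals -/

theorem exists_pos_mul_le {c δ : ℝ≥0∞} (hc : c ≠ ⊤) (hδ : δ ≠ 0) :
    ∃ t : ℝ≥0∞, t ≠ 0 ∧ ∀ s ≤ t, c * s ≤ δ := by
  rcases eq_or_ne c 0 with rfl | hc0
  · exact ⟨1, one_ne_zero, fun s _ => by simp⟩
  · refine ⟨δ / c, (ENNReal.div_pos hδ hc).ne', fun s hs => ?_⟩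
    calc c * s ≤ c * (δ / c) := by gcongr
      _ = δ := ENNReal.mul_div_cancel hc0 hc

theorem enorm_kernelConv_trunc_le {r : ℝ} (hr : 0 < r) {h : ℂ → ℂ} (hi : Integrable h) :
    ∃ C : ℝ, ∀ z, ‖kernelConv (truncKernel r) h z‖ ≤ C := by
  refine ⟨(Real.pi * r ^ 2)⁻¹ * ∫ t, ‖h t‖, fun z => ?_⟩
  calc _ ≤ ∫ t, (Real.pi * r ^ 2)⁻¹ * ‖h (z - t)‖ := by
        refine norm_integral_le_of_norm_le ((hi.comp_sub_left z).norm.const_mul _)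
          (Eventually.of_forall fun t => ?_)
        rw [norm_mul]
        gcongr
        exact norm_truncKernel_le hr t
    _ = _ := by
        rw [integral_const_mul, integral_sub_left_eq_self (fun t => ‖h t‖)]

theorem integrable_truncKernel_mul {r : ℝ} (hr : 0 < r) {h : ℂ → ℂ} (hi : Integrable h) (z : ℂ) :
    Integrable fun t => truncKernel r t * h (z - t) :=
  (hi.comp_sub_left z).bdd_mul (measurable_truncKernel r).aestronglyMeasurable
    (Eventually.of_forall fun t => norm_truncKernel_le hr t)

theorem integral_mul_kernelConv_trunc {r : ℝ} (hr : 0 < r) {φ b : ℂ → ℂ} (hφ : Integrable φ)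
    (hb : Integrable b) :
    ∫ z, φ z * kernelConv (truncKernel r) b z = ∫ w, (∫ z, φ z * truncKernel r (z - w)) * b w := by
  have mK := measurable_truncKernel r
  have h2 : Integrable (Function.uncurry fun z w => φ z * (truncKernel r (z - w) * b w))
      (volume.prod volume) := by
    have := (hφ.mul_prod hb).bdd_mul (f := fun p : ℂ × ℂ => truncKernel r (p.1 - p.2))
      (c := (Real.pi * r ^ 2)⁻¹)
      (mK.comp (measurable_fst.sub measurable_snd)).aestronglyMeasurable
      (Eventually.of_forall fun p => norm_truncKernel_le hr _)
    refine this.congr (Eventually.of_forall fun p => ?_)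
    simp only [Function.uncurry]; ring
  calc _ = ∫ z, ∫ w, φ z * (truncKernel r (z - w) * b w) := by
        congr 1; ext z
        rw [integral_const_mul, kernelConv_eq_integral_sub]
    _ = ∫ w, ∫ z, φ z * (truncKernel r (z - w) * b w) := integral_integral_swap h2
    _ = _ := by
        congr 1; ext w
        rw [← integral_mul_const]
        congr 1; ext z; ring

/-- If the truncations of an integrable function converge almost everywhere on a set of finite
measure to an integrable limit, then they also converge against bounded functions whose truncated
transforms are uniformly bounded. -/
theorem tendsto_integral_mul_kernelConv {f : ℂ → ℂ} (hf : Measurable f) (hfi : Integrable f)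
    {ε : ℕ → ℝ} (hε : ∀ n, 0 < ε n) {D : Set ℂ} (hD : MeasurableSet D) (hDt : volume D ≠ ⊤)
    {G : ℂ → ℂ} (hGm : Measurable G) (hG : IntegrableOn G D)
    (lim : ∀ᵐ z, z ∈ D →
      Tendsto (fun n => kernelConv (truncKernel (ε n)) f z) atTop (𝓝 (G z)))
    {φ : ℂ → ℂ} (hφm : Measurable φ) {M : ℝ≥0} (hφ : ∀ z, ‖φ z‖ₑ ≤ M) (hφD : ∀ z ∉ D, φ z = 0)
    (hM : ∀ n w, ‖∫ z, φ z * truncKernel (ε n) (z - w)‖ₑ ≤ M) :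
    Tendsto (fun n => ∫ z, φ z * kernelConv (truncKernel (ε n)) f z) atTop
      (𝓝 (∫ z, φ z * G z)) := by
  have hMt : (M : ℝ≥0∞) ≠ ⊤ := ENNReal.coe_ne_top
  have mK := fun n => measurable_truncKernel (ε n)
  have hφb : ∀ z, ‖φ z‖ ≤ M := fun z => by
    exact_mod_cast enorm_le_coe.1 (hφ z)
  have hφi : Integrable φ := by
    have h1 : IntegrableOn φ D := by
      refine Measure.integrableOn_of_bounded hDt hφm.aestronglyMeasurable
        (Eventually.of_forall hφb)
    rwa [integrableOn_iff_integrable_of_support_subset] at h1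
    intro z hz
    by_contra h
    exact hz (hφD z h)
  have iφ : ∀ n {h : ℂ → ℂ}, Measurable h → Integrable h →
      Integrable fun z => φ z * kernelConv (truncKernel (ε n)) h z := by
    intro n h hm hi
    obtain ⟨C, hC⟩ := enorm_kernelConv_trunc_le (hε n) hi
    exact hφi.mul_bdd (measurable_kernelConv (mK n) hm).aestronglyMeasurable
      (Eventually.of_forall hC)
  have iG : Integrable fun z => φ z * G z := by
    have h1 : IntegrableOn (fun z => φ z * G z) D :=
      hG.bdd_mul hφm.aestronglyMeasurable (Eventually.of_forall hφb)
    rwa [integrableOn_iff_integrable_of_support_subset] at h1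
    intro z hz
    by_contra h
    exact hz (by simp [hφD z h])
  rw [tendsto_iff_edist_tendsto_0, ENNReal.tendsto_atTop_zero]
  intro δ hδ
  set d := δ / 5 with hd
  have hd0 : d ≠ 0 := (ENNReal.div_pos hδ.ne' (by norm_num)).ne'
  obtain ⟨t1, ht1, ht1'⟩ := exists_pos_mul_le hMt hd0
  obtain ⟨η, hη0, hη⟩ := exists_pos_setLIntegral_lt_of_measure_lt
    (f := fun z => ‖G z‖ₑ) (μ := volume.restrict D) hG.2.ne ht1
  obtain ⟨η', hη'0, hη'⟩ := exists_between hη0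
  obtain ⟨t2, ht2, ht2'⟩ := exists_pos_mul_le (c := 2) (by norm_num) hη'0.ne'
  -- On the exceptional set Cauchy–Schwarz gives (M ∫_E |P|)² ≤ M² |E| ‖g‖₂², and |E| ‖g‖₂² will be
  -- at most twice the error of the decomposition.
  obtain ⟨t3, ht3, ht3'⟩ := exists_pos_mul_le (c := (M : ℝ≥0∞) ^ 2 * 2) (by finiteness)
    (pow_ne_zero 2 hd0)
  obtain ⟨t4, ht4, ht4'⟩ := exists_pos_mul_le (c := (M : ℝ≥0∞) * volume D) (by finiteness) hd0
  set δ0 := min t1 (min t2 t3) with hδ0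
  have hδ00 : δ0 ≠ 0 := by
    simp only [hδ0, ne_eq]
    exact (lt_min (pos_iff_ne_zero.2 ht1) (lt_min (pos_iff_ne_zero.2 ht2)
      (pos_iff_ne_zero.2 ht3))).ne'
  -- One decomposition serves all truncation radii, so it can be fixed before n.
  obtain ⟨g, E0, gm, gi, g2, hE0, hE0v, hE0g, hb1, hbE⟩ := exists_calderonZygmund hf hfi hδ00
  set S := ∫⁻ z, ‖g z‖ₑ ^ 2 with hS
  have hSt : S ≠ ⊤ := by
    have := g2.2
    rw [eLpNorm_two_eq] at this
    exact ((ENNReal.rpow_lt_top_iff_of_pos (by norm_num)).1 this).ne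
  set b := fun z => f z - g z with hb
  have bm : Measurable b := hf.sub gm
  have bi : Integrable b := hfi.sub gi
  obtain ⟨t5, ht5, ht5'⟩ := exists_pos_mul_le hSt hδ00
  obtain ⟨η1, h0, hlt⟩ := exists_between (lt_min (pos_iff_ne_zero.2 ht5) (pos_iff_ne_zero.2 hδ00))
  have hη1r : ENNReal.ofReal η1.toReal = η1 := ENNReal.ofReal_toReal hlt.ne_top
  -- Egorov's theorem. The discarded set is chosen after g, so that both its measure and its measure
  -- times ‖g‖₂² are small.
  obtain ⟨A, hAD, hAm, hAv, hAu⟩ := tendstoUniformlyOn_of_ae_tendsto (μ := volume)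
    (fun n => (measurable_kernelConv (mK n) hf).stronglyMeasurable) hGm.stronglyMeasurable hD hDt
    lim (ENNReal.toReal_pos h0.ne' hlt.ne_top)
  rw [hη1r] at hAv
  have hAv1 : volume A ≤ δ0 := hAv.trans (hlt.le.trans (min_le_right _ _))
  have hAS : volume A * S ≤ δ0 := by
    rw [mul_comm]
    exact ht5' _ (hAv.trans (hlt.le.trans (min_le_left _ _)))
  set E := E0 ∪ A with hE
  have hEm : MeasurableSet E := hE0.union hAm
  have hEv : volume E ≤ 2 * δ0 := by
    rw [two_mul]; exact (measure_union_le _ _).trans (add_le_add hE0v hAv1)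
  have hES : volume E * S ≤ 2 * δ0 := by
    rw [two_mul]
    calc volume E * S ≤ (volume E0 + volume A) * S := by gcongr; exact measure_union_le _ _
      _ = volume E0 * S + volume A * S := add_mul _ _ _
      _ ≤ _ := add_le_add hE0g hAS
  -- uniform convergence off `E`
  obtain ⟨t6, ht6, ht6t⟩ : ∃ t6 : ℝ≥0∞, 0 < t6 ∧ t6 ≤ t4 := ⟨t4, pos_iff_ne_zero.2 ht4, le_rfl⟩
  have hev := EMetric.tendstoUniformlyOn_iff.1 hAu t6 ht6
  obtain ⟨N, hN⟩ := eventually_atTop.1 hev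
  refine ⟨N, fun n hn => ?_⟩
  have hun := hN n hn
  set F := kernelConv (truncKernel (ε n)) f with hF
  set P := kernelConv (truncKernel (ε n)) g with hP
  set B := kernelConv (truncKernel (ε n)) b with hB
  have Pm : Measurable P := measurable_kernelConv (mK n) gm
  have Bm : Measurable B := measurable_kernelConv (mK n) bm
  have Fm : Measurable F := measurable_kernelConv (mK n) hf
  have hFPB : ∀ z, F z = P z + B z := by
    intro z
    simp only [hF, hP, hB, kernelConv]
    rw [← integral_add (integrable_truncKernel_mul (hε n) gi z)
      (integrable_truncKernel_mul (hε n) bi z)]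
    congr 1; ext t
    simp only [hb]; ring
  have iP := iφ n gm gi
  have iB := iφ n bm bi
  rw [edist_eq_enorm_sub]
  -- The transform B of the bad part has no L¹ bound on E. Its integral is therefore taken over the
  -- whole plane, where transposition bounds it by M‖b‖₁, and the integral over the complement of E,
  -- which Hörmander's condition controls, is subtracted again.
  have split : (∫ z, φ z * F z) - ∫ z, φ z * G z =
      (∫ z, φ z * B z) + (∫ z in E, φ z * P z) - (∫ z in E, φ z * G z) +
        (∫ z in Eᶜ, φ z * (F z - G z)) - ∫ z in Eᶜ, φ z * B z := by
    have e1 : ∫ z, φ z * F z = (∫ z, φ z * P z) + ∫ z, φ z * B z := by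
      rw [← integral_add iP iB]; congr 1; ext z; rw [hFPB]; ring
    have e2 : ∫ z in Eᶜ, φ z * (F z - G z) =
        (∫ z in Eᶜ, φ z * P z) + (∫ z in Eᶜ, φ z * B z) - ∫ z in Eᶜ, φ z * G z := by
      have iPB : IntegrableOn (fun z => φ z * P z + φ z * B z) Eᶜ :=
        iP.integrableOn.add iB.integrableOn
      rw [← integral_add iP.integrableOn iB.integrableOn, ← integral_sub iPB iG.integrableOn]
      congr 1; ext z
      rw [hFPB]; ring
    rw [e1, e2, ← integral_add_compl hEm iP, ← integral_add_compl hEm iG]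
    ring
  have term1 : ‖∫ z, φ z * B z‖ₑ ≤ d := by
    rw [hB, integral_mul_kernelConv_trunc (hε n) hφi bi]
    calc _ ≤ ∫⁻ w, ‖(∫ z, φ z * truncKernel (ε n) (z - w)) * b w‖ₑ :=
          enorm_integral_le_lintegral_enorm _
      _ ≤ ∫⁻ w, M * ‖b w‖ₑ := by
          gcongr with w
          rw [enorm_mul]
          gcongr
          exact hM n w
      _ = M * ∫⁻ w, ‖b w‖ₑ := lintegral_const_mul _ bm.enorm
      _ ≤ d := ht1' _ (hb1.trans (min_le_left _ _))
  have mulM : ∀ (T : Set ℂ) (H : ℂ → ℂ), Measurable H →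
      ‖∫ z in T, φ z * H z‖ₑ ≤ M * ∫⁻ z in T, ‖H z‖ₑ := by
    intro T H hH
    rw [← lintegral_const_mul _ hH.enorm]
    refine (enorm_integral_le_lintegral_enorm _).trans ?_
    gcongr with z
    rw [enorm_mul]
    gcongr
    exact hφ z
  have term2 : ‖∫ z in E, φ z * P z‖ₑ ≤ d := by
    refine (mulM E P Pm).trans ?_
    have h1 := lintegral_mul_sq_le (μ := volume.restrict E) (F := fun z => ‖P z‖ₑ)
      (G := fun _ => 1) Pm.enorm.aemeasurable aemeasurable_const
    have h2 : ∫⁻ z, ‖P z‖ₑ ^ 2 ≤ S := by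
      have := eLpNorm_kernelConv_trunc_le (hε n) g2
      rw [eLpNorm_two_eq, eLpNorm_two_eq] at this
      exact (ENNReal.rpow_le_rpow_iff (by norm_num)).1 this
    have h3 : (M * ∫⁻ z in E, ‖P z‖ₑ) ^ 2 ≤ d ^ 2 := by
      calc (M * ∫⁻ z in E, ‖P z‖ₑ) ^ 2 = (M : ℝ≥0∞) ^ 2 * (∫⁻ z in E, ‖P z‖ₑ * 1) ^ 2 := by
            simp only [mul_one, mul_pow]
        _ ≤ (M : ℝ≥0∞) ^ 2 * ((∫⁻ z in E, ‖P z‖ₑ ^ 2) * ∫⁻ z in E, 1 ^ 2) := by gcongr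
        _ ≤ (M : ℝ≥0∞) ^ 2 * (S * volume E) := by
            gcongr
            · exact (setLIntegral_le_lintegral _ _).trans h2
            · simp
        _ = (M : ℝ≥0∞) ^ 2 * (volume E * S) := by rw [mul_comm S]
        _ ≤ (M : ℝ≥0∞) ^ 2 * (2 * δ0) := by gcongr
        _ = (M : ℝ≥0∞) ^ 2 * 2 * δ0 := (mul_assoc _ _ _).symm
        _ ≤ d ^ 2 := ht3' _ ((min_le_right _ _).trans (min_le_right _ _))
    exact (ENNReal.pow_le_pow_left_iff two_ne_zero).1 h3
  have term3 : ‖∫ z in E, φ z * G z‖ₑ ≤ d := by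
    have e : ∫ z in E, φ z * G z = ∫ z in E ∩ D, φ z * G z := by
      rw [← integral_indicator hEm, ← integral_indicator (hEm.inter hD)]
      congr 1; ext z
      by_cases h1 : z ∈ E <;> by_cases h2 : z ∈ D <;> simp [h1, h2, hφD]
    rw [e]
    refine (mulM _ G hGm).trans (ht1' _ ?_)
    rw [← Measure.restrict_restrict hEm]
    refine (hη E (lt_of_le_of_lt ((Measure.restrict_apply_le _ _).trans (hEv.trans
      (ht2' _ ((min_le_right _ _).trans (min_le_left _ _))))) hη')).le
  have term4 : ‖∫ z in Eᶜ, φ z * (F z - G z)‖ₑ ≤ d := by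
    have e : ∫ z in Eᶜ, φ z * (F z - G z) = ∫ z in Eᶜ ∩ D, φ z * (F z - G z) := by
      rw [← integral_indicator hEm.compl, ← integral_indicator (hEm.compl.inter hD)]
      congr 1; ext z
      by_cases h1 : z ∈ Eᶜ <;> by_cases h2 : z ∈ D <;> simp [Set.indicator, h1, h2, hφD]
    rw [e]
    refine (mulM _ (fun z => F z - G z) (Fm.sub hGm)).trans ?_
    calc (M : ℝ≥0∞) * ∫⁻ z in Eᶜ ∩ D, ‖F z - G z‖ₑ ≤ M * ∫⁻ z in Eᶜ ∩ D, t6 := by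
          gcongr 1
          refine setLIntegral_mono' (hEm.compl.inter hD) fun z hz => ?_
          have := hun z ⟨hz.2, fun hA => hz.1 (Or.inr hA)⟩
          rw [edist_comm, edist_eq_enorm_sub] at this
          exact this.le
      _ ≤ M * (volume D * t6) := by
          rw [setLIntegral_const, mul_comm t6]
          gcongr
          exact Set.inter_subset_right
      _ = M * volume D * t6 := (mul_assoc _ _ _).symm
      _ ≤ d := ht4' _ ht6t
  have term5 : ‖∫ z in Eᶜ, φ z * B z‖ₑ ≤ d := by
    refine (mulM _ B Bm).trans (ht1' _ ?_)
    refine le_trans (lintegral_mono_set ?_) ((hbE _ (hε n)).trans (min_le_left _ _))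
    exact Set.compl_subset_compl.2 Set.subset_union_left
  rw [split]
  calc _ ≤ d + d + d + d + d := by
        refine enorm_sub_le.trans (add_le_add ((enorm_add_le _ _).trans (add_le_add
          (enorm_sub_le.trans (add_le_add ((enorm_add_le _ _).trans (add_le_add term1 term2))
            term3)) term4)) term5)
    _ = 5 * d := by ring
    _ = δ := ENNReal.mul_div_cancel (by norm_num) (by norm_num)

/-! ### Annular truncations and measurability of the principal value -/

/-- The Beurling kernel restricted to the open annulus `ε < |w| < R`. -/
noncomputable def annulusKernel (ε R : ℝ) (w : ℂ) : ℂ :=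
  if ε < ‖w‖ ∧ ‖w‖ < R then ((Real.pi : ℂ) * w ^ 2)⁻¹ else 0

theorem measurable_annulusKernel (ε R : ℝ) : Measurable (annulusKernel ε R) := by
  unfold annulusKernel
  exact Measurable.ite ((measurableSet_lt measurable_const measurable_norm).inter
    (measurableSet_lt measurable_norm measurable_const)) (by fun_prop) measurable_const

theorem beurlingAnnulus_eq_kernelConv (f : ℂ → ℂ) (ε R : ℝ) (z : ℂ) :
    beurlingAnnulus f ε R z = kernelConv (annulusKernel ε R) f z := by
  have hm : MeasurableSet {w : ℂ | ε < ‖w‖ ∧ ‖w‖ < R} :=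
    (measurableSet_lt measurable_const measurable_norm).inter
      (measurableSet_lt measurable_norm measurable_const)
  rw [beurlingAnnulus, kernelConv, ← integral_indicator hm, ← integral_const_mul]
  congr 1; ext w
  by_cases h : ε < ‖w‖ ∧ ‖w‖ < R
  · rw [Set.indicator_of_mem (by exact h), annulusKernel, if_pos h, mul_inv]
    ring
  · rw [Set.indicator_of_notMem (by exact h), annulusKernel, if_neg h]
    simp

theorem annulusKernel_of_lt {ε R : ℝ} {w : ℂ} (h : ‖w‖ < R) :
    annulusKernel ε R w = truncKernel ε w := by
  simp [annulusKernel, truncKernel, h]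

theorem norm_annulusKernel_le {ε : ℝ} (hε : 0 < ε) (R : ℝ) (w : ℂ) :
    ‖annulusKernel ε R w‖ ≤ (Real.pi * ε ^ 2)⁻¹ := by
  by_cases h : ‖w‖ < R
  · rw [annulusKernel_of_lt h]; exact norm_truncKernel_le hε w
  · simp only [annulusKernel, h, and_false, if_false, norm_zero]
    positivity

/-- Equality can fail on the circle |w| = R, where both the annular kernel and `truncKernel R`
vanish. -/
theorem annulusKernel_eq_sub_ae {ε R : ℝ} (hR : 0 < R) (hεR : ε ≤ R) :
    ∀ᵐ w : ℂ, annulusKernel ε R w = truncKernel ε w - truncKernel R w := by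
  filter_upwards [ae_norm_ne R hR.ne'] with w hw
  rcases lt_or_gt_of_ne hw with h | h
  · rw [annulusKernel_of_lt h]
    simp [truncKernel, h.le.not_gt]
  · simp [annulusKernel, truncKernel, h, h.le.not_gt, hεR.trans_lt h]

theorem integrable_mul_of_bounded_support {κ f : ℂ → ℂ} {C R : ℝ} (hκ : Measurable κ)
    (hC : ∀ w, ‖κ w‖ ≤ C) (hR : ∀ w, R < ‖w‖ → κ w = 0) (hf : LocallyIntegrable f) (z : ℂ) :
    Integrable fun w => κ w * f (z - w) := by
  have h1 : LocallyIntegrable fun w => f (z - w) := by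
    intro w
    obtain ⟨s, hs, hfs⟩ := hf (z - w)
    refine ⟨(fun x => z - x) ⁻¹' s,
      (continuous_const.sub continuous_id).continuousAt.preimage_mem_nhds hs, ?_⟩
    exact ((volume.measurePreserving_sub_left z).integrableOn_comp_preimage
      (MeasurableEquiv.subLeft z).measurableEmbedding).2 hfs
  have h2 : IntegrableOn (fun w => κ w * f (z - w)) (Metric.closedBall 0 R) :=
    (h1.integrableOn_isCompact (isCompact_closedBall _ _)).bdd_mul hκ.aestronglyMeasurable
      (Eventually.of_forall hC)
  rwa [integrableOn_iff_integrable_of_support_subset] at h2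
  intro w hw
  by_contra h
  rw [mem_closedBall_zero_iff, not_le] at h
  exact hw (by simp [hR w h])

theorem integrable_annulusKernel_mul {ε : ℝ} (hε : 0 < ε) (R : ℝ) {f : ℂ → ℂ}
    (hf : LocallyIntegrable f) (z : ℂ) : Integrable fun w => annulusKernel ε R w * f (z - w) :=
  integrable_mul_of_bounded_support (R := R) (measurable_annulusKernel ε R) (norm_annulusKernel_le hε R)
    (fun w hw => by simp [annulusKernel, hw.le.not_gt]) hf z

theorem HasBeurlingPV.tendsto_annulus {f : ℂ → ℂ} {z l : ℂ} (h : HasBeurlingPV f z l) {ε : ℝ}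
    (hε : 0 < ε) :
    Tendsto (fun R => beurlingAnnulus f ε R z) atTop (𝓝 (beurlingTrunc f ε z)) :=
  tendsto_nhds_limUnder (h.1 ε hε)

theorem HasBeurlingPV.tendsto_trunc {f : ℂ → ℂ} {z l : ℂ} (h : HasBeurlingPV f z l) :
    Tendsto (fun ε => beurlingTrunc f ε z) (𝓝[>] 0) (𝓝 (beurling f z)) :=
  tendsto_nhds_limUnder ⟨l, h.2⟩

theorem tendsto_div_nat_succ_nhdsGT {ρ : ℝ} (hρ : 0 < ρ) :
    Tendsto (fun n : ℕ => ρ / ((n : ℝ) + 1)) atTop (𝓝[>] 0) := by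
  refine tendsto_nhdsWithin_iff.2 ⟨?_, Eventually.of_forall fun n => by
      show (0:ℝ) < _; positivity⟩
  have := (tendsto_one_div_add_atTop_nhds_zero_nat (𝕜 := ℝ)).const_mul ρ
  simpa [div_eq_mul_inv] using this

theorem aemeasurable_beurling {f : ℂ → ℂ} (hf : Measurable f)
    (hpv : ∀ᵐ z : ℂ, ∃ l : ℂ, HasBeurlingPV f z l) : AEMeasurable (beurling f) := by
  have h1 : ∀ ε > 0, AEMeasurable (beurlingTrunc f ε) := by
    intro ε hε
    refine aemeasurable_of_tendsto_metrizable_ae atTop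
      (f := fun n : ℕ => fun z => beurlingAnnulus f ε n z) (fun n => ?_) ?_
    · simp only [beurlingAnnulus_eq_kernelConv]
      exact (measurable_kernelConv (measurable_annulusKernel _ _) hf).aemeasurable
    · filter_upwards [hpv] with z ⟨l, hl⟩
      exact (hl.tendsto_annulus hε).comp tendsto_natCast_atTop_atTop
  refine aemeasurable_of_tendsto_metrizable_ae atTop
    (f := fun n : ℕ => beurlingTrunc f (1 / ((n:ℝ) + 1))) (fun n => h1 _ (by positivity)) ?_
  filter_upwards [hpv] with z ⟨l, hl⟩
  exact hl.tendsto_trunc.comp (tendsto_div_nat_succ_nhdsGT one_pos)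

/-! ### Test functions and disc averages -/

theorem integral_wirtingerBar_eq_zero {ψ : ℂ → ℂ} (hψ : ContDiff ℝ 1 ψ)
    (hc : HasCompactSupport ψ) : ∫ z, wirtingerBar ψ z = 0 := by
  have h0 : ∀ v, ∫ z, fderiv ℝ ψ z v = 0 := by
    intro v
    have := integral_lipschitz_mul_fderiv (k := fun _ => 1) (k' := fun _ => 0) (v := v)
      (LipschitzWith.const 1) (Eventually.of_forall fun x => by
        simpa using (hasFDerivAt_const (𝕜 := ℝ) (1 : ℂ) x).hasLineDerivAt v) hψ hc
    simpa using this
  have hi : ∀ v, Integrable fun z => fderiv ℝ ψ z v := fun v =>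
    ((hψ.continuous_fderiv one_ne_zero).clm_apply continuous_const).integrable_of_hasCompactSupport
      (hc.fderiv_apply ℝ v)
  simp only [wirtingerBar]
  rw [integral_const_mul, integral_add (hi 1) ((hi _).const_mul _), integral_const_mul, h0, h0]
  simp

theorem norm_integral_disc_mul_le {r : ℝ} (hr : 0 < r) {θ : ℂ → ℂ} {M : ℝ} (hM : ∀ z, ‖θ z‖ ≤ M) :
    ‖∫ t, discKernel r t * θ t‖ ≤ M := by
  have hi : Integrable (discKernel r) :=
    ⟨(measurable_discKernel r).aestronglyMeasurable, by
      rw [HasFiniteIntegral, lintegral_enorm_discKernel hr]; simp⟩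
  have h1 : ∫ t, ‖discKernel r t‖ = 1 := by
    rw [integral_norm_eq_lintegral_enorm hi.1, lintegral_enorm_discKernel hr]; simp
  calc _ ≤ ∫ t, ‖discKernel r t‖ * M := by
        refine norm_integral_le_of_norm_le (hi.norm.mul_const _) (Eventually.of_forall fun t => ?_)
        rw [norm_mul]
        gcongr
        exact hM t
    _ = M := by rw [integral_mul_const, h1, one_mul]

theorem integral_discKernel {r : ℝ} (hr : 0 < r) : ∫ t, discKernel r t = 1 := by
  have hi : Integrable (discKernel r) :=
    ⟨(measurable_discKernel r).aestronglyMeasurable, by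
      rw [HasFiniteIntegral, lintegral_enorm_discKernel hr]; simp⟩
  have e : ∀ t, discKernel r t = ((‖discKernel r t‖ : ℝ) : ℂ) := by
    intro t
    by_cases h : r < ‖t‖
    · simp [discKernel, h]
    · simp [discKernel, h, abs_of_pos Real.pi_pos]
  have h1 : ∫ t, ‖discKernel r t‖ = 1 := by
    rw [integral_norm_eq_lintegral_enorm hi.1, lintegral_enorm_discKernel hr]; simp
  rw [integral_congr_ae (Eventually.of_forall e), integral_complex_ofReal, h1]
  simp

theorem tendsto_integral_disc_mul {θ : ℂ → ℂ} (hθ : Continuous θ) (hc : HasCompactSupport θ)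
    {ε : ℕ → ℝ} (hε : ∀ n, 0 < ε n) (hlim : Tendsto ε atTop (𝓝 0)) (w : ℂ) :
    Tendsto (fun n => ∫ t, discKernel (ε n) t * θ (t + w)) atTop (𝓝 (θ w)) := by
  rw [Metric.tendsto_atTop]
  intro δ hδ
  obtain ⟨s, hs, hcont⟩ := Metric.continuousAt_iff.1 (hθ.continuousAt (x := w)) (δ / 2) (by positivity)
  obtain ⟨N, hN⟩ := eventually_atTop.1 (hlim.eventually (gt_mem_nhds hs))
  refine ⟨N, fun n hn => ?_⟩
  have hi : Integrable (discKernel (ε n)) :=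
    ⟨(measurable_discKernel _).aestronglyMeasurable, by
      rw [HasFiniteIntegral, lintegral_enorm_discKernel (hε n)]; simp⟩
  have hi2 : Integrable fun t => discKernel (ε n) t * θ (t + w) :=
    integrable_bdd_mul_of_hasCompactSupport (measurable_discKernel _) norm_discKernel_le
      (hθ.comp (continuous_id.add continuous_const)) (hc.comp_homeomorph (Homeomorph.addRight w))
  have e : (∫ t, discKernel (ε n) t * θ (t + w)) - θ w =
      ∫ t, discKernel (ε n) t * (if ε n < ‖t‖ then 0 else θ (t + w) - θ w) := by
    have : θ w = ∫ t, discKernel (ε n) t * θ w := by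
      rw [integral_mul_const, integral_discKernel (hε n), one_mul]
    conv_lhs => rw [this]
    rw [← integral_sub hi2 (hi.mul_const _)]
    congr 1; ext t
    by_cases h : ε n < ‖t‖
    · simp [discKernel, h]
    · simp [h]; ring
  rw [dist_eq_norm, e]
  refine lt_of_le_of_lt (norm_integral_disc_mul_le (hε n) (M := δ / 2) fun t => ?_) (by linarith)
  split_ifs with h
  · simp; positivity
  · rw [← dist_eq_norm]
    refine (hcont ?_).le
    rw [dist_eq_norm]
    have := hN n hn
    simp only [add_sub_cancel_right]
    linarith

/-! ### The contribution of the far part of f -/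

theorem integrable_indicator_inv_norm_cube {s : ℝ} (hs : 0 < s) :
    Integrable ({x : ℂ | s < ‖x‖}.indicator fun x => (‖x‖ ^ 3)⁻¹) := by
  have hset : MeasurableSet {x : ℂ | s < ‖x‖} := measurableSet_lt measurable_const measurable_norm
  rw [integrable_indicator_iff hset]
  refine ⟨by fun_prop, ?_⟩
  rw [HasFiniteIntegral]
  have e : ∀ x : ℂ, ‖(‖x‖ ^ 3)⁻¹‖ₑ = ENNReal.ofReal (‖x‖ ^ 3)⁻¹ := fun x =>
    Real.enorm_of_nonneg (by positivity)
  simp only [e]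
  rw [lintegral_inv_norm_cube hs]
  exact ENNReal.ofReal_lt_top

theorem locallyIntegrable_of_norm_le_add {f : ℂ → ℂ} {u : ℂ → ℝ} {K : ℝ} (hf : Measurable f)
    (hu : Integrable u) (hfu : ∀ᵐ z, ‖f z‖ ≤ u z + K) : LocallyIntegrable f := by
  refine (hu.locallyIntegrable.add (locallyIntegrable_const K)).mono hf.aestronglyMeasurable ?_
  filter_upwards [hfu] with z hz
  exact hz.trans (le_abs_self _)

section
variable {f : ℂ → ℂ} {u : ℂ → ℝ} {K ρ : ℝ} {z z₀ : ℂ}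

/-- At distance more than 5ρ from z₀ the cubic kernel is bounded, which suffices for u, and
integrable, which suffices for the constant K. The Beurling kernel itself is not integrable at
infinity; its differences gain the missing power. -/
theorem integrable_norm_mul_inv_norm_cube (hf : Measurable f) (hu : Integrable u)
    (hu0 : ∀ z, 0 ≤ u z) (hK : 0 ≤ K) (hfu : ∀ᵐ z, ‖f z‖ ≤ u z + K) (hρ : 0 < ρ)
    (hz₀ : ‖z₀‖ ≤ ρ) (hfar : ∀ w, ‖w‖ ≤ 6 * ρ → f w = 0) :
    Integrable fun w => ‖f w‖ * (‖z₀ - w‖ ^ 3)⁻¹ := by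
  have h1 := ((integrable_indicator_inv_norm_cube (s := 5 * ρ) (by positivity)).comp_sub_left
    z₀).const_mul K
  have h2 := hu.mul_const ((5 * ρ) ^ 3)⁻¹
  refine (h2.add h1).mono' (by fun_prop) ?_
  filter_upwards [hfu] with w hw
  rw [Real.norm_of_nonneg (by positivity)]
  by_cases hw6 : ‖w‖ ≤ 6 * ρ
  · rw [hfar w hw6]
    simp only [norm_zero, zero_mul, Pi.add_apply]
    have := hu0 w
    refine add_nonneg (by positivity) (mul_nonneg hK (Set.indicator_nonneg (fun x _ => ?_) _))
    positivity
  · have h5 : 5 * ρ < ‖z₀ - w‖ := by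
      have := norm_sub_norm_le w z₀
      rw [norm_sub_rev] at this
      linarith
    simp only [Pi.add_apply]
    rw [Set.indicator_of_mem (by exact h5)]
    calc _ ≤ (u w + K) * (‖z₀ - w‖ ^ 3)⁻¹ := by gcongr
      _ = u w * (‖z₀ - w‖ ^ 3)⁻¹ + K * (‖z₀ - w‖ ^ 3)⁻¹ := add_mul _ _ _
      _ ≤ _ := by
        gcongr
        exact hu0 w

/-- The radius 6ρ ensures |z₀ - w| > 5ρ on the support of f, while 2|z₀ - z| ≤ 4ρ, so the estimate
for kernel differences applies. -/
theorem norm_truncKernel_sub_mul_le (hρ : 0 < ρ) (hz : ‖z‖ ≤ ρ)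
    (hz₀ : ‖z₀‖ ≤ ρ) (hfar : ∀ w, ‖w‖ ≤ 6 * ρ → f w = 0) (R : ℝ) (w : ℂ) :
    ‖(truncKernel R (z - w) - truncKernel R (z₀ - w)) * f w‖ ≤
      8 * ρ * (‖f w‖ * (‖z₀ - w‖ ^ 3)⁻¹) +
        (if |‖z₀ - w‖ - R| ≤ 2 * ρ then 2 / ‖z₀ - w‖ ^ 2 else 0) * ‖f w‖ := by
  by_cases hw6 : ‖w‖ ≤ 6 * ρ
  · simp [hfar w hw6]
  have h5 : 5 * ρ < ‖z₀ - w‖ := by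
    have := norm_sub_norm_le w z₀
    rw [norm_sub_rev] at this
    linarith
  have hy : ‖z₀ - z‖ ≤ 2 * ρ := by linarith [norm_sub_le z₀ z]
  have h := norm_truncKernel_sub_le (R := R) (x := z₀ - w) (y := z₀ - z) (by linarith)
  rw [show z₀ - w - (z₀ - z) = z - w by ring] at h
  rw [norm_mul]
  calc _ ≤ (4 * ‖z₀ - z‖ / ‖z₀ - w‖ ^ 3 +
        if |‖z₀ - w‖ - R| ≤ ‖z₀ - z‖ then 2 / ‖z₀ - w‖ ^ 2 else 0) * ‖f w‖ := by gcongr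
    _ ≤ (4 * (2 * ρ) / ‖z₀ - w‖ ^ 3 +
        if |‖z₀ - w‖ - R| ≤ 2 * ρ then 2 / ‖z₀ - w‖ ^ 2 else 0) * ‖f w‖ := by
        gcongr ?_ * _
        refine add_le_add (by gcongr) ?_
        split_ifs with h1 h2
        · exact le_rfl
        · exact absurd (h1.trans hy) h2
        · positivity
        · exact le_rfl
    _ = _ := by
        rw [add_mul]
        congr 1
        rw [div_eq_mul_inv]; ring

/-- For truncation at ρ the shell reaches only to distance 3ρ from z₀, and f vanishes there. -/
theorem norm_truncKernel_sub_mul_le_self (hρ : 0 < ρ) (hz : ‖z‖ ≤ ρ)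
    (hz₀ : ‖z₀‖ ≤ ρ) (hfar : ∀ w, ‖w‖ ≤ 6 * ρ → f w = 0) (w : ℂ) :
    ‖(truncKernel ρ (z - w) - truncKernel ρ (z₀ - w)) * f w‖ ≤
      8 * ρ * (‖f w‖ * (‖z₀ - w‖ ^ 3)⁻¹) := by
  have h := norm_truncKernel_sub_mul_le hρ hz hz₀ hfar ρ w
  by_cases hw6 : ‖w‖ ≤ 6 * ρ
  · simp [hfar w hw6]
  have h5 : 5 * ρ < ‖z₀ - w‖ := by
    have := norm_sub_norm_le w z₀
    rw [norm_sub_rev] at this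
    linarith
  rw [if_neg] at h
  · simpa using h
  · rw [abs_le]
    rintro ⟨-, h6⟩
    linarith

/-- (R + 2ρ)² - (R - 2ρ)² = 8ρR. The area grows linearly in R, whereas the kernel on the shell is of
size R⁻². -/
theorem volume_shell_le (hρ : 0 < ρ) {R : ℝ} (hR : 4 * ρ ≤ R) :
    volume.real {w : ℂ | |‖z₀ - w‖ - R| ≤ 2 * ρ} ≤ 8 * Real.pi * ρ * R := by
  have hsub : {w : ℂ | |‖z₀ - w‖ - R| ≤ 2 * ρ} ⊆
      Metric.closedBall z₀ (R + 2 * ρ) \ Metric.ball z₀ (R - 2 * ρ) := by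
    intro w hw
    have hw' : |‖z₀ - w‖ - R| ≤ 2 * ρ := hw
    rw [abs_le] at hw'
    rw [Set.mem_sdiff, Metric.mem_closedBall, Metric.mem_ball, dist_comm, dist_eq_norm]
    constructor <;> linarith
  have hfin : volume (Metric.closedBall z₀ (R + 2 * ρ) \ Metric.ball z₀ (R - 2 * ρ)) ≠ ⊤ :=
    (lt_of_le_of_lt (measure_mono Set.sdiff_subset) measure_closedBall_lt_top).ne
  refine (measureReal_mono hsub hfin).trans ?_
  rw [measureReal_sdiff (Metric.ball_subset_closedBall.trans
    (Metric.closedBall_subset_closedBall (by linarith))) measurableSet_ball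
    (h₁ := measure_closedBall_lt_top.ne)]
  have e1 : volume.real (Metric.closedBall z₀ (R + 2 * ρ)) = (R + 2 * ρ) ^ 2 * Real.pi := by
    rw [Measure.real, Complex.volume_closedBall, ENNReal.toReal_mul, ENNReal.toReal_pow,
      ENNReal.toReal_ofReal (by linarith)]
    simp
  have e2 : volume.real (Metric.ball z₀ (R - 2 * ρ)) = (R - 2 * ρ) ^ 2 * Real.pi := by
    rw [Measure.real, Complex.volume_ball, ENNReal.toReal_mul, ENNReal.toReal_pow,
      ENNReal.toReal_ofReal (by linarith)]
    simp
  rw [e1, e2]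
  apply le_of_eq
  ring

/-- Both kernels vanish where |z₀ - w| < R - 2ρ. Beyond, the smooth difference is the tail of an
integrable function, and the jump across the shell costs O(R⁻²)(‖u‖₁ + O(R)K), which tends to 0 even
for merely bounded f. -/
theorem tendsto_integral_truncKernel_sub (hf : Measurable f) (hu : Integrable u)
    (hu0 : ∀ z, 0 ≤ u z) (hK : 0 ≤ K) (hfu : ∀ᵐ z, ‖f z‖ ≤ u z + K) (hρ : 0 < ρ)
    (hz : ‖z‖ ≤ ρ) (hz₀ : ‖z₀‖ ≤ ρ) (hfar : ∀ w, ‖w‖ ≤ 6 * ρ → f w = 0) :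
    Tendsto (fun R => ∫ w, (truncKernel R (z - w) - truncKernel R (z₀ - w)) * f w) atTop (𝓝 0) := by
  set q : ℂ → ℝ := fun w => 8 * ρ * (‖f w‖ * (‖z₀ - w‖ ^ 3)⁻¹) with hq
  have qi : Integrable q :=
    (integrable_norm_mul_inv_norm_cube hf hu hu0 hK hfu hρ hz₀ hfar).const_mul _
  have q0 : ∀ w, 0 ≤ q w := fun w => by positivity
  set p : ℝ → ℂ → ℝ := fun R => {w : ℂ | R - 2 * ρ ≤ ‖z₀ - w‖}.indicator q with hp
  have mset : ∀ R : ℝ, MeasurableSet {w : ℂ | R - 2 * ρ ≤ ‖z₀ - w‖} := fun R =>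
    measurableSet_le measurable_const (by fun_prop)
  have mshell : ∀ R : ℝ, MeasurableSet {w : ℂ | |‖z₀ - w‖ - R| ≤ 2 * ρ} := fun R =>
    measurableSet_le (by fun_prop) measurable_const
  have pi : ∀ R, Integrable (p R) := fun R => qi.indicator (mset R)
  have plim : Tendsto (fun R => ∫ w, p R w) atTop (𝓝 0) := by
    have := tendsto_integral_filter_of_dominated_convergence (μ := volume) (l := atTop) (F := p)
      (f := fun _ => 0) q (Eventually.of_forall fun R => (pi R).aestronglyMeasurable)
      (Eventually.of_forall fun R => Eventually.of_forall fun w => by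
        rw [Real.norm_of_nonneg (Set.indicator_nonneg (fun w _ => q0 w) w)]
        exact Set.indicator_le_self' (fun w _ => q0 w) w) qi
      (Eventually.of_forall fun w => by
        refine tendsto_const_nhds.congr' ?_
        filter_upwards [eventually_gt_atTop (‖z₀ - w‖ + 2 * ρ)] with R hR
        have : w ∉ {w : ℂ | R - 2 * ρ ≤ ‖z₀ - w‖} := fun (h : R - 2 * ρ ≤ ‖z₀ - w‖) => by linarith
        rw [hp]; simp only [Set.indicator_of_notMem this])
    simpa using this
  set s : ℝ → ℂ → ℝ := fun R =>
    {w : ℂ | |‖z₀ - w‖ - R| ≤ 2 * ρ}.indicator fun w => 8 / R ^ 2 * (u w + K) with hs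
  have sfin : ∀ R, 4 * ρ ≤ R → volume {w : ℂ | |‖z₀ - w‖ - R| ≤ 2 * ρ} ≠ ⊤ := by
    intro R hR
    refine (lt_of_le_of_lt (measure_mono (t := Metric.closedBall z₀ (R + 2 * ρ)) fun w hw => ?_)
      measure_closedBall_lt_top).ne
    have hw' : |‖z₀ - w‖ - R| ≤ 2 * ρ := hw
    rw [abs_le] at hw'
    rw [Metric.mem_closedBall, dist_comm, dist_eq_norm]
    linarith
  have si : ∀ R, 4 * ρ ≤ R → Integrable (s R) := by
    intro R hR
    rw [hs]
    refine (integrable_indicator_iff (mshell R)).2 (Integrable.const_mul ?_ _)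
    exact hu.integrableOn.add (integrableOn_const (sfin R hR))
  have sb : ∀ R, 4 * ρ ≤ R → ∫ w, s R w ≤ 8 / R ^ 2 * (∫ w, u w) + 64 * Real.pi * ρ * K * R⁻¹ := by
    intro R hR
    have hR0 : 0 < R := by linarith
    rw [hs]
    simp only
    rw [integral_indicator (mshell R), integral_const_mul,
      integral_add hu.integrableOn (integrableOn_const (sfin R hR)), setIntegral_const, smul_eq_mul]
    have h1 : ∫ w in {w : ℂ | |‖z₀ - w‖ - R| ≤ 2 * ρ}, u w ≤ ∫ w, u w :=
      setIntegral_le_integral hu (Eventually.of_forall hu0)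
    have h2 := volume_shell_le (z₀ := z₀) hρ hR
    calc _ ≤ 8 / R ^ 2 * ((∫ w, u w) + 8 * Real.pi * ρ * R * K) := by gcongr
      _ = _ := by field_simp; ring
  have bound : ∀ R, 4 * ρ ≤ R → ∀ᵐ w,
      ‖(truncKernel R (z - w) - truncKernel R (z₀ - w)) * f w‖ ≤ p R w + s R w := by
    intro R hR
    filter_upwards [hfu] with w hw
    have hs0 : 0 ≤ s R w := by
      refine Set.indicator_nonneg (fun w _ => ?_) w
      have := hu0 w
      positivity
    by_cases h : R - 2 * ρ ≤ ‖z₀ - w‖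
    · refine (norm_truncKernel_sub_mul_le hρ hz hz₀ hfar R w).trans ?_
      rw [hp]
      simp only
      rw [Set.indicator_of_mem (by exact h)]
      refine add_le_add le_rfl ?_
      split_ifs with h2
      · rw [hs]
        simp only
        rw [Set.indicator_of_mem (by exact h2)]
        have h3 : R / 2 ≤ ‖z₀ - w‖ := by linarith
        have hR0 : 0 < R := by linarith
        refine mul_le_mul ?_ hw (norm_nonneg _) (by positivity)
        calc 2 / ‖z₀ - w‖ ^ 2 ≤ 2 / (R / 2) ^ 2 := by gcongr
          _ = 8 / R ^ 2 := by field_simp; norm_num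
      · rw [zero_mul]; exact hs0
    · have h1 : ¬ R < ‖z₀ - w‖ := by linarith
      have h2 : ¬ R < ‖z - w‖ := by
        have : ‖z - w‖ ≤ ‖z - z₀‖ + ‖z₀ - w‖ := by
          have := norm_add_le (z - z₀) (z₀ - w)
          rwa [sub_add_sub_cancel] at this
        have h3 := norm_sub_le z z₀
        linarith
      simp only [truncKernel, h1, h2, if_false, sub_zero, zero_mul, norm_zero]
      exact add_nonneg (Set.indicator_nonneg (fun w _ => q0 w) w) hs0
  have lim : Tendsto (fun R : ℝ => (∫ w, p R w) +
      (8 / R ^ 2 * (∫ w, u w) + 64 * Real.pi * ρ * K * R⁻¹)) atTop (𝓝 0) := by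
    have l1 : Tendsto (fun R : ℝ => 8 / R ^ 2) atTop (𝓝 0) :=
      tendsto_const_nhds.div_atTop (tendsto_pow_atTop two_ne_zero)
    have := plim.add ((l1.mul_const (∫ w, u w)).add
      (tendsto_inv_atTop_zero.const_mul (64 * Real.pi * ρ * K)))
    simpa using this
  refine squeeze_zero_norm' ?_ lim
  filter_upwards [eventually_ge_atTop (4 * ρ)] with R hR
  calc _ ≤ ∫ w, (p R w + s R w) :=
        norm_integral_le_of_norm_le ((pi R).add (si R hR)) (bound R hR)
    _ = (∫ w, p R w) + ∫ w, s R w := integral_add (pi R) (si R hR)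
    _ ≤ _ := by gcongr; exact sb R hR

/-- The annular kernel is the truncation at ρ minus the truncation at R, and the outer truncations
at z and z₀ cancel in the limit. So the far contributions at two points differ by an absolutely
convergent integral even if neither converges by itself. -/
theorem tendsto_annulus_sub (hf : Measurable f) (hu : Integrable u)
    (hu0 : ∀ z, 0 ≤ u z) (hK : 0 ≤ K) (hfu : ∀ᵐ z, ‖f z‖ ≤ u z + K) (hρ : 0 < ρ)
    (hz : ‖z‖ ≤ ρ) (hz₀ : ‖z₀‖ ≤ ρ) (hfar : ∀ w, ‖w‖ ≤ 6 * ρ → f w = 0) :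
    Tendsto (fun R => beurlingAnnulus f ρ R z - beurlingAnnulus f ρ R z₀) atTop
      (𝓝 (∫ w, (truncKernel ρ (z - w) - truncKernel ρ (z₀ - w)) * f w)) := by
  have hl := locallyIntegrable_of_norm_le_add hf hu hfu
  have h0 := tendsto_integral_truncKernel_sub hf hu hu0 hK hfu hρ hz hz₀ hfar
  have h1 := h0.const_sub (∫ w, (truncKernel ρ (z - w) - truncKernel ρ (z₀ - w)) * f w)
  rw [sub_zero] at h1
  refine h1.congr' ?_
  filter_upwards [eventually_ge_atTop ρ] with R hR
  have hann : ∀ x : ℂ, Integrable (fun w => annulusKernel ρ R (x - w) * f w) ∧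
      beurlingAnnulus f ρ R x = ∫ w, annulusKernel ρ R (x - w) * f w := by
    intro x
    constructor
    · have := (integrable_annulusKernel_mul hρ R hl x).comp_sub_left x
      simpa using this
    · rw [beurlingAnnulus_eq_kernelConv, kernelConv_eq_integral_sub]
  have hae : ∀ x : ℂ, ∀ᵐ w, annulusKernel ρ R (x - w) =
      truncKernel ρ (x - w) - truncKernel R (x - w) := fun x =>
    (volume.measurePreserving_sub_left x).quasiMeasurePreserving.ae (annulusKernel_eq_sub_ae
      (by linarith) hR)
  have i1 : Integrable fun w => (truncKernel ρ (z - w) - truncKernel ρ (z₀ - w)) * f w := by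
    refine ((integrable_norm_mul_inv_norm_cube hf hu hu0 hK hfu hρ hz₀ hfar).const_mul
      (8 * ρ)).mono' ?_ (Eventually.of_forall fun w =>
        norm_truncKernel_sub_mul_le_self hρ hz hz₀ hfar w)
    have := measurable_truncKernel ρ
    fun_prop
  have i2 : Integrable fun w => (truncKernel R (z - w) - truncKernel R (z₀ - w)) * f w := by
    refine (i1.sub ((hann z).1.sub (hann z₀).1)).congr ?_
    filter_upwards [hae z, hae z₀] with w h1 h2
    simp only [Pi.sub_apply, h1, h2]
    ring
  rw [(hann z).2, (hann z₀).2, ← integral_sub i1 i2, ← integral_sub (hann z).1 (hann z₀).1]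
  refine integral_congr_ae ?_
  filter_upwards [hae z, hae z₀] with w h1 h2
  rw [h1, h2]
  ring

end

/-! ### The principal value is the distributional transform -/

theorem integral_wirtingerBar_mul_truncKernel {r : ℝ} (hr : 0 < r) {ψ : ℂ → ℂ}
    (hψ : ContDiff ℝ 2 ψ) (hc : HasCompactSupport ψ) (w : ℂ) :
    ∫ z, wirtingerBar ψ z * truncKernel r (z - w) =
      -∫ t, discKernel r t * wirtinger ψ (t + w) := by
  rw [← integral_truncKernel_mul_wirtingerBar hr hψ hc w,
    ← integral_add_right_eq_self (fun z => wirtingerBar ψ z * truncKernel r (z - w)) w]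
  simp only [add_sub_cancel_right, mul_comm]

theorem integral_disc_mul_eq_zero {ρ : ℝ} {θ : ℂ → ℂ} (hθ : ∀ z, ρ < ‖z‖ → θ z = 0) {w : ℂ}
    (hw : 2 * ρ < ‖w‖) : ∫ t, discKernel ρ t * θ (t + w) = 0 := by
  refine integral_eq_zero_of_ae (Eventually.of_forall fun t => ?_)
  by_cases ht : ρ < ‖t‖
  · simp [discKernel, ht]
  · have : ρ < ‖t + w‖ := by
      have := norm_sub_norm_le w (-t)
      rw [norm_neg, sub_neg_eq_add, add_comm w t] at this
      linarith
    simp [hθ _ this]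

section
variable {f : ℂ → ℂ} {u : ℂ → ℝ} {K ρ ε R : ℝ} {z z₀ : ℂ}

theorem integrable_truncKernel_sub_mul {h : ℂ → ℂ} (hh : Integrable h) (hε : 0 < ε) (z : ℂ) :
    Integrable fun w => truncKernel ε (z - w) * h w :=
  hh.bdd_mul (c := (Real.pi * ε ^ 2)⁻¹)
    ((measurable_truncKernel ε).comp (measurable_const.sub measurable_id)).aestronglyMeasurable
    (Eventually.of_forall fun _ => norm_truncKernel_le hε _)

/-- For |z| ≤ ρ, the points w with |w| ≤ 6ρ satisfy |z - w| ≤ 7ρ < R and do not see the outer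
truncation; those with |w| > 6ρ satisfy |z - w| > 5ρ and do not see the inner one, so ε may be
replaced by ρ there. -/
theorem beurlingAnnulus_eq_add (hf : Measurable f) (hl : LocallyIntegrable f) (hρ : 0 < ρ)
    (hε : 0 < ε) (hερ : ε ≤ ρ) (hR : 7 * ρ < R) (hz : ‖z‖ ≤ ρ) :
    beurlingAnnulus f ε R z =
      kernelConv (truncKernel ε) ((Metric.closedBall 0 (6 * ρ)).indicator f) z +
        beurlingAnnulus ((Metric.closedBall 0 (6 * ρ))ᶜ.indicator f) ρ R z := by
  have hm : MeasurableSet (Metric.closedBall (0 : ℂ) (6 * ρ)) := measurableSet_closedBall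
  have i1 : Integrable ((Metric.closedBall 0 (6 * ρ)).indicator f) :=
    (integrable_indicator_iff hm).2 (hl.integrableOn_isCompact (isCompact_closedBall _ _))
  have l2 : LocallyIntegrable ((Metric.closedBall 0 (6 * ρ))ᶜ.indicator f) :=
    hl.mono (hf.indicator hm.compl).aestronglyMeasurable
      (Eventually.of_forall fun w => norm_indicator_le_norm_self _ _)
  have i2 := (integrable_annulusKernel_mul hρ R l2 z).comp_sub_left z
  simp only [sub_sub_cancel] at i2
  rw [beurlingAnnulus_eq_kernelConv, beurlingAnnulus_eq_kernelConv, kernelConv_eq_integral_sub,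
    kernelConv_eq_integral_sub, kernelConv_eq_integral_sub,
    ← integral_add (integrable_truncKernel_sub_mul i1 hε z) i2]
  congr 1
  ext w
  by_cases hw : ‖w‖ ≤ 6 * ρ
  · have hmem : w ∈ Metric.closedBall (0 : ℂ) (6 * ρ) := by simpa using hw
    have : ‖z - w‖ < R := by linarith [norm_sub_le z w]
    rw [annulusKernel_of_lt this, Set.indicator_of_mem hmem,
      Set.indicator_of_notMem (by simpa using hw)]
    ring
  · have hmem : w ∉ Metric.closedBall (0 : ℂ) (6 * ρ) := by simpa using hw
    have h5 : ρ < ‖z - w‖ := by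
      have := norm_sub_norm_le w z
      rw [norm_sub_rev] at this
      linarith
    rw [Set.indicator_of_notMem hmem, Set.indicator_of_mem (by exact hmem)]
    simp [annulusKernel, h5, hερ.trans_lt h5]

/-- The difference at `z` and `z₀` of the far contributions to the Beurling transform. -/
noncomputable def farDifference (f : ℂ → ℂ) (ρ : ℝ) (z₀ z : ℂ) : ℂ :=
  ∫ w, (truncKernel ρ (z - w) - truncKernel ρ (z₀ - w)) * f w

theorem measurable_farDifference (hf : Measurable f) (ρ : ℝ) (z₀ : ℂ) :
    Measurable (farDifference f ρ z₀) := by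
  have mK := measurable_truncKernel ρ
  refine (StronglyMeasurable.integral_prod_right' (f := fun p : ℂ × ℂ =>
    (truncKernel ρ (p.1 - p.2) - truncKernel ρ (z₀ - p.2)) * f p.2) ?_).measurable
  exact Measurable.stronglyMeasurable (by fun_prop)

theorem norm_farDifference_le (hi : Integrable fun w => ‖f w‖ * (‖z₀ - w‖ ^ 3)⁻¹)
    (hρ : 0 < ρ) (hz : ‖z‖ ≤ ρ) (hz₀ : ‖z₀‖ ≤ ρ) (hfar : ∀ w, ‖w‖ ≤ 6 * ρ → f w = 0) :
    ‖farDifference f ρ z₀ z‖ ≤ ∫ w, 8 * ρ * (‖f w‖ * (‖z₀ - w‖ ^ 3)⁻¹) :=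
  norm_integral_le_of_norm_le (hi.const_mul _)
    (Eventually.of_forall fun w => norm_truncKernel_sub_mul_le_self hρ hz hz₀ hfar w)

/-- After Fubini, the z₀ term vanishes because ∂̄ψ has integral zero. The other term is, by
transposition, an average of ∂ψ over a disc of radius ρ about w, which misses the support of ψ when
|w| > 6ρ. -/
theorem integral_wirtingerBar_mul_farDifference {ψ : ℂ → ℂ} (hψ : ContDiff ℝ 2 ψ)
    (hc : HasCompactSupport ψ) (hD : ∀ z, ρ < ‖z‖ → z ∉ tsupport ψ) (hf : Measurable f)
    (hi : Integrable fun w => ‖f w‖ * (‖z₀ - w‖ ^ 3)⁻¹)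
    (hρ : 0 < ρ) (hz₀ : ‖z₀‖ ≤ ρ) (hfar : ∀ w, ‖w‖ ≤ 6 * ρ → f w = 0) :
    ∫ z, wirtingerBar ψ z * farDifference f ρ z₀ z = 0 := by
  have mK := measurable_truncKernel ρ
  have hb0 : ∀ z, ρ < ‖z‖ → wirtingerBar ψ z = 0 := fun z hz => by
    by_contra h
    exact hD z hz (tsupport_wirtingerBar_subset h)
  have h0 : ∀ z, ρ < ‖z‖ → wirtinger ψ z = 0 := fun z hz => by
    by_contra h
    exact hD z hz (tsupport_wirtinger_subset h)
  have cb : Continuous (wirtingerBar ψ) := (contDiff_wirtingerBar hψ (m := 1) (by norm_num)).continuous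
  have ib : Integrable (wirtingerBar ψ) := cb.integrable_of_hasCompactSupport hc.wirtingerBar
  have h2 : Integrable (Function.uncurry fun z w =>
      wirtingerBar ψ z * ((truncKernel ρ (z - w) - truncKernel ρ (z₀ - w)) * f w))
      (volume.prod volume) := by
    refine (ib.norm.mul_prod (hi.const_mul (8 * ρ))).mono'
      (Measurable.aestronglyMeasurable (by fun_prop)) (Eventually.of_forall fun p => ?_)
    simp only [Function.uncurry, norm_mul (wirtingerBar ψ p.1)]
    by_cases hp : ρ < ‖p.1‖
    · simp [hb0 _ hp]
    · gcongr
      exact norm_truncKernel_sub_mul_le_self hρ (not_lt.1 hp) hz₀ hfar p.2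
  calc _ = ∫ z, ∫ w, wirtingerBar ψ z * ((truncKernel ρ (z - w) - truncKernel ρ (z₀ - w)) * f w) := by
        simp only [farDifference, integral_const_mul]
    _ = ∫ w, ∫ z, wirtingerBar ψ z * ((truncKernel ρ (z - w) - truncKernel ρ (z₀ - w)) * f w) :=
        integral_integral_swap h2
    _ = ∫ w : ℂ, (0 : ℂ) := by
        congr 1
        ext w
        by_cases hw : ‖w‖ ≤ 6 * ρ
        · simp [hfar w hw]
        · have e : ∀ z, wirtingerBar ψ z * ((truncKernel ρ (z - w) - truncKernel ρ (z₀ - w)) * f w) =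
              (wirtingerBar ψ z * truncKernel ρ (z - w) -
                wirtingerBar ψ z * truncKernel ρ (z₀ - w)) * f w := fun z => by ring
          have i1 : Integrable fun z => wirtingerBar ψ z * truncKernel ρ (z - w) :=
            ib.mul_bdd (c := (Real.pi * ρ ^ 2)⁻¹) (Measurable.aestronglyMeasurable (by fun_prop))
              (Eventually.of_forall fun z => norm_truncKernel_le hρ _)
          simp only [e]
          rw [integral_mul_const, integral_sub i1 (ib.mul_const _), integral_mul_const,
            integral_wirtingerBar_eq_zero (hψ.of_le (by norm_num)) hc,
            integral_wirtingerBar_mul_truncKernel hρ hψ hc,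
            integral_disc_mul_eq_zero h0 (by linarith)]
          simp
    _ = 0 := by simp

/-- If `Bf` exists almost everywhere as a principal value and is integrable, then it is also the
Beurling transform of `f` in the sense of distributions. -/
theorem integral_wirtingerBar_mul_beurling {ψ : ℂ → ℂ} (hψ : ContDiff ℝ 2 ψ)
    (hc : HasCompactSupport ψ) (hf : Measurable f) (hu : Integrable u)
    (hu0 : ∀ z, 0 ≤ u z) (hK : 0 ≤ K) (hfu : ∀ᵐ z, ‖f z‖ ≤ u z + K)
    (hpv : ∀ᵐ z : ℂ, ∃ l : ℂ, HasBeurlingPV f z l) (hg : Integrable (beurling f)) :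
    ∫ z, wirtingerBar ψ z * beurling f z = -∫ z, wirtinger ψ z * f z := by
  have hl := locallyIntegrable_of_norm_le_add hf hu hfu
  obtain ⟨ρ, hρ, hD⟩ : ∃ ρ > 0, ∀ z, ρ < ‖z‖ → z ∉ tsupport ψ := by
    obtain ⟨ρ, hρ⟩ := hc.isCompact.isBounded.subset_closedBall 0
    refine ⟨max ρ 1, by positivity, fun z hz h => ?_⟩
    have := hρ h
    rw [mem_closedBall_zero_iff] at this
    exact absurd (this.trans (le_max_left _ _)) (not_le.2 hz)
  have hb0 : ∀ z, ρ < ‖z‖ → wirtingerBar ψ z = 0 := fun z hz => by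
    by_contra h
    exact hD z hz (tsupport_wirtingerBar_subset h)
  have h0 : ∀ z, ρ < ‖z‖ → wirtinger ψ z = 0 := fun z hz => by
    by_contra h
    exact hD z hz (tsupport_wirtinger_subset h)
  have cb : Continuous (wirtingerBar ψ) := (contDiff_wirtingerBar hψ (m := 1) (by norm_num)).continuous
  have ct : Continuous (wirtinger ψ) := (contDiff_wirtinger hψ (m := 1) (by norm_num)).continuous
  have ib : Integrable (wirtingerBar ψ) := cb.integrable_of_hasCompactSupport hc.wirtingerBar
  obtain ⟨M₁, hM₁⟩ := cb.bounded_above_of_compact_support hc.wirtingerBar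
  obtain ⟨M₂, hM₂⟩ := ct.bounded_above_of_compact_support hc.wirtinger
  -- A reference point at which the principal value exists: the far contribution at other points is
  -- known only through its difference from the one at z₀.
  obtain ⟨z₀, ⟨l₀, hl₀⟩, hz₀'⟩ := (Measure.dense_of_ae hpv).exists_mem_open Metric.isOpen_ball
    (Metric.nonempty_ball.2 hρ : (Metric.ball (0:ℂ) ρ).Nonempty)
  have hz₀ : ‖z₀‖ ≤ ρ := (mem_ball_zero_iff.1 hz₀').le
  have hm : MeasurableSet (Metric.closedBall (0 : ℂ) (6 * ρ)) := measurableSet_closedBall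
  set f₁ := (Metric.closedBall 0 (6 * ρ)).indicator f with hf₁
  set f₂ := (Metric.closedBall 0 (6 * ρ))ᶜ.indicator f with hf₂
  have m₁ : Measurable f₁ := hf.indicator hm
  have m₂ : Measurable f₂ := hf.indicator hm.compl
  have i₁ : Integrable f₁ :=
    (integrable_indicator_iff hm).2 (hl.integrableOn_isCompact (isCompact_closedBall _ _))
  have hfar : ∀ w, ‖w‖ ≤ 6 * ρ → f₂ w = 0 := fun w hw =>
    Set.indicator_of_notMem (by simpa using hw) f
  have hfu₂ : ∀ᵐ z, ‖f₂ z‖ ≤ u z + K := hfu.mono fun z hz =>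
    (norm_indicator_le_norm_self f z).trans hz
  have hi₂ := integrable_norm_mul_inv_norm_cube m₂ hu hu0 hK hfu₂ hρ hz₀ hfar
  set k := farDifference f₂ ρ z₀ with hk
  set h := beurlingTrunc f ρ z₀ - kernelConv (truncKernel ρ) f₁ z₀ with hh
  have hlim₀ : Tendsto (fun R => beurlingAnnulus f₂ ρ R z₀) atTop (𝓝 h) := by
    refine ((hl₀.tendsto_annulus hρ).sub_const _).congr' ?_
    filter_upwards [eventually_gt_atTop (7 * ρ)] with R hR
    rw [beurlingAnnulus_eq_add hf hl hρ hρ le_rfl hR hz₀]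
    ring
  -- On the disc of radius ρ the truncations of the integrable near part differ from those of f by h
  -- + k, independent of ε. They therefore converge almost everywhere there to Bf - h - k.
  have near : ∀ ε, 0 < ε → ε ≤ ρ → ∀ z, ‖z‖ ≤ ρ → (∃ l, HasBeurlingPV f z l) →
      kernelConv (truncKernel ε) f₁ z = beurlingTrunc f ε z - h - k z := by
    rintro ε hε hερ z hz ⟨l, hl'⟩
    have t1 := (tendsto_annulus_sub m₂ hu hu0 hK hfu₂ hρ hz hz₀ hfar).add hlim₀
    have t2 := (hl'.tendsto_annulus hε).sub t1
    have t3 : Tendsto (fun _ : ℝ => kernelConv (truncKernel ε) f₁ z) atTop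
        (𝓝 (beurlingTrunc f ε z - (k z + h))) := by
      refine t2.congr' ?_
      filter_upwards [eventually_gt_atTop (7 * ρ)] with R hR
      rw [beurlingAnnulus_eq_add hf hl hρ hε hερ hR hz]
      ring
    rw [tendsto_nhds_unique tendsto_const_nhds t3]
    ring
  set ε : ℕ → ℝ := fun n => ρ / ((n : ℝ) + 1) with hε
  have ε0 : ∀ n, 0 < ε n := fun n => by positivity
  have ερ : ∀ n, ε n ≤ ρ := fun n => div_le_self hρ.le (by linarith [(n.cast_nonneg : (0:ℝ) ≤ n)])
  have εlim : Tendsto ε atTop (𝓝[>] 0) := tendsto_div_nat_succ_nhdsGT hρ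
  have hgm := hg.aestronglyMeasurable.stronglyMeasurable_mk.measurable
  have hge := hg.aestronglyMeasurable.ae_eq_mk
  set g := hg.aestronglyMeasurable.mk (beurling f) with hgdef
  have gi : Integrable g := hg.congr hge
  have km : Measurable k := measurable_farDifference m₂ ρ z₀
  have volD : volume (Metric.closedBall (0 : ℂ) ρ) ≠ ⊤ := measure_closedBall_lt_top.ne
  have kb : ∀ z, ‖z‖ ≤ ρ → ‖k z‖ ≤ ∫ w, 8 * ρ * (‖f₂ w‖ * (‖z₀ - w‖ ^ 3)⁻¹) := fun z hz =>
    norm_farDifference_le hi₂ hρ hz hz₀ hfar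
  have kD : IntegrableOn k (Metric.closedBall 0 ρ) :=
    Measure.integrableOn_of_bounded volD km.aestronglyMeasurable
      ((ae_restrict_iff' measurableSet_closedBall).2 (Eventually.of_forall fun z hz =>
        kb z (by simpa using hz)))
  have hD0 : ∀ z ∉ Metric.closedBall (0 : ℂ) ρ, wirtingerBar ψ z = 0 := fun z hz =>
    hb0 z (by simpa using hz)
  have conv := tendsto_integral_mul_kernelConv m₁ i₁ ε0 measurableSet_closedBall volD
    (G := fun z => g z - h - k z) ((hgm.sub_const h).sub km)
    ((gi.integrableOn.sub (integrableOn_const volD)).sub kD)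
    (by
      filter_upwards [hpv, hge] with z hz hgz hzD
      have hzρ : ‖z‖ ≤ ρ := by simpa using hzD
      obtain ⟨l, hl'⟩ := id hz
      have := ((hl'.tendsto_trunc.comp εlim).sub_const h).sub_const (k z)
      rw [hgz] at this
      exact this.congr fun n => (near (ε n) (ε0 n) (ερ n) z hzρ hz).symm)
    -- M₁ bounds ∂̄ψ; M₂ bounds ∂ψ and hence, by transposition, all truncated transforms of ∂̄ψ.
    cb.measurable (M := (max M₁ M₂).toNNReal)
    (fun z => by
      rw [← ofReal_norm]
      exact ENNReal.ofReal_le_ofReal ((hM₁ z).trans (le_max_left _ _))) hD0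
    (fun n w => by
      rw [integral_wirtingerBar_mul_truncKernel (ε0 n) hψ hc, enorm_neg, ← ofReal_norm]
      exact ENNReal.ofReal_le_ofReal ((norm_integral_disc_mul_le (ε0 n) fun z =>
        hM₂ (z + w)).trans (le_max_right _ _)))
  -- The same integrals evaluated a second time: transposition replaces the truncation by disc
  -- averages of ∂ψ, which converge boundedly to ∂ψ.
  have conv' : Tendsto (fun n => ∫ z, wirtingerBar ψ z * kernelConv (truncKernel (ε n)) f₁ z) atTop
      (𝓝 (∫ w, -wirtinger ψ w * f₁ w)) := by
    simp only [fun n => integral_mul_kernelConv_trunc (ε0 n) ib i₁,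
      fun n w => integral_wirtingerBar_mul_truncKernel (ε0 n) hψ hc w]
    have md : ∀ n, Measurable fun w => ∫ t, discKernel (ε n) t * wirtinger ψ (t + w) := fun n => by
      have := measurable_discKernel (ε n)
      have := ct.measurable
      refine (StronglyMeasurable.integral_prod_left' (f := fun p : ℂ × ℂ =>
        discKernel (ε n) p.1 * wirtinger ψ (p.1 + p.2)) ?_).measurable
      exact Measurable.stronglyMeasurable (by fun_prop)
    refine tendsto_integral_of_dominated_convergence (fun w => M₂ * ‖f₁ w‖)
      (fun n => ((md n).neg.mul m₁).aestronglyMeasurable) (i₁.norm.const_mul _)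
      (fun n => Eventually.of_forall fun w => ?_) (Eventually.of_forall fun w => ?_)
    · rw [norm_mul, norm_neg]
      gcongr
      exact norm_integral_disc_mul_le (ε0 n) fun z => hM₂ (z + w)
    · exact ((tendsto_integral_disc_mul ct hc.wirtinger ε0
        (εlim.mono_right nhdsWithin_le_nhds) w).neg).mul_const _
  have key := tendsto_nhds_unique conv conv'
  -- The constant h and the far difference k are both annihilated by ∂̄ψ.
  have e1 : ∫ z, wirtingerBar ψ z * (g z - h - k z) = ∫ z, wirtingerBar ψ z * beurling f z := by
    have j1 : Integrable fun z => wirtingerBar ψ z * g z :=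
      gi.bdd_mul cb.aestronglyMeasurable (Eventually.of_forall hM₁)
    have j2 : Integrable fun z => wirtingerBar ψ z * h := ib.mul_const h
    have j3 : Integrable fun z => wirtingerBar ψ z * k z := by
      have : IntegrableOn (fun z => wirtingerBar ψ z * k z) (Metric.closedBall 0 ρ) :=
        kD.bdd_mul cb.aestronglyMeasurable (Eventually.of_forall hM₁)
      rwa [integrableOn_iff_integrable_of_support_subset] at this
      intro z hz
      by_contra hzD
      exact hz (by simp [hD0 z hzD])
    have j12 : Integrable fun z => wirtingerBar ψ z * g z - wirtingerBar ψ z * h := j1.sub j2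
    simp only [mul_sub]
    rw [integral_sub j12 j3, integral_sub j1 j2, integral_mul_const,
      integral_wirtingerBar_eq_zero (hψ.of_le (by norm_num)) hc,
      integral_wirtingerBar_mul_farDifference hψ hc hD m₂ hi₂ hρ hz₀ hfar, zero_mul, sub_zero,
      sub_zero]
    exact integral_congr_ae (hge.mono fun z hz => by simp only [hz])
  rw [← e1, key, ← integral_neg]
  congr 1
  ext w
  by_cases hw : ‖w‖ ≤ 6 * ρ
  · rw [hf₁, Set.indicator_of_mem (by simpa using hw), neg_mul]
  · rw [h0 w (by linarith)]
    simp

end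

/-! ### Annular truncations tested against the distributional equation -/

section
variable {r R : ℝ} {h : ℂ → ℂ}

theorem wirtinger_kernelConv_cauchyKernel (hr : 0 < r) (hh : ContDiff ℝ 1 h)
    (hc : HasCompactSupport h) (z : ℂ) :
    wirtinger (kernelConv (cauchyKernel r) h) z = -kernelConv (truncKernel r) h z ∧
    wirtingerBar (kernelConv (cauchyKernel r) h) z = kernelConv (discKernel r) h z := by
  have lk : LocallyIntegrable (cauchyKernel r) :=
    (lipschitzWith_cauchyKernel hr).continuous.locallyIntegrable
  simp only [wirtinger, wirtingerBar, fderiv_kernelConv lk hh hc,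
    kernelConv_cauchyKernel_fderiv hr hh hc, map_one, Complex.conj_I]
  constructor
  · linear_combination (2⁻¹ * (kernelConv (discKernel r) h z + kernelConv (truncKernel r) h z)) *
      Complex.I_mul_I
  · linear_combination -(2⁻¹ * (kernelConv (discKernel r) h z + kernelConv (truncKernel r) h z)) *
      Complex.I_mul_I

theorem fderiv_comp_const_sub' {V : ℂ → ℂ} (hV : Differentiable ℝ V) (z w v : ℂ) :
    fderiv ℝ (fun x => V (z - x)) w v = -fderiv ℝ V (z - w) v := by
  have := ((hV (z - w)).hasFDerivAt).comp w ((hasFDerivAt_id w).const_sub z)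
  have e := this.fderiv
  simp only [Function.comp_def] at e
  rw [e]
  simp

/-- Testing the distributional identity `∂̄(Bf) = ∂f` against a mollified difference of
regularised Cauchy kernels. -/
theorem integral_kernelConv_disc_mul_eq {f g : ℂ → ℂ} (hr : 0 < r) (hrR : r ≤ R)
    (weak : ∀ ψ : ℂ → ℂ, ContDiff ℝ 2 ψ → HasCompactSupport ψ →
      ∫ z, wirtingerBar ψ z * g z = -∫ z, wirtinger ψ z * f z)
    (hh : ContDiff ℝ 2 h) (hc : HasCompactSupport h) (z : ℂ) :
    ∫ w, kernelConv (fun t => discKernel r t - discKernel R t) h (z - w) * g w =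
      ∫ w, kernelConv (annulusKernel r R) h (z - w) * f w := by
  have hR : 0 < R := hr.trans_le hrR
  have hh1 : ContDiff ℝ 1 h := hh.of_le (by norm_num)
  have lk : ∀ s, 0 < s → LocallyIntegrable (cauchyKernel s) := fun s hs =>
    (lipschitzWith_cauchyKernel hs).continuous.locallyIntegrable
  have cV : ∀ s, 0 < s → ContDiff ℝ 2 (kernelConv (cauchyKernel s) h) := fun s hs =>
    contDiff_kernelConv (n := 2) (lk s hs) hh hc
  have ksub : ∀ (κ₁ κ₂ : ℂ → ℂ) (C₁ C₂ : ℝ), Measurable κ₁ → Measurable κ₂ →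
      (∀ t, ‖κ₁ t‖ ≤ C₁) → (∀ t, ‖κ₂ t‖ ≤ C₂) → ∀ x, kernelConv (fun t => κ₁ t - κ₂ t) h x =
        kernelConv κ₁ h x - kernelConv κ₂ h x := by
    intro κ₁ κ₂ C₁ C₂ m₁ m₂ b₁ b₂ x
    have cx : Continuous fun t => h (x - t) := hh.continuous.comp (continuous_const.sub continuous_id)
    have hx : HasCompactSupport fun t => h (x - t) := hc.comp_homeomorph (Homeomorph.subLeft x)
    rw [kernelConv, kernelConv, kernelConv,
      ← integral_sub (integrable_bdd_mul_of_hasCompactSupport m₁ b₁ cx hx)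
        (integrable_bdd_mul_of_hasCompactSupport m₂ b₂ cx hx)]
    simp only [sub_mul]
  set V : ℂ → ℂ := fun x => kernelConv (cauchyKernel r) h x - kernelConv (cauchyKernel R) h x with hV
  have V2 : ContDiff ℝ 2 V := (cV r hr).sub (cV R hR)
  have Vd : Differentiable ℝ V := V2.differentiable (by norm_num)
  have Vf : ∀ x v, fderiv ℝ V x v = fderiv ℝ (kernelConv (cauchyKernel r) h) x v -
      fderiv ℝ (kernelConv (cauchyKernel R) h) x v := fun x v => by
    rw [hV, fderiv_fun_sub ((cV r hr).differentiable (by norm_num) x)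
      ((cV R hR).differentiable (by norm_num) x)]
    rfl
  -- Beyond radius R both Cauchy kernels equal 1/(πw), so their difference has compact support;
  -- convolution with h makes it C², hence an admissible test function.
  have Vc : HasCompactSupport V := by
    have e : V = kernelConv (fun t => cauchyKernel r t - cauchyKernel R t) h := by
      ext x
      have b := fun s (hs : 0 < s) t => (norm_cauchyKernel_le hs t).trans
        (show (Real.pi * max ‖t‖ s)⁻¹ ≤ (Real.pi * s)⁻¹ by gcongr; exact le_max_right _ _)
      rw [ksub _ _ _ _ (lipschitzWith_cauchyKernel hr).continuous.measurable
        (lipschitzWith_cauchyKernel hR).continuous.measurable (b r hr) (b R hR)]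
    rw [e, kernelConv_eq_convolution]
    refine HasCompactSupport.convolution _ (HasCompactSupport.intro
      (isCompact_closedBall (0:ℂ) R) fun x hx => ?_) hc
    have hx' : R < ‖x‖ := by simpa using hx
    simp [cauchyKernel, max_eq_left hx'.le, max_eq_left (hrR.trans hx'.le)]
  have hψ : ContDiff ℝ 2 fun w => V (z - w) := V2.comp (contDiff_const.sub contDiff_id)
  have hψc : HasCompactSupport fun w => V (z - w) := Vc.comp_homeomorph (Homeomorph.subLeft z)
  have key := weak _ hψ hψc
  have e1 : ∀ w, wirtingerBar (fun w => V (z - w)) w =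
      -kernelConv (fun t => discKernel r t - discKernel R t) h (z - w) := by
    intro w
    rw [ksub _ _ _ _ (measurable_discKernel r) (measurable_discKernel R) (norm_discKernel_le (r := r))
      (norm_discKernel_le (r := R)), ← (wirtinger_kernelConv_cauchyKernel hr hh1 hc _).2,
      ← (wirtinger_kernelConv_cauchyKernel hR hh1 hc _).2]
    simp only [wirtingerBar, fderiv_comp_const_sub' Vd, Vf]
    ring
  have e2 : ∀ w, wirtinger (fun w => V (z - w)) w = kernelConv (annulusKernel r R) h (z - w) := by
    intro w
    have e3 : kernelConv (annulusKernel r R) h (z - w) =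
        kernelConv (fun t => truncKernel r t - truncKernel R t) h (z - w) :=
      integral_congr_ae ((annulusKernel_eq_sub_ae hR hrR).mono fun t ht => by simp only [ht])
    rw [e3, ksub _ _ _ _ (measurable_truncKernel r) (measurable_truncKernel R)
      (norm_truncKernel_le hr) (norm_truncKernel_le hR),
      ← neg_neg (kernelConv (truncKernel r) h _), ← neg_neg (kernelConv (truncKernel R) h _),
      ← (wirtinger_kernelConv_cauchyKernel hr hh1 hc _).1,
      ← (wirtinger_kernelConv_cauchyKernel hR hh1 hc _).1]
    simp only [wirtinger, fderiv_comp_const_sub' Vd, Vf]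
    ring
  simp only [e1, e2, neg_mul, integral_neg, neg_inj] at key
  exact key

end

/-! ### Removal of the mollifier and the mean value identity -/

/-- A smooth approximate identity on the plane. -/
noncomputable def planeBump (n : ℕ) : ContDiffBump (0 : ℂ) where
  rIn := 1 / (2 * ((n : ℝ) + 1))
  rOut := 1 / ((n : ℝ) + 1)
  rIn_pos := by positivity
  rIn_lt_rOut := by
    have : (0:ℝ) < n + 1 := by positivity
    gcongr
    linarith

noncomputable def mollifier (n : ℕ) (x : ℂ) : ℂ := ((planeBump n).normed volume x : ℝ)

theorem contDiff_mollifier (n : ℕ) : ContDiff ℝ 2 (mollifier n) :=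
  Complex.ofRealCLM.contDiff.comp (planeBump n).contDiff_normed

theorem hasCompactSupport_mollifier (n : ℕ) : HasCompactSupport (mollifier n) :=
  (planeBump n).hasCompactSupport_normed.comp_left (g := fun x : ℝ => (x : ℂ)) (by simp)

theorem mollifier_eq_zero {n : ℕ} {x : ℂ} (hx : 1 < ‖x‖) : mollifier n x = 0 := by
  have : (planeBump n).normed volume x = 0 := by
    rw [← Function.notMem_support, (planeBump n).support_normed_eq, mem_ball_zero_iff, not_lt]
    refine le_trans ?_ hx.le
    show 1 / ((n : ℝ) + 1) ≤ 1
    rw [div_le_one (by positivity)]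
    linarith [(n.cast_nonneg : (0:ℝ) ≤ n)]
  simp [mollifier, this]

theorem norm_kernelConv_mollifier_le {κ : ℂ → ℂ} {C : ℝ} (hC : ∀ t, ‖κ t‖ ≤ C) (n : ℕ) (x : ℂ) :
    ‖kernelConv κ (mollifier n) x‖ ≤ C := by
  rw [kernelConv_eq_integral_sub]
  calc _ ≤ ∫ y, C * (planeBump n).normed volume y := by
        refine norm_integral_le_of_norm_le ((planeBump n).integrable_normed.const_mul C)
          (Eventually.of_forall fun y => ?_)
        rw [norm_mul, mollifier, Complex.norm_real, Real.norm_of_nonneg ((planeBump n).nonneg_normed y)]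
        gcongr
        · exact (planeBump n).nonneg_normed y
        · exact hC _
    _ = C := by rw [integral_const_mul, (planeBump n).integral_normed, mul_one]

theorem kernelConv_mollifier_eq_zero {κ : ℂ → ℂ} {S : ℝ} (hS : ∀ t, S < ‖t‖ → κ t = 0) (n : ℕ)
    {x : ℂ} (hx : S + 1 < ‖x‖) : kernelConv κ (mollifier n) x = 0 := by
  refine integral_eq_zero_of_ae (Eventually.of_forall fun t => ?_)
  by_cases ht : S < ‖t‖
  · simp [hS t ht]
  · have : 1 < ‖x - t‖ := by linarith [norm_sub_norm_le x t]
    simp [mollifier_eq_zero this]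

theorem tendsto_kernelConv_mollifier {κ : ℂ → ℂ} (hκ : Measurable κ) {x : ℂ}
    (hx : ContinuousAt κ x) : Tendsto (fun n => kernelConv κ (mollifier n) x) atTop (𝓝 (κ x)) := by
  have := ContDiffBump.convolution_tendsto_right (μ := volume) (φ := planeBump)
    (g := fun _ => κ) (k := fun _ => x) (x₀ := x) (z₀ := κ x) (l := atTop)
    (tendsto_one_div_add_atTop_nhds_zero_nat (𝕜 := ℝ)) (Eventually.of_forall fun _ =>
      hκ.aestronglyMeasurable) (hx.tendsto.comp tendsto_snd) tendsto_const_nhds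
  refine this.congr fun n => ?_
  rw [kernelConv_eq_integral_sub, convolution]
  congr 1
  ext y
  simp [mollifier, mul_comm]

/-- Off its discontinuities, a bounded kernel of bounded support may be integrated by mollifying. -/
theorem tendsto_integral_kernelConv_mollifier_mul {κ f : ℂ → ℂ} {C S : ℝ} (hκ : Measurable κ)
    (hC : ∀ t, ‖κ t‖ ≤ C) (hS : ∀ t, S < ‖t‖ → κ t = 0) (hcont : ∀ᵐ t, ContinuousAt κ t)
    (hf : LocallyIntegrable f) (z : ℂ) :
    Tendsto (fun n => ∫ w, kernelConv κ (mollifier n) (z - w) * f w) atTop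
      (𝓝 (∫ w, κ (z - w) * f w)) := by
  have hi : IntegrableOn f (Metric.closedBall z (S + 1)) :=
    hf.integrableOn_isCompact (isCompact_closedBall _ _)
  have hm : MeasurableSet (Metric.closedBall z (S + 1)) := measurableSet_closedBall
  refine tendsto_integral_of_dominated_convergence
    (fun w => C * ‖(Metric.closedBall z (S + 1)).indicator f w‖) (fun n => ?_)
    (((integrable_indicator_iff hm).2 hi).norm.const_mul C) (fun n => ?_) ?_
  · exact ((measurable_kernelConv hκ (contDiff_mollifier n).continuous.measurable).comp
      (measurable_const.sub measurable_id)).aestronglyMeasurable.mul hf.aestronglyMeasurable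
  · refine Eventually.of_forall fun w => ?_
    rw [norm_mul]
    by_cases hw : S + 1 < ‖z - w‖
    · rw [kernelConv_mollifier_eq_zero hS n hw, norm_zero, zero_mul]
      have := (norm_nonneg _).trans (hC 0)
      positivity
    · rw [Set.indicator_of_mem]
      · gcongr
        exact norm_kernelConv_mollifier_le hC n _
      · rw [Metric.mem_closedBall, dist_comm, dist_eq_norm]
        exact not_lt.1 hw
  · filter_upwards [(volume.measurePreserving_sub_left z).quasiMeasurePreserving.ae hcont] with w hw
    exact (tendsto_kernelConv_mollifier hκ hw).mul_const _

theorem continuousAt_discKernel {r : ℝ} {t : ℂ} (ht : ‖t‖ ≠ r) : ContinuousAt (discKernel r) t := by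
  rcases lt_or_gt_of_ne ht with h | h
  · refine (continuousAt_const (y := ((Real.pi * r ^ 2 : ℝ) : ℂ)⁻¹)).congr ?_
    filter_upwards [continuous_norm.continuousAt.eventually_lt continuousAt_const h] with s hs
    simp [discKernel, hs.le.not_gt]
  · refine (continuousAt_const (y := (0 : ℂ))).congr ?_
    filter_upwards [continuousAt_const.eventually_lt continuous_norm.continuousAt h] with s hs
    simp [discKernel, hs]

theorem continuousAt_annulusKernel {r R : ℝ} (hr : 0 < r) {t : ℂ} (ht : ‖t‖ ≠ r) (ht' : ‖t‖ ≠ R) :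
    ContinuousAt (annulusKernel r R) t := by
  rcases lt_or_gt_of_ne ht with h | h
  · refine (continuousAt_const (y := (0 : ℂ))).congr ?_
    filter_upwards [continuous_norm.continuousAt.eventually_lt continuousAt_const h] with s hs
    simp [annulusKernel, hs.le.not_gt]
  rcases lt_or_gt_of_ne ht' with h' | h'
  · have t0 : t ≠ 0 := norm_pos_iff.1 (hr.trans h)
    have : ContinuousAt (fun w : ℂ => ((Real.pi : ℂ) * w ^ 2)⁻¹) t :=
      ContinuousAt.inv₀ (by fun_prop) (by simp [t0, Real.pi_ne_zero])
    refine this.congr ?_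
    filter_upwards [continuous_norm.continuousAt.eventually_lt continuousAt_const h',
      continuousAt_const.eventually_lt continuous_norm.continuousAt h] with s hs hs'
    simp [annulusKernel, hs, hs']
  · refine (continuousAt_const (y := (0 : ℂ))).congr ?_
    filter_upwards [continuousAt_const.eventually_lt continuous_norm.continuousAt h'] with s hs
    simp [annulusKernel, hs.le.not_gt]

section
variable {f g : ℂ → ℂ} {r R : ℝ}

/-- The annular truncations of the Beurling transform are differences of averages of its
distributional limit. -/
theorem beurlingAnnulus_eq_sub (hr : 0 < r) (hrR : r ≤ R) (hf : LocallyIntegrable f)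
    (hg : Integrable g) (weak : ∀ ψ : ℂ → ℂ, ContDiff ℝ 2 ψ → HasCompactSupport ψ →
      ∫ z, wirtingerBar ψ z * g z = -∫ z, wirtinger ψ z * f z) (z : ℂ) :
    beurlingAnnulus f r R z =
      (∫ w, discKernel r (z - w) * g w) - ∫ w, discKernel R (z - w) * g w := by
  have hR : 0 < R := hr.trans_le hrR
  have md : ∀ s, Measurable fun w => discKernel s (z - w) := fun s =>
    (measurable_discKernel s).comp (measurable_const.sub measurable_id)
  have di : ∀ s, Integrable fun w => discKernel s (z - w) * g w := fun s =>
    hg.bdd_mul (md s).aestronglyMeasurable (Eventually.of_forall fun w => norm_discKernel_le (z - w))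
  rw [← integral_sub (di r) (di R), beurlingAnnulus_eq_kernelConv, kernelConv_eq_integral_sub]
  have t1 := tendsto_integral_kernelConv_mollifier_mul (S := R) (measurable_annulusKernel r R)
    (norm_annulusKernel_le hr R) (fun t ht => by simp [annulusKernel, ht.le.not_gt])
    (by
      filter_upwards [ae_norm_ne r hr.ne', ae_norm_ne R hR.ne'] with t h1 h2
      exact continuousAt_annulusKernel hr h1 h2) hf z
  have t2 := tendsto_integral_kernelConv_mollifier_mul (S := R)
    (κ := fun t => discKernel r t - discKernel R t)
    ((measurable_discKernel r).sub (measurable_discKernel R))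
    (fun t => (norm_sub_le _ _).trans (add_le_add (norm_discKernel_le t) (norm_discKernel_le t)))
    (fun t ht => by simp [discKernel, ht, hrR.trans_lt ht])
    (by
      filter_upwards [ae_norm_ne r hr.ne', ae_norm_ne R hR.ne'] with t h1 h2
      exact (continuousAt_discKernel h1).sub (continuousAt_discKernel h2)) hg.locallyIntegrable z
  simp only [← sub_mul]
  refine tendsto_nhds_unique t1 (t2.congr fun n => ?_)
  exact integral_kernelConv_disc_mul_eq hr hrR weak (contDiff_mollifier n)
    (hasCompactSupport_mollifier n) z

/-- The mean of g over the disc of radius R is at most ‖g‖₁ / (πR²) and drops out. The limit exists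
at every z, so no exceptional points have to be removed for the supremum over r. -/
theorem beurlingTrunc_eq (hr : 0 < r) (hf : LocallyIntegrable f)
    (hg : Integrable g) (weak : ∀ ψ : ℂ → ℂ, ContDiff ℝ 2 ψ → HasCompactSupport ψ →
      ∫ z, wirtingerBar ψ z * g z = -∫ z, wirtinger ψ z * f z) (z : ℂ) :
    beurlingTrunc f r z = ∫ w, discKernel r (z - w) * g w := by
  refine Tendsto.limUnder_eq ?_
  have h0 : Tendsto (fun R : ℝ => ∫ w, discKernel R (z - w) * g w) atTop (𝓝 0) := by
    have lim : Tendsto (fun R : ℝ => (Real.pi * R ^ 2)⁻¹ * ∫ w, ‖g w‖) atTop (𝓝 0) := by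
      have : Tendsto (fun R : ℝ => (Real.pi * R ^ 2)⁻¹) atTop (𝓝 0) :=
        tendsto_inv_atTop_zero.comp
          ((tendsto_pow_atTop two_ne_zero).const_mul_atTop Real.pi_pos)
      simpa using this.mul_const (∫ w, ‖g w‖)
    refine squeeze_zero_norm (fun R => ?_) lim
    rw [← integral_const_mul]
    refine norm_integral_le_of_norm_le (hg.norm.const_mul _) (Eventually.of_forall fun w => ?_)
    rw [norm_mul]
    gcongr
    exact norm_discKernel_le _
  have := h0.const_sub (∫ w, discKernel r (z - w) * g w)
  rw [sub_zero] at this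
  refine this.congr' ?_
  filter_upwards [eventually_ge_atTop r] with R hR
  exact (beurlingAnnulus_eq_sub hr hR hf hg weak z).symm

end

/-! ### Reduction to a measurable representative and the maximal inequality -/

theorem beurlingAnnulus_congr_ae {f f' : ℂ → ℂ} (h : f =ᵐ[volume] f') :
    beurlingAnnulus f = beurlingAnnulus f' := by
  funext ε R z
  unfold beurlingAnnulus
  congr 1
  refine integral_congr_ae (ae_restrict_of_ae ?_)
  filter_upwards [(volume.measurePreserving_sub_left z).quasiMeasurePreserving.ae h] with w hw
  rw [hw]

theorem beurlingTrunc_congr_ae {f f' : ℂ → ℂ} (h : f =ᵐ[volume] f') :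
    beurlingTrunc f = beurlingTrunc f' := by
  funext ε z
  rw [beurlingTrunc, beurlingTrunc, beurlingAnnulus_congr_ae h]

theorem maximalBeurling_congr_ae {f f' : ℂ → ℂ} (h : f =ᵐ[volume] f') :
    maximalBeurling f = maximalBeurling f' := by
  funext z
  rw [maximalBeurling, maximalBeurling, beurlingTrunc_congr_ae h]

theorem beurlingL1Norm_congr_ae {f f' : ℂ → ℂ} (h : f =ᵐ[volume] f') :
    beurlingL1Norm f = beurlingL1Norm f' := by
  have h1 : HasBeurlingPV f = HasBeurlingPV f' := by
    funext z l
    rw [HasBeurlingPV, HasBeurlingPV, beurlingAnnulus_congr_ae h, beurlingTrunc_congr_ae h]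
  have h2 : beurling f = beurling f' := by
    funext z
    rw [beurling, beurling, beurlingTrunc_congr_ae h]
  rw [beurlingL1Norm, beurlingL1Norm, h1, h2]

/-- For finite q one has |f| ≤ |f|^q + 1, and for q = ∞ the essential supremum serves as K. This
single form of the hypothesis covers all exponents. -/
theorem exists_integrable_add_const_of_memLp {f : ℂ → ℂ} {q : ℝ≥0∞} (hq : 1 ≤ q)
    (hf : MemLp f q) :
    ∃ (u : ℂ → ℝ) (K : ℝ), Integrable u ∧ (∀ z, 0 ≤ u z) ∧ 0 ≤ K ∧ ∀ᵐ z, ‖f z‖ ≤ u z + K := by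
  rcases eq_or_ne q ⊤ with rfl | hqt
  · refine ⟨fun _ => 0, (eLpNormEssSup f volume).toReal, integrable_zero _ _ _, fun _ => le_rfl,
      ENNReal.toReal_nonneg, ?_⟩
    have ht : eLpNormEssSup f volume ≠ ⊤ := by
      have := hf.2
      rw [eLpNorm_exponent_top] at this
      exact this.ne
    filter_upwards [ae_le_eLpNormEssSup (f := f) (μ := volume)] with z hz
    rw [zero_add, ← toReal_enorm]
    exact ENNReal.toReal_mono ht hz
  · have hq0 : q ≠ 0 := (one_pos.trans_le hq).ne'
    refine ⟨fun z => ‖f z‖ ^ q.toReal, 1, hf.integrable_norm_rpow hq0 hqt, fun z => by positivity,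
      zero_le_one, Eventually.of_forall fun z => ?_⟩
    have hq1 : 1 ≤ q.toReal := by
      simpa using ENNReal.toReal_mono hqt hq
    rcases le_total ‖f z‖ 1 with h | h
    · have : 0 ≤ ‖f z‖ ^ q.toReal := by positivity
      linarith
    · have := Real.self_le_rpow_of_one_le h hq1
      linarith

theorem enorm_integral_discKernel_mul_le {g : ℂ → ℂ} {r : ℝ} (z : ℂ) :
    ‖∫ w, discKernel r (z - w) * g w‖ₑ ≤
      ENNReal.ofReal (Real.pi * r ^ 2)⁻¹ * ∫⁻ w in Metric.closedBall z r, ‖g w‖ₑ := by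
  refine (enorm_integral_le_lintegral_enorm _).trans ?_
  rw [← lintegral_const_mul' _ _ ENNReal.ofReal_ne_top, ← lintegral_indicator measurableSet_closedBall]
  refine lintegral_mono fun w => ?_
  by_cases hw : r < ‖z - w‖
  · simp [discKernel, hw]
  · rw [Set.indicator_of_mem (by rw [Metric.mem_closedBall, dist_comm, dist_eq_norm]; exact not_lt.1 hw),
      enorm_mul]
    gcongr
    rw [← ofReal_norm]
    exact ENNReal.ofReal_le_ofReal (norm_discKernel_le _)

theorem volume_closedBall_five_mul (z : ℂ) (r : ℝ) :
    volume (Metric.closedBall z (5 * r)) = 25 * volume (Metric.closedBall z r) := by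
  rw [Complex.volume_closedBall, Complex.volume_closedBall, ENNReal.ofReal_mul (by norm_num), mul_pow,
    mul_assoc]
  congr 1
  rw [← ENNReal.ofReal_pow (by norm_num)]
  norm_num

/-- Vitali's covering argument: the weak type `(1, 1)` bound for the Hardy–Littlewood maximal
operator over discs. -/
theorem mul_volume_le_of_forall_closedBall {g : ℂ → ℂ} (hg : ∫⁻ w, ‖g w‖ₑ ≠ ⊤) {t : ℝ≥0}
    (ht : t ≠ 0) {E : Set ℂ}
    (hE : ∀ z ∈ E, ∃ r > 0, t * volume (Metric.closedBall z r) ≤ ∫⁻ w in Metric.closedBall z r, ‖g w‖ₑ) :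
    t * volume E ≤ 25 * ∫⁻ w, ‖g w‖ₑ := by
  have ht' : (t : ℝ≥0∞) ≠ 0 := by exact_mod_cast ht
  choose! r hr0 hr using hE
  -- Vitali's lemma needs bounded radii: tπr² ≤ ‖g‖₁, where π is weakened to 1.
  have hbound : ∀ z ∈ E, r z ≤ Real.sqrt ((∫⁻ w, ‖g w‖ₑ) / t).toReal := by
    intro z hz
    refine Real.le_sqrt_of_sq_le ?_
    have h1 : volume (Metric.closedBall z (r z)) ≤ (∫⁻ w, ‖g w‖ₑ) / t := by
      rw [ENNReal.le_div_iff_mul_le (Or.inl ht') (Or.inl ENNReal.coe_ne_top), mul_comm]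
      exact (hr z hz).trans (setLIntegral_le_lintegral _ _)
    have h2 := ENNReal.toReal_mono (ENNReal.div_ne_top hg ht') h1
    rw [Complex.volume_closedBall, ENNReal.toReal_mul, ENNReal.toReal_pow,
      ENNReal.toReal_ofReal (hr0 z hz).le] at h2
    refine le_trans ?_ h2
    have : (1:ℝ) ≤ ((NNReal.pi : ℝ≥0∞)).toReal := by
      simp only [ENNReal.coe_toReal, NNReal.coe_real_pi]
      linarith [Real.pi_gt_three]
    nlinarith [sq_nonneg (r z)]
  obtain ⟨v, hvE, hdisj, hcov⟩ := Vitali.exists_disjoint_subfamily_covering_enlargement_closedBall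
    E (fun z => z) r _ hbound 5 (by norm_num)
  have hvc : v.Countable := hdisj.countable_of_nonempty_interior fun z hz =>
    (Metric.nonempty_ball.2 (hr0 z (hvE hz))).mono Metric.ball_subset_interior_closedBall
  have hsub : E ⊆ ⋃ b ∈ v, Metric.closedBall b (5 * r b) := by
    intro z hz
    obtain ⟨b, hb, hzb⟩ := hcov z hz
    exact Set.mem_biUnion hb (hzb (Metric.mem_closedBall_self (hr0 z hz).le))
  calc t * volume E ≤ t * ∑' b : v, volume (Metric.closedBall (b : ℂ) (5 * r b)) := by
        gcongr
        exact (measure_mono hsub).trans (measure_biUnion_le volume hvc _)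
    _ = 25 * ∑' b : v, t * volume (Metric.closedBall (b : ℂ) (r b)) := by
        rw [← ENNReal.tsum_mul_left, ← ENNReal.tsum_mul_left]
        congr 1
        ext b
        rw [volume_closedBall_five_mul]
        ring
    _ ≤ 25 * ∑' b : v, ∫⁻ w in Metric.closedBall (b : ℂ) (r b), ‖g w‖ₑ := by
        gcongr with b
        exact hr b (hvE b.2)
    _ = 25 * ∫⁻ w in ⋃ b ∈ v, Metric.closedBall b (r b), ‖g w‖ₑ := by
        rw [lintegral_biUnion hvc (fun b _ => measurableSet_closedBall) hdisj]
    _ ≤ _ := by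
        gcongr
        exact Measure.restrict_le_self

/-- As B^r f(z) is a mean of Bf over a disc about z, each point with B^⋆f(z) > t is the centre of a
disc on which |Bf| has mean at least t. Vitali's argument applies to these discs. -/
theorem weakL1Norm_maximalBeurling_le {f : ℂ → ℂ} {u : ℂ → ℝ} {K : ℝ} (hf : Measurable f)
    (hu : Integrable u) (hu0 : ∀ z, 0 ≤ u z) (hK : 0 ≤ K) (hfu : ∀ᵐ z, ‖f z‖ ≤ u z + K)
    (hpv : ∀ᵐ z : ℂ, ∃ l : ℂ, HasBeurlingPV f z l) (hg : ∫⁻ z, ‖beurling f z‖ₑ ≠ ⊤) :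
    weakL1Norm (maximalBeurling f) ≤ 25 * ∫⁻ z, ‖beurling f z‖ₑ := by
  have gi : Integrable (beurling f) :=
    ⟨(aemeasurable_beurling hf hpv).aestronglyMeasurable, lt_top_iff_ne_top.2 hg⟩
  refine iSup_le fun t => ?_
  rcases eq_or_ne t 0 with rfl | ht
  · simp
  refine mul_volume_le_of_forall_closedBall hg ht fun z hz => ?_
  have hz' : (t : ℝ≥0∞) < maximalBeurling f z := hz
  simp only [maximalBeurling, lt_iSup_iff] at hz'
  obtain ⟨r, hr, hlt⟩ := hz'
  refine ⟨r, hr, ?_⟩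
  rw [beurlingTrunc_eq hr (locallyIntegrable_of_norm_le_add hf hu hfu) gi fun ψ hψ hc =>
    integral_wirtingerBar_mul_beurling hψ hc hf hu hu0 hK hfu hpv gi] at hlt
  have h1 := hlt.le.trans (enorm_integral_discKernel_mul_le z)
  have hvol : volume (Metric.closedBall z r) = ENNReal.ofReal (Real.pi * r ^ 2) := by
    rw [Complex.volume_closedBall, ← ENNReal.ofReal_pow hr.le, mul_comm,
      ENNReal.ofReal_mul Real.pi_pos.le]
    congr 1
    rw [← NNReal.coe_real_pi, ENNReal.ofReal_coe_nnreal]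
  have hpos : 0 < Real.pi * r ^ 2 := by positivity
  calc _ ≤ (ENNReal.ofReal (Real.pi * r ^ 2)⁻¹ * ∫⁻ w in Metric.closedBall z r, ‖beurling f w‖ₑ) *
        volume (Metric.closedBall z r) := by gcongr
    _ = (ENNReal.ofReal (Real.pi * r ^ 2)⁻¹ * ENNReal.ofReal (Real.pi * r ^ 2)) *
        ∫⁻ w in Metric.closedBall z r, ‖beurling f w‖ₑ := by rw [hvol]; ring
    _ = _ := by
      rw [← ENNReal.ofReal_mul (by positivity), inv_mul_cancel₀ hpos.ne', ENNReal.ofReal_one, one_mul]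

theorem theorem3 :
    ∃ C : ℝ≥0, ∀ (q : ℝ≥0∞), 1 ≤ q → ∀ f : ℂ → ℂ, MemLp f q volume →
      weakL1Norm (maximalBeurling f) ≤ (C : ℝ≥0∞) * beurlingL1Norm f := by
  refine ⟨25, fun q hq f hf => ?_⟩
  have hae := hf.1.ae_eq_mk
  set f' := hf.1.mk f
  have hf' : MemLp f' q := (memLp_congr_ae hae).1 hf
  have hm : Measurable f' := hf.1.stronglyMeasurable_mk.measurable
  rw [maximalBeurling_congr_ae hae, beurlingL1Norm_congr_ae hae]
  obtain ⟨u, K, hu, hu0, hK, hfu⟩ := exists_integrable_add_const_of_memLp hq hf'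
  by_cases htop : beurlingL1Norm f' = ⊤
  · rw [htop, ENNReal.mul_top (by norm_num)]
    exact le_top
  by_cases hpv : ∀ᵐ z : ℂ, ∃ l : ℂ, HasBeurlingPV f' z l
  · rw [beurlingL1Norm, if_pos hpv] at htop ⊢
    exact_mod_cast weakL1Norm_maximalBeurling_le hm hu hu0 hK hfu hpv htop
  · exact absurd (by rw [beurlingL1Norm, if_neg hpv]) htop
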